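/- Let $\theta>0$. Let $\mathcal A=(S(\mathbb R^2),\star)$ be the Moyal algebra of complex Schwartz functions on the plane, with product $$(f\star g)(x)=\frac{1}{(\pi\theta)^2}\int_{\mathbb R^2}\int_{\mathbb R^2} f(x+u)\,g(x+v)\,e^{-\frac{2i}{\theta}\,u\,\Theta_0^{-1}v}\,dv\,du,\qquad \Theta_0=\begin{pmatrix}0&1\\-1&0\end{pmatrix},$$ and involution $f^*=\bar f$. It acts on $\mathcal H=L^2(\mathbb R^2)\otimes\mathbb C^2$ by $f\mapsto \mathcal L(f)\otimes\mathbb I$, where $\mathcal L(f)\psi=f\star\psi$. Let $D=-i\gamma^\mu\partial_\mu$ be the Dirac operator of the plane, with $\gamma^1=\begin{pmatrix}0&1\\1&0\end{pmatrix}$, $\gamma^2=\begin{pmatrix}0&i\\-i&0\end{pmatrix}$, and let $\Gamma=\mathrm{diag}(1,-1)$ be the grading. For $\Lambda\in\mathbb C$ let $D_I=\begin{pmatrix}0&\bar\Lambda\\ \Lambda&0\end{pmatrix}$ on $\mathbb C^2$, on which the algebra $\mathbb C^2$ acts by diagonal matrices, and let $\delta^1,\delta^2$ be the two pure states $\delta^i(z_1,z_2)=z_i$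 of $\mathbb C^2$. The product of the Moyal plane by $\mathbb C^2$ is $$\mathcal A'=\mathcal A\otimes\mathbb C^2,\qquad \mathcal H'=\mathcal H\otimes\mathbb C^2,\qquad D'=D\otimes\mathbb I+\Gamma\otimes D_I .$$ For such a triple $(\mathcal B,\mathcal K,\mathcal D)$ the spectral distance is $$d_{\mathcal D}(\varphi_1,\varphi_2)=\sup_{a\in\mathcal B}\{|\varphi_1(a)-\varphi_2(a)| : \|[\mathcal D,a]\|\le 1\}\in[0,\infty].$$ A state of $\mathcal A$ means a state of its $C^*$-closure in the operator norm of the representation. For a state $\varphi$ of $\mathcal A$ and $\kappa\in\mathbb R^2$ let $(\alpha_\kappa\varphi)(f)=\varphi(f(\cdot+\kappa))$, and let $\mathcal C(\varphi)=\{\alpha_\kappa\varphi:\kappa\in\mathbb R^2\}$. For a state $\omega$ of $\mathcal A$, write $\omega^i=\omega\otimes\delta^i$, that is, $\omega^i(a_1,a_2)=\omega(a_i)$. Then for every state $\varphi$ of $\mathcal A$ and all $\omega,\tilde\omega\in\mathcal C(\varphi)$, $$d_{D'}^2(\omega^1,\tilde\omega^2)=d_D^2(\omega,\tilde\omega)+d_{D_I}^2(\delta^1,\delta^2),$$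 as an identity in $[0,\infty]$ (both sides are infinite if $\Lambda=0$). -/

import Mathlib

noncomputable section

namespace MoyalPlane

open MeasureTheory SchwartzMap
open scoped FourierTransform LineDeriv ENNReal ComplexConjugate

/-! ### Schwartz functions on the plane -/

/-- The Euclidean plane `ℝ²`. -/
abbrev Plane : Type := EuclideanSpace ℝ (Fin 2)

/-- The space `S(ℝ²)` of complex Schwartz functions on the plane. -/
abbrev Alg : Type := SchwartzMap Plane ℂ

section helpers

open scoped ContDiff

theorem schwartz_bound {V : Type} [NormedAddCommGroup V] [NormedSpace ℝ V]
    (F : SchwartzMap (Plane × Plane) V) (k : ℕ) :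
    ∃ C : ℝ, 0 ≤ C ∧ ∀ p : Plane × Plane, (1 + ‖p‖) ^ k * ‖F p‖ ≤ C := by
  refine ⟨2 ^ k * ((Finset.Iic (k, 0)).sup fun m => SchwartzMap.seminorm ℝ m.1 m.2) F,
    by positivity, fun p => ?_⟩
  simpa using one_add_le_sup_seminorm_apply (𝕜 := ℝ) (m := (k, 0)) (k := k) (n := 0)
    le_rfl le_rfl F p

theorem exists_weight : ∃ n : ℕ,
    Integrable (fun u : Plane => (1 + ‖u‖) ^ (-(n : ℝ))) volume :=
  (inferInstance : (volume : Measure Plane).HasTemperateGrowth).exists_integrable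

theorem slice_bound {V : Type} [NormedAddCommGroup V] [NormedSpace ℝ V]
    (F : SchwartzMap (Plane × Plane) V) (k : ℕ) :
    ∃ b : Plane → ℝ, Integrable b volume ∧ ∀ x u, ‖x‖ ^ k * ‖F (x, u)‖ ≤ b u := by
  obtain ⟨n, hn⟩ := exists_weight
  obtain ⟨C, hC, hb⟩ := schwartz_bound F (k + n)
  refine ⟨fun u => C * (1 + ‖u‖) ^ (-(n : ℝ)), hn.const_mul C, fun x u => ?_⟩
  have h1 := hb (x, u)
  have hu : (0 : ℝ) < (1 + ‖u‖) ^ n := by positivity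
  change _ ≤ C * (1 + ‖u‖) ^ (-(n : ℝ))
  rw [Real.rpow_neg (by positivity), Real.rpow_natCast, ← div_eq_mul_inv, le_div_iff₀ hu]
  refine le_trans ?_ h1
  have hx : ‖x‖ ≤ 1 + ‖(x, u)‖ := by
    have := norm_fst_le (x, u); simp only at this; linarith
  have hu' : 1 + ‖u‖ ≤ 1 + ‖(x, u)‖ := by
    have := norm_snd_le (x, u); simp only at this; linarith
  rw [pow_add]
  calc ‖x‖ ^ k * ‖F (x, u)‖ * (1 + ‖u‖) ^ n
      = ‖x‖ ^ k * (1 + ‖u‖) ^ n * ‖F (x, u)‖ := by ring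
    _ ≤ _ := by gcongr

theorem slice_integrable {V : Type} [NormedAddCommGroup V] [NormedSpace ℝ V]
    (F : SchwartzMap (Plane × Plane) V) (x : Plane) :
    Integrable (fun u => F (x, u)) volume := by
  obtain ⟨b, hb, h⟩ := slice_bound F 0
  refine hb.mono' ?_ (.of_forall fun u => by simpa using h x u)
  exact (F.continuous.comp (by fun_prop)).aestronglyMeasurable

/-- The derivative in the first variable. -/
def fderivFst {V : Type} [NormedAddCommGroup V] [NormedSpace ℝ V]
    (F : SchwartzMap (Plane × Plane) V) : SchwartzMap (Plane × Plane) (Plane →L[ℝ] V) :=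
  SchwartzMap.postcompCLM (𝕜 := ℝ)
    ((ContinuousLinearMap.compL ℝ Plane (Plane × Plane) V).flip
      (ContinuousLinearMap.inl ℝ Plane Plane)) (SchwartzMap.fderivCLM ℝ (Plane × Plane) V F)

theorem fderivFst_apply {V : Type} [NormedAddCommGroup V] [NormedSpace ℝ V]
    (F : SchwartzMap (Plane × Plane) V) (p : Plane × Plane) :
    fderivFst F p = (fderiv ℝ F p).comp (ContinuousLinearMap.inl ℝ Plane Plane) := rfl

theorem slice_hasFDerivAt {V : Type} [NormedAddCommGroup V] [NormedSpace ℝ V]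
    (F : SchwartzMap (Plane × Plane) V) (x : Plane) :
    HasFDerivAt (fun x => ∫ u, F (x, u)) (∫ u, fderivFst F (x, u)) x := by
  obtain ⟨b, hb, h⟩ := slice_bound (fderivFst F) 0
  refine hasFDerivAt_integral_of_dominated_of_fderiv_le (s := Set.univ) (bound := b)
    (F' := fun x u => fderivFst F (x, u)) Filter.univ_mem ?_ (slice_integrable F x) ?_ ?_ hb ?_
  · exact .of_forall fun y => (slice_integrable F y).aestronglyMeasurable
  · exact (slice_integrable (fderivFst F) x).aestronglyMeasurable
  · exact .of_forall fun u y _ => by simpa using h y u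
  · refine .of_forall fun u y _ => ?_
    rw [fderivFst_apply]
    exact (F.hasFDerivAt (y, u)).comp y (hasFDerivAt_prodMk_left y u)

theorem slice_contDiff (n : ℕ) : ∀ {V : Type} [NormedAddCommGroup V] [NormedSpace ℝ V]
    (F : SchwartzMap (Plane × Plane) V), ContDiff ℝ n (fun x => ∫ u, F (x, u)) := by
  induction n with
  | zero =>
    intro V _ _ F
    exact contDiff_zero.2 (continuous_iff_continuousAt.2 fun x =>
      (slice_hasFDerivAt F x).continuousAt)
  | succ n ih =>
    intro V _ _ F
    refine (contDiff_succ_iff_hasFDerivAt (n := n)).2 ⟨_, ih (fderivFst F), slice_hasFDerivAt F⟩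

theorem slice_decay (k n : ℕ) : ∀ {V : Type} [NormedAddCommGroup V] [NormedSpace ℝ V]
    (F : SchwartzMap (Plane × Plane) V),
    ∃ C : ℝ, ∀ x, ‖x‖ ^ k * ‖iteratedFDeriv ℝ n (fun x => ∫ u, F (x, u)) x‖ ≤ C := by
  induction n with
  | zero =>
    intro V _ _ F
    obtain ⟨b, hb, h⟩ := slice_bound F k
    refine ⟨∫ u, b u, fun x => ?_⟩
    rw [norm_iteratedFDeriv_zero]
    calc ‖x‖ ^ k * ‖∫ u, F (x, u)‖ ≤ ‖x‖ ^ k * ∫ u, ‖F (x, u)‖ := by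
          gcongr; exact norm_integral_le_integral_norm _
      _ = ∫ u, ‖x‖ ^ k * ‖F (x, u)‖ := (integral_const_mul _ _).symm
      _ ≤ _ := integral_mono ((slice_integrable F x).norm.const_mul _) hb (h x)
  | succ n ih =>
    intro V _ _ F
    obtain ⟨C, hC⟩ := ih (fderivFst F)
    refine ⟨C, fun x => ?_⟩
    rw [← norm_iteratedFDeriv_fderiv, show fderiv ℝ (fun x => ∫ u, F (x, u)) =
      fun x => ∫ u, fderivFst F (x, u) from funext fun y => (slice_hasFDerivAt F y).fderiv]
    exact hC x

theorem norm_iteratedFDeriv_comp_le {f : Plane → ℂ} (hf : ContDiff ℝ ∞ f)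
    (L : (Plane × Plane) →L[ℝ] Plane) (hL : ‖L‖ ≤ 1) (n : ℕ) (p : Plane × Plane) :
    ‖iteratedFDeriv ℝ n (fun p => f (L p)) p‖ ≤ ‖iteratedFDeriv ℝ n f (L p)‖ := by
  have := L.iteratedFDeriv_comp_right hf p (i := n) (mod_cast le_top)
  rw [show (fun p => f (L p)) = f ∘ L from rfl, this]
  refine (ContinuousMultilinearMap.norm_compContinuousLinearMap_le _ _).trans ?_
  refine mul_le_of_le_one_right (norm_nonneg _) ?_
  exact Finset.prod_le_one (fun _ _ => norm_nonneg _) fun _ _ => hL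

/-- The function `(x, u) ↦ f(x) g(u)`. -/
def tensor (f g : Alg) : SchwartzMap (Plane × Plane) ℂ where
  toFun p := f p.1 * g p.2
  smooth' := ((f.smooth ⊤).comp contDiff_fst).mul ((g.smooth ⊤).comp contDiff_snd)
  decay' k n := by
    refine ⟨∑ i ∈ Finset.range (n + 1), (n.choose i : ℝ) *
      (SchwartzMap.seminorm ℝ k i f * SchwartzMap.seminorm ℝ 0 (n - i) g +
       SchwartzMap.seminorm ℝ 0 i f * SchwartzMap.seminorm ℝ k (n - i) g), fun p => ?_⟩
    have h := norm_iteratedFDeriv_mul_le (𝕜 := ℝ) (N := ∞)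
      (f := fun p : Plane × Plane => f p.1) (g := fun p : Plane × Plane => g p.2)
      ((f.smooth ⊤).comp contDiff_fst) ((g.smooth ⊤).comp contDiff_snd) p (n := n)
      (mod_cast le_top)
    refine (mul_le_mul_of_nonneg_left h (by positivity)).trans ?_
    rw [Finset.mul_sum]
    refine Finset.sum_le_sum fun i _ => ?_
    have h1 := norm_iteratedFDeriv_comp_le (f.smooth ⊤) (ContinuousLinearMap.fst ℝ Plane Plane)
      (ContinuousLinearMap.norm_fst_le ..) i p
    have h2 := norm_iteratedFDeriv_comp_le (g.smooth ⊤) (ContinuousLinearMap.snd ℝ Plane Plane)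
      (ContinuousLinearMap.norm_snd_le ..) (n - i) p
    simp only [ContinuousLinearMap.coe_fst', ContinuousLinearMap.coe_snd'] at h1 h2
    have hp : ‖p‖ ^ k ≤ ‖p.1‖ ^ k + ‖p.2‖ ^ k := by
      rw [Prod.norm_def]
      rcases max_cases ‖p.1‖ ‖p.2‖ with ⟨h, _⟩ | ⟨h, _⟩ <;> rw [h] <;>
        simp only [le_add_iff_nonneg_right, le_add_iff_nonneg_left] <;> positivity
    have a1 := f.le_seminorm ℝ k i p.1
    have a2 := f.le_seminorm ℝ 0 i p.1
    have b1 := g.le_seminorm ℝ k (n - i) p.2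
    have b2 := g.le_seminorm ℝ 0 (n - i) p.2
    rw [pow_zero, one_mul] at a2 b2
    calc ‖p‖ ^ k * ((n.choose i : ℝ) * ‖iteratedFDeriv ℝ i (fun p => f p.1) p‖ *
          ‖iteratedFDeriv ℝ (n - i) (fun p => g p.2) p‖)
        ≤ (‖p.1‖ ^ k + ‖p.2‖ ^ k) * ((n.choose i : ℝ) * ‖iteratedFDeriv ℝ i f p.1‖ *
          ‖iteratedFDeriv ℝ (n - i) g p.2‖) := by gcongr
      _ = (n.choose i : ℝ) * ((‖p.1‖ ^ k * ‖iteratedFDeriv ℝ i f p.1‖) *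
            ‖iteratedFDeriv ℝ (n - i) g p.2‖ +
          ‖iteratedFDeriv ℝ i f p.1‖ * (‖p.2‖ ^ k * ‖iteratedFDeriv ℝ (n - i) g p.2‖)) := by ring
      _ ≤ _ := by gcongr

theorem phase_temperate {q : Plane × Plane → ℝ} (hq : q.HasTemperateGrowth) :
    Function.HasTemperateGrowth (fun p => Complex.exp ((q p : ℂ) * Complex.I)) := by
  have h : Function.HasTemperateGrowth (fun t : ℝ => Complex.exp ((t : ℂ) * Complex.I)) := by
    refine ⟨(Complex.ofRealCLM.contDiff.mul contDiff_const).cexp, fun n => ⟨0, 1, fun t => ?_⟩⟩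
    have key : ∀ n : ℕ, iteratedDeriv n (fun t : ℝ => Complex.exp ((t : ℂ) * Complex.I)) =
        fun t : ℝ => Complex.I ^ n * Complex.exp ((t : ℂ) * Complex.I) := by
      intro n
      induction n with
      | zero => simp
      | succ n ih =>
        rw [iteratedDeriv_succ, ih]
        funext t
        have h1 : HasDerivAt (fun t : ℝ => (t : ℂ) * Complex.I) Complex.I t := by
          simpa using (Complex.ofRealCLM.hasDerivAt (x := t)).mul_const Complex.I
        rw [(h1.cexp.const_mul (Complex.I ^ n)).deriv]
        ring
    rw [norm_iteratedFDeriv_eq_norm_iteratedDeriv, key]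
    simp [Complex.norm_exp_ofReal_mul_I]
  exact h.comp hq

end helpers

/-! ### The Moyal product -/

/-- The bilinear form `u Θ₀⁻¹ v` on the plane, where `Θ₀` has rows `(0, 1)` and `(-1, 0)`. -/
def form (u v : Plane) : ℝ := u 1 * v 0 - u 0 * v 1

/-- The Moyal product as a function:
`(f ⋆ g)(x) = (πθ)⁻² ∫∫ f(x+u) g(x+v) exp(-(2i/θ) u Θ₀⁻¹ v) dv du`. -/
def moyalFun (θ : ℝ) (f g : Plane → ℂ) (x : Plane) : ℂ :=
  ((1 / (Real.pi * θ)) ^ 2 : ℝ) *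
    ∫ u : Plane, ∫ v : Plane,
      f (x + u) * g (x + v) * Complex.exp (-(2 * Complex.I / θ) * form u v)

section helpers

theorem form_sub (u v w : Plane) : form u (v - w) = form u v - form u w := by
  simp [form]; ring

/-- The linear map `u ↦ (u₁, -u₀) / (πθ)`. -/
def rot (θ : ℝ) (u : Plane) : Plane :=
  (1 / (Real.pi * θ)) • !₂[u 1, -u 0]

theorem inner_rot (θ : ℝ) (u w : Plane) :
    inner ℝ w (rot θ u) = (1 / (Real.pi * θ)) * form u w := by
  simp [rot, form, PiLp.inner_apply, Fin.sum_univ_two]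
  ring

/-- The linear change of variables `(x, u) ↦ (x + u, (u₁, -u₀) / (πθ))`. -/
def shear (θ : ℝ) (hθ : θ ≠ 0) : (Plane × Plane) ≃L[ℝ] (Plane × Plane) :=
  LinearEquiv.toContinuousLinearEquiv
    { toFun := fun p => (p.1 + p.2, rot θ p.2)
      map_add' := fun p q => by
        ext i
        · simp; ring
        · fin_cases i <;> simp [rot] <;> ring
      map_smul' := fun c p => by
        ext i
        · simp
        · fin_cases i <;> simp [rot] <;> ring
      invFun := fun p => (p.1 - (Real.pi * θ) • !₂[-p.2 1, p.2 0],
        (Real.pi * θ) • !₂[-p.2 1, p.2 0])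
      left_inv := fun p => by
        have := Real.pi_ne_zero
        ext i
        · fin_cases i <;> simp [rot] <;> field_simp <;> ring
        · fin_cases i <;> simp [rot] <;> field_simp
      right_inv := fun p => by
        have := Real.pi_ne_zero
        ext i
        · simp
        · fin_cases i <;> simp [rot] <;> field_simp }

theorem form_temperate (θ : ℝ) :
    Function.HasTemperateGrowth (fun p : Plane × Plane => 2 / θ * form p.2 p.1) := by
  have h (i : Fin 2) : Function.HasTemperateGrowth (fun p : Plane × Plane => p.1 i) :=
    ((EuclideanSpace.proj (𝕜 := ℝ) i).comp
      (ContinuousLinearMap.fst ℝ Plane Plane)).hasTemperateGrowth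
  have h' (i : Fin 2) : Function.HasTemperateGrowth (fun p : Plane × Plane => p.2 i) :=
    ((EuclideanSpace.proj (𝕜 := ℝ) i).comp
      (ContinuousLinearMap.snd ℝ Plane Plane)).hasTemperateGrowth
  exact (Function.HasTemperateGrowth.const (2 / θ)).mul
    (((h' 1).mul (h 0)).sub ((h' 0).mul (h 1)))

/-- The Schwartz function on `ℝ² × ℝ²` whose integral over the second variable is the Moyal
product up to a constant. -/
def moyalIntegrand (θ : ℝ) (hθ : θ ≠ 0) (f g : Alg) : SchwartzMap (Plane × Plane) ℂ :=
  SchwartzMap.smulLeftCLM ℂ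
    (fun p : Plane × Plane => Complex.exp (((2 / θ * form p.2 p.1 : ℝ) : ℂ) * Complex.I))
    (SchwartzMap.compCLMOfContinuousLinearEquiv ℂ (shear θ hθ) (tensor f (𝓕 g)))

theorem moyalIntegrand_apply (θ : ℝ) (hθ : θ ≠ 0) (f g : Alg) (x u : Plane) :
    moyalIntegrand θ hθ f g (x, u) =
      Complex.exp (((2 / θ * form u x : ℝ) : ℂ) * Complex.I) *
        (f (x + u) * (𝓕 g : Alg) (rot θ u)) := by
  rw [moyalIntegrand, SchwartzMap.smulLeftCLM_apply_apply (phase_temperate (form_temperate θ))]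
  rfl

theorem moyal_inner (θ : ℝ) (hθ : θ ≠ 0) (f g : Alg) (x u : Plane) :
    ∫ v : Plane, f (x + u) * g (x + v) * Complex.exp (-(2 * Complex.I / θ) * form u v) =
      moyalIntegrand θ hθ f g (x, u) := by
  have hpi : (Real.pi : ℂ) ≠ 0 := by exact_mod_cast Real.pi_ne_zero
  have hθ' : (θ : ℂ) ≠ 0 := by exact_mod_cast hθ
  have h1 := integral_add_left_eq_self (μ := (volume : Measure Plane)) (fun w : Plane =>
    f (x + u) * g w * Complex.exp (-(2 * Complex.I / θ) * form u (w - x))) x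
  simp only [add_sub_cancel_left] at h1
  rw [h1, moyalIntegrand_apply, SchwartzMap.fourier_coe, Real.fourier_eq', ← mul_assoc,
    ← integral_const_mul]
  congr 1
  funext w
  rw [inner_rot, form_sub, smul_eq_mul]
  have h2 : Complex.exp (-(2 * Complex.I / θ) * ((form u w - form u x : ℝ) : ℂ)) =
      Complex.exp (((2 / θ * form u x : ℝ) : ℂ) * Complex.I) *
        Complex.exp (((-2 * Real.pi * (1 / (Real.pi * θ) * form u w) : ℝ) : ℂ) * Complex.I) := by
    rw [← Complex.exp_add]
    congr 1
    push_cast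
    field_simp
    ring
  rw [h2]
  ring

theorem moyalFun_eq (θ : ℝ) (hθ : θ ≠ 0) (f g : Alg) (x : Plane) :
    moyalFun θ f g x = ((1 / (Real.pi * θ)) ^ 2 : ℝ) * ∫ u, moyalIntegrand θ hθ f g (x, u) := by
  simp only [moyalFun, moyal_inner θ hθ]

theorem moyalFun_zero (f g : Plane → ℂ) (x : Plane) : moyalFun 0 f g x = 0 := by
  simp [moyalFun]

end helpers

/-- The Moyal product `f ⋆ g` of Schwartz functions, which is again a Schwartz function. -/
def moyal (θ : ℝ) (f g : Alg) : Alg where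
  toFun := moyalFun θ f g
  smooth' := by
    rcases eq_or_ne θ 0 with rfl | hθ
    · rw [funext (moyalFun_zero f g)]; exact contDiff_const
    · rw [funext (moyalFun_eq θ hθ f g)]
      exact contDiff_const.mul (contDiff_infty.2 fun n => slice_contDiff n _)
  decay' k n := by
    rcases eq_or_ne θ 0 with rfl | hθ
    · rw [funext (moyalFun_zero f g)]
      refine ⟨0, fun x => ?_⟩
      have : iteratedFDeriv ℝ n (fun _ : Plane => (0 : ℂ)) x = 0 := by
        rw [iteratedFDeriv_fun_zero]; rfl
      simp [this]
    · rw [funext (moyalFun_eq θ hθ f g)]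
      obtain ⟨C, hC⟩ := slice_decay k n (moyalIntegrand θ hθ f g)
      set c : ℂ := (((1 / (Real.pi * θ)) ^ 2 : ℝ) : ℂ)
      refine ⟨‖c‖ * C, fun x => ?_⟩
      have hs := iteratedFDeriv_const_smul_apply' (𝕜 := ℝ) (i := n) (a := c) (x := x)
        (f := fun x => ∫ u, moyalIntegrand θ hθ f g (x, u))
        (slice_contDiff n (moyalIntegrand θ hθ f g)).contDiffAt
      simp only [smul_eq_mul] at hs
      rw [hs, norm_smul, mul_left_comm]
      exact mul_le_mul_of_nonneg_left (hC x) (norm_nonneg _)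

/-- Left multiplication `L(f) g = f ⋆ g`, linear in `f` and in `g`. -/
def leftMul (θ : ℝ) : Alg →ₗ[ℂ] Alg →ₗ[ℂ] Alg :=
  LinearMap.mk₂ ℂ (moyal θ)
    (fun f f' g => by
      ext x
      change moyalFun θ (f + f' : Alg) g x = moyalFun θ f g x + moyalFun θ f' g x
      rcases eq_or_ne θ 0 with rfl | hθ
      · simp [moyalFun_zero]
      rw [moyalFun_eq θ hθ, moyalFun_eq θ hθ, moyalFun_eq θ hθ, ← mul_add,
        ← integral_add (slice_integrable _ x) (slice_integrable _ x)]
      congr 2; funext u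
      simp only [moyalIntegrand_apply, add_apply]; ring)
    (fun c f g => by
      ext x
      change moyalFun θ (c • f : Alg) g x = c * moyalFun θ f g x
      rcases eq_or_ne θ 0 with rfl | hθ
      · simp [moyalFun_zero]
      rw [moyalFun_eq θ hθ, moyalFun_eq θ hθ, mul_left_comm, ← integral_const_mul c]
      congr 2; funext u
      simp only [moyalIntegrand_apply, smul_apply, smul_eq_mul]; ring)
    (fun f g g' => by
      ext x
      change moyalFun θ f (g + g' : Alg) x = moyalFun θ f g x + moyalFun θ f g' x
      rcases eq_or_ne θ 0 with rfl | hθ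
      · simp [moyalFun_zero]
      rw [moyalFun_eq θ hθ, moyalFun_eq θ hθ, moyalFun_eq θ hθ, ← mul_add,
        ← integral_add (slice_integrable _ x) (slice_integrable _ x)]
      congr 2; funext u
      simp only [moyalIntegrand_apply, FourierTransform.fourier_add, add_apply]; ring)
    (fun c f g => by
      ext x
      change moyalFun θ f (c • g : Alg) x = c * moyalFun θ f g x
      rcases eq_or_ne θ 0 with rfl | hθ
      · simp [moyalFun_zero]
      rw [moyalFun_eq θ hθ, moyalFun_eq θ hθ, mul_left_comm, ← integral_const_mul c]
      congr 2; funext u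
      simp only [moyalIntegrand_apply, FourierTransform.fourier_smul, smul_apply,
        smul_eq_mul]; ring)

/-- The involution `f ↦ f^*`, pointwise complex conjugation. -/
def conjAlg (f : Alg) : Alg :=
  SchwartzMap.postcompCLM (𝕜 := ℝ) (Complex.conjCLE : ℂ →L[ℝ] ℂ) f

theorem conjAlg_apply (f : Alg) (x : Plane) : conjAlg f x = conj (f x) := rfl

theorem moyal_apply (θ : ℝ) (f g : Alg) (x : Plane) : moyal θ f g x = moyalFun θ f g x := rfl

/-! ### Spectral triples and the spectral distance -/

/-- The data `(A, H, D)` of a spectral triple, the operators being given on a common invariant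
core: `V` is the core, `core` its inclusion in the Hilbert space `H`, `rep` the action of the
algebra `A` and `dirac` the operator `D`. -/
structure SpectralData (A V H : Type) [AddCommGroup A] [Module ℂ A] [AddCommGroup V] [Module ℂ V]
    [NormedAddCommGroup H] [InnerProductSpace ℂ H] where
  core : V →ₗ[ℂ] H
  rep : A →ₗ[ℂ] V →ₗ[ℂ] V
  dirac : V →ₗ[ℂ] V

namespace SpectralData

variable {A V H : Type} [AddCommGroup A] [Module ℂ A] [AddCommGroup V] [Module ℂ V]
  [NormedAddCommGroup H] [InnerProductSpace ℂ H]

/-- The operator `T`, given on the core, has operator norm at most `1` on the Hilbert space. -/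
def Contractive (S : SpectralData A V H) (T : V →ₗ[ℂ] V) : Prop :=
  ∀ ψ : V, ‖S.core (T ψ)‖ ≤ ‖S.core ψ‖

/-- The commutator `[D, a]`. -/
def comm (S : SpectralData A V H) (a : A) : V →ₗ[ℂ] V :=
  S.dirac ∘ₗ S.rep a - S.rep a ∘ₗ S.dirac

/-- The spectral distance `d_D(φ₁, φ₂) = sup { |φ₁(a) - φ₂(a)| : a ∈ A, ‖[D, a]‖ ≤ 1 }`,
with values in `[0, ∞]`. -/
def spectralDist (S : SpectralData A V H) (φ₁ φ₂ : A →ₗ[ℂ] ℂ) : ℝ≥0∞ :=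
  ⨆ (a : A) (_ : S.Contractive (S.comm a)), ENNReal.ofReal ‖φ₁ a - φ₂ a‖

end SpectralData

/-- The matrix `D_I = (0, Λ̄; Λ, 0)`. -/
def diracI (Λ : ℂ) : Matrix (Fin 2) (Fin 2) ℂ := !![0, conj Λ; Λ, 0]

/-- The diagonal action of `ℂ²`, acting on pairs of vectors in `M` through an action of `A`. -/
def diagRep {A M : Type} [AddCommGroup A] [Module ℂ A] [AddCommGroup M] [Module ℂ M]
    (ρ : A →ₗ[ℂ] M →ₗ[ℂ] M) : (Fin 2 → A) →ₗ[ℂ] (Fin 2 → M) →ₗ[ℂ] (Fin 2 → M) :=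
  LinearMap.mk₂ ℂ (fun a ψ i => ρ (a i) (ψ i))
    (fun a a' ψ => by ext i; simp) (fun c a ψ => by ext i; simp)
    (fun a ψ ψ' => by ext i; simp) (fun c a ψ => by ext i; simp)

/-- The spectral triple `(ℂ², ℂ², D_I)`, with `ℂ²` acting on itself by diagonal matrices. -/
def twoPoint (Λ : ℂ) : SpectralData (Fin 2 → ℂ) (Fin 2 → ℂ) (EuclideanSpace ℂ (Fin 2)) where
  core := (WithLp.linearEquiv 2 ℂ (Fin 2 → ℂ)).symm.toLinearMap
  rep := diagRep (LinearMap.mul ℂ ℂ)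
  dirac := Matrix.toLin' (diracI Λ)

/-- The pure state `δ_i` of `ℂ²`: `δ_i (z₁, z₂) = z_i`. -/
def delta (i : Fin 2) : (Fin 2 → ℂ) →ₗ[ℂ] ℂ := LinearMap.proj i

/-- The product of the spectral triple `S`, with grading `Γ`, by the triple `(ℂ², ℂ², D_I)`:
`A' = A ⊗ ℂ²`, `H' = H ⊗ ℂ²`, `D' = D ⊗ 1 + Γ ⊗ D_I`, where `X ⊗ ℂ²` is realised as `X × X`. -/
def SpectralData.double {A V H : Type} [AddCommGroup A] [Module ℂ A] [AddCommGroup V] [Module ℂ V]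
    [NormedAddCommGroup H] [InnerProductSpace ℂ H] (S : SpectralData A V H)
    (Γ : V →ₗ[ℂ] V) (Λ : ℂ) :
    SpectralData (Fin 2 → A) (Fin 2 → V) (PiLp 2 fun _ : Fin 2 => H) where
  core := (WithLp.linearEquiv 2 ℂ (Fin 2 → H)).symm.toLinearMap ∘ₗ
    LinearMap.pi fun i => S.core ∘ₗ LinearMap.proj i
  rep := diagRep S.rep
  dirac := LinearMap.pi fun i =>
    S.dirac ∘ₗ LinearMap.proj i + ∑ j, diracI Λ i j • (Γ ∘ₗ LinearMap.proj j)

/-- The state `ω^i = (ω, δ_i) = ω ⊗ δ_i` of `A ⊗ ℂ²`: `ω^i (a₁, a₂) = ω (a_i)`. -/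
def sheet {A : Type} [AddCommGroup A] [Module ℂ A] (ω : A →ₗ[ℂ] ℂ) (i : Fin 2) :
    (Fin 2 → A) →ₗ[ℂ] ℂ :=
  ω ∘ₗ LinearMap.proj i

/-! ### The Moyal plane -/

/-- Spinors with Schwartz components, a core in `L²(ℝ²) ⊗ ℂ²`. -/
abbrev Spinor : Type := Fin 2 → Alg

/-- The Hilbert space `L²(ℝ²) ⊗ ℂ²`. -/
abbrev SpinorL2 : Type := PiLp 2 fun _ : Fin 2 => Lp ℂ 2 (volume : Measure Plane)

/-- The Dirac matrices of the plane. -/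
def gam : Fin 2 → Matrix (Fin 2) (Fin 2) ℂ :=
  ![!![0, 1; 1, 0], !![0, Complex.I; -Complex.I, 0]]

theorem gam_clifford (μ ν : Fin 2) :
    gam μ * gam ν + gam ν * gam μ = if μ = ν then (2 : ℂ) • 1 else 0 := by
  fin_cases μ <;> fin_cases ν <;> ext i j <;> fin_cases i <;> fin_cases j <;>
    simp [gam] <;> norm_num

/-- The partial derivative `∂_μ`. -/
def partialDeriv (μ : Fin 2) : Alg →ₗ[ℂ] Alg :=
  (LineDeriv.lineDerivOpCLM ℂ Alg (EuclideanSpace.single μ (1 : ℝ) : Plane)).toLinearMap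

/-- The Dirac operator `D = -i γ^μ ∂_μ`. -/
def planeDirac : Spinor →ₗ[ℂ] Spinor :=
  LinearMap.pi fun s =>
    (-Complex.I) • ∑ μ, ∑ t, gam μ s t • (partialDeriv μ ∘ₗ LinearMap.proj t)

/-- The grading `Γ = diag(1, -1)` of `L²(ℝ²) ⊗ ℂ²`. -/
def grading : Spinor →ₗ[ℂ] Spinor :=
  LinearMap.pi fun s => (![1, -1] s : ℂ) • LinearMap.proj s

/-- The spectral triple of the Moyal plane: the algebra `(S(ℝ²), ⋆)` acting on `L²(ℝ²) ⊗ ℂ²` by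
`L(f) ⊗ 1`, with the Dirac operator of the plane. -/
def moyalTriple (θ : ℝ) : SpectralData Alg Spinor SpinorL2 where
  core := (WithLp.linearEquiv 2 ℂ (Fin 2 → Lp ℂ 2 (volume : Measure Plane))).symm.toLinearMap ∘ₗ
    LinearMap.pi fun i =>
      (SchwartzMap.toLpCLM ℂ ℂ 2 (volume : Measure Plane)).toLinearMap ∘ₗ LinearMap.proj i
  rep := LinearMap.mk₂ ℂ (fun f ψ i => leftMul θ f (ψ i))
    (fun a a' ψ => by ext i; simp) (fun c a ψ => by ext i; simp)
    (fun a ψ ψ' => by ext i; simp) (fun c a ψ => by ext i; simp)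
  dirac := planeDirac

/-- A state of the Moyal algebra: a positive linear form of norm `1` for the operator norm of the
representation. Such forms are exactly the restrictions to `S(ℝ²)` of the states of its
`C^*`-closure, each of which is determined by its restriction. -/
structure IsState (θ : ℝ) (φ : Alg →ₗ[ℂ] ℂ) : Prop where
  nonneg : ∀ f : Alg, 0 ≤ (φ (moyal θ (conjAlg f) f)).re ∧ (φ (moyal θ (conjAlg f) f)).im = 0
  norm_eq_one :
    IsLUB {r : ℝ | ∃ f : Alg, (moyalTriple θ).Contractive ((moyalTriple θ).rep f) ∧ r = ‖φ f‖} 1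

/-- The translate `(α_κ f)(x) = f(x + κ)`. -/
def translate (κ : Plane) : Alg →ₗ[ℂ] Alg :=
  (SchwartzMap.compSubConstCLM ℂ (-κ)).toLinearMap

theorem translate_apply (κ : Plane) (f : Alg) (x : Plane) : translate κ f x = f (x + κ) := by
  simp [translate]

/-- The set `C(ω) = { α_κ ω : κ ∈ ℝ² }` of translates of `ω`, where `(α_κ ω)(f) = ω(α_κ f)`. -/
def translates (ω : Alg →ₗ[ℂ] ℂ) : Set (Alg →ₗ[ℂ] ℂ) :=
  Set.range fun κ : Plane => ω ∘ₗ translate κ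

end MoyalPlane

end

/-!
Write `ω`, `ω̃` for the translates of the state `φ` by `κ` and `κ'`. All three distances are computed
explicitly: `d_D (ω, ω̃) = ‖κ - κ'‖` (`moyal_dist`), `d_{D_I} (δ₁, δ₂) = ‖Λ‖⁻¹` (`twoPoint_dist`), and
`d_{D'} (ω¹, ω̃²) = √(‖κ - κ'‖² + ‖Λ‖⁻²)` (`double_dist`), with the value `∞` for the last two when
`Λ = 0`.

*Upper bounds.* If `[D', (a₁, a₂)]` is contractive, its columns give, for `i = 1, 2` and every `χ`,
`‖(∂₁ ± i∂₂) a_i ⋆ χ‖² + ‖Λ‖² ‖(a₁ - a₂) ⋆ χ‖² ≤ ‖χ‖²` (`quadratic_bound_of_contractive`). By the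
Cauchy-Schwarz inequality left multiplication by `∂_d a_i - (a₁ - a₂)` has norm at most
`√(‖d‖² + ‖Λ‖⁻²)`. With `d = κ' - κ` and `φ_t` the translate of `φ` by `κ + t d`, the function
`(1 - t) φ_t (a₁) + t φ_t (a₂)` goes from `ω (a₁)` to `ω̃ (a₂)`, and its derivative is a convex
combination of values of the state `φ_t` at these two elements (`double_dist_le`). That states can be
differentiated along translations follows from a density in momentum space (`exists_density`): the
operator norm is dominated by the `L¹` norm of the Fourier transform, hence by a Sobolev norm.

*Lower bounds.* The optimal elements should be the affine functions `(v·x + s, v·x)`, which are not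
Schwartz functions and whose Gaussian cutoffs are not easily bounded as operators. They are therefore
quantized: fix `g` with `‖g‖₂ = 1` and replace a symbol `h` by `quant h = ∫ h (κ) f₀ (· - κ) dκ`,
where `f₀ = g^* ⋆ g`. Since `ψ ↦ (g (· - κ) ⋆ ψ)_κ` is an isometry into `L²(ℝ² × ℝ²)`
(`integral_coherent`), left multiplication by `quant h` is the compression of multiplication by
`h (κ)`, so that the quantization of a matrix of symbols is bounded by its pointwise norm
(`quant_matrix_bound`).
Quantization commutes with derivatives, so `[D', quant b]` is the quantization of the commutator of
the commutative plane, whose pointwise norm is `√(‖v‖² + ‖Λ‖² s²)` up to an error which vanishes with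
the cutoff (`sum_commSymbol_le`). On the other side, `φ (quant h)` is the integral of `h` against the
density `husimi`, which is nonnegative and has total mass one (`integral_husimi`): no mass escapes
because quantized cutoffs form an approximate unit (`tendsto_apply_quant_cutoff`). Hence the
difference of the two states on the quantized pair tends to `v·(κ - κ') + s`, and it remains to
maximize this over `‖v‖² + ‖Λ‖² s² ≤ 1`.
-/

noncomputable section

namespace MoyalPlane

open MeasureTheory SchwartzMap
open scoped FourierTransform LineDeriv ENNReal ComplexConjugate

/-! ### Plane waves -/

/-- The plane wave `x ↦ exp (2πi k·x)`. -/
def wave (k x : Plane) : ℂ := Complex.exp (((2 * Real.pi * inner ℝ k x : ℝ) : ℂ) * Complex.I)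

theorem wave_comm (k x : Plane) : wave k x = wave x k := by
  rw [wave, wave, real_inner_comm]

theorem norm_wave (k x : Plane) : ‖wave k x‖ = 1 := Complex.norm_exp_ofReal_mul_I _

theorem wave_add_right (k x y : Plane) : wave k (x + y) = wave k x * wave k y := by
  simp only [wave, ← Complex.exp_add, inner_add_right]
  congr 1; push_cast; ring

theorem wave_add_left (k l x : Plane) : wave (k + l) x = wave k x * wave l x := by
  simp only [wave_comm _ x, wave_add_right]

theorem wave_zero_left (x : Plane) : wave 0 x = 1 := by simp [wave]

theorem wave_neg_right (k x : Plane) : wave k (-x) = wave (-k) x := by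
  simp [wave]

theorem wave_mul_neg (k x : Plane) : wave k x * wave (-k) x = 1 := by
  rw [← wave_add_left, add_neg_cancel, wave_zero_left]

theorem conj_wave (k x : Plane) : conj (wave k x) = wave (-k) x := by
  rw [wave, wave, ← Complex.exp_conj, map_mul, Complex.conj_ofReal, Complex.conj_I,
    inner_neg_left]
  congr 1; push_cast; ring

@[fun_prop]
theorem continuous_wave {X : Type*} [TopologicalSpace X] {a b : X → Plane}
    (ha : Continuous a) (hb : Continuous b) : Continuous fun t => wave (a t) (b t) := by
  unfold wave; fun_prop

theorem fourier_eq_wave (f : Alg) (k : Plane) : 𝓕 f k = ∫ x, f x * wave (-k) x := by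
  rw [SchwartzMap.fourier_coe, Real.fourier_eq']
  congr 1; ext x
  rw [smul_eq_mul, mul_comm, wave, inner_neg_left, real_inner_comm k x]
  congr 3; push_cast; ring

theorem eq_integral_fourier (f : Alg) (x : Plane) : f x = ∫ k, 𝓕 f k * wave k x := by
  conv_lhs => rw [← FourierTransform.fourierInv_fourier_eq (F := Alg) f]
  rw [SchwartzMap.fourierInv_coe, Real.fourierInv_eq']
  congr 1; ext k
  rw [smul_eq_mul, mul_comm, wave]

/-! ### The Moyal product in terms of plane waves -/

/-- The rotation by a right angle. -/
def quarterTurn : Plane ≃ₗᵢ[ℝ] Plane where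
  toFun k := !₂[-k 1, k 0]
  invFun k := !₂[k 1, -k 0]
  map_add' k l := by ext i; fin_cases i <;> simp [add_comm]
  map_smul' c k := by ext i; fin_cases i <;> simp
  left_inv k := by ext i; fin_cases i <;> simp
  right_inv k := by ext i; fin_cases i <;> simp
  norm_map' k := by simp [EuclideanSpace.norm_eq, Fin.sum_univ_two, add_comm]

/-- The displacement attached to a momentum: multiplying on the right by the plane wave `k`
translates by `displ θ k`, multiplying on the left translates by its opposite. -/
def displ (θ : ℝ) : Plane →L[ℝ] Plane :=
  (Real.pi * θ) • (quarterTurn.toContinuousLinearEquiv : Plane →L[ℝ] Plane)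

theorem displ_apply (θ : ℝ) (k : Plane) : displ θ k = (Real.pi * θ) • quarterTurn k := rfl

theorem inner_displ (θ : ℝ) (k l : Plane) :
    inner ℝ k (displ θ l) = Real.pi * θ * (k 1 * l 0 - k 0 * l 1) := by
  simp [displ_apply, quarterTurn, PiLp.inner_apply, Fin.sum_univ_two]
  ring

theorem wave_displ_self (θ : ℝ) (k : Plane) : wave k (displ θ k) = 1 := by
  rw [wave, inner_displ]; simp [mul_comm]

theorem wave_displ_comm (θ : ℝ) (k l : Plane) : wave k (displ θ l) = wave l (-displ θ k) := by
  rw [wave, wave, inner_neg_right, inner_displ, inner_displ]; congr 3; ring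

theorem integral_comp_displ {θ : ℝ} (hθ : 0 < θ) (F : Plane → ℂ) :
    ((1 / (Real.pi * θ)) ^ 2 : ℝ) * ∫ u, F u = ∫ k, F (displ θ k) := by
  have h1 : ∫ k, F (displ θ k) = ∫ u, F ((Real.pi * θ) • u) :=
    quarterTurn.measurePreserving.integral_comp
      quarterTurn.toHomeomorph.measurableEmbedding (fun u => F ((Real.pi * θ) • u))
  have hp : 0 < Real.pi * θ := by positivity
  rw [h1, Measure.integral_comp_smul, Complex.real_smul, finrank_euclideanSpace_fin,
    abs_of_pos (by positivity), one_div, inv_pow]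

theorem rot_displ {θ : ℝ} (hθ : 0 < θ) (k : Plane) : rot θ (displ θ k) = k := by
  have := Real.pi_ne_zero
  ext i
  fin_cases i <;> simp [rot, displ_apply, quarterTurn] <;> field_simp

/-- The Moyal product with the right factor resolved into plane waves. -/
theorem moyal_eq_right {θ : ℝ} (hθ : 0 < θ) (f g : Alg) (x : Plane) :
    moyal θ f g x = ∫ k, 𝓕 g k * wave k x * f (x + displ θ k) := by
  rw [moyal_apply, moyalFun_eq θ hθ.ne', integral_comp_displ hθ]
  congr 1; ext k
  rw [moyalIntegrand_apply, rot_displ hθ]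
  have : 2 / θ * form (displ θ k) x = 2 * Real.pi * inner ℝ k x := by
    simp [form, displ_apply, quarterTurn, PiLp.inner_apply, Fin.sum_univ_two]
    field_simp
  rw [this, wave]; ring

theorem norm_apply_le (f : Alg) : ∃ C, 0 ≤ C ∧ ∀ x, ‖f x‖ ≤ C :=
  ⟨_, apply_nonneg _ f, fun x => norm_le_seminorm ℝ f x⟩

theorem integrable_mul_bounded (f : Alg) {b : Plane → ℂ} (hb : Continuous b) {C : ℝ}
    (h : ∀ x, ‖b x‖ ≤ C) : Integrable fun x => f x * b x :=
  f.integrable.mul_bdd (c := C) hb.aestronglyMeasurable (.of_forall h)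

/-- The Moyal product with the left factor resolved into plane waves. -/
theorem moyal_eq_left {θ : ℝ} (hθ : 0 < θ) (f g : Alg) (x : Plane) :
    moyal θ f g x = ∫ k, 𝓕 f k * wave k x * g (x - displ θ k) := by
  have h1 (k : Plane) : 𝓕 g k * wave k x * f (x + displ θ k) =
      ∫ l, (𝓕 g k * wave k x) * (𝓕 f l * wave l (x + displ θ k)) := by
    rw [integral_const_mul, ← eq_integral_fourier]
  have h2 (l : Plane) : 𝓕 f l * wave l x * g (x - displ θ l) =
      ∫ k, (𝓕 g k * wave k x) * (𝓕 f l * wave l (x + displ θ k)) := by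
    rw [eq_integral_fourier g, ← integral_const_mul]
    congr 1; ext k
    rw [wave_add_right, wave_displ_comm, sub_eq_add_neg, wave_add_right]; ring
  rw [moyal_eq_right hθ]
  simp_rw [h1, h2]
  refine integral_integral_swap ?_
  refine ((𝓕 g).integrable.norm.mul_prod (𝓕 f).integrable.norm).mono' ?_ (.of_forall fun p => ?_)
  · exact Continuous.aestronglyMeasurable (by fun_prop)
  · simp only [Function.uncurry, norm_mul, norm_wave, mul_one, le_refl]

theorem integrable_prod_shear (θ : ℝ) (f g : Alg) :
    Integrable (fun p : Plane × Plane => ‖g p.2‖ * ‖f (p.1 + displ θ p.2)‖)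
      (volume.prod volume) := by
  rw [integrable_prod_iff' (Continuous.aestronglyMeasurable (by fun_prop))]
  refine ⟨.of_forall fun y => ?_, ?_⟩
  · exact ((f.integrable (μ := volume)).norm.comp_add_right (displ θ y)).const_mul ‖g y‖
  · refine (g.integrable.norm.mul_const (∫ x, ‖f x‖)).congr (.of_forall fun y => ?_)
    simp only [norm_mul, norm_norm]
    rw [integral_const_mul, integral_add_right_eq_self (μ := volume) (fun x => ‖f x‖)]

/-- The Fourier transform carries the Moyal product to the twisted convolution. -/
theorem fourier_moyal {θ : ℝ} (hθ : 0 < θ) (f g : Alg) (k : Plane) :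
    𝓕 (moyal θ f g) k = ∫ l, 𝓕 g l * 𝓕 f (k - l) * wave k (displ θ l) := by
  rw [fourier_eq_wave]
  have h1 (x : Plane) : moyal θ f g x * wave (-k) x =
      ∫ l, 𝓕 g l * wave l x * f (x + displ θ l) * wave (-k) x := by
    rw [integral_mul_const, moyal_eq_right hθ]
  have h2 (l : Plane) : 𝓕 g l * 𝓕 f (k - l) * wave k (displ θ l) =
      ∫ x, 𝓕 g l * wave l x * f (x + displ θ l) * wave (-k) x := by
    have h3 (x : Plane) : 𝓕 g l * wave l x * f (x + displ θ l) * wave (-k) x =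
        𝓕 g l * wave k (displ θ l) *
          (f (x + displ θ l) * wave (-(k - l)) (x + displ θ l)) := by
      have e1 : wave k (displ θ l) * wave (-k) (displ θ l) = 1 := wave_mul_neg _ _
      rw [neg_sub, sub_eq_add_neg, wave_add_right, wave_add_left, wave_add_left, wave_displ_self]
      linear_combination (-(𝓕 g l * wave l x * f (x + displ θ l) * wave (-k) x)) * e1
    simp only [h3]
    rw [integral_const_mul, integral_add_right_eq_self (μ := (volume : Measure Plane))
      (fun x => f x * wave (-(k - l)) x), ← fourier_eq_wave f]
    ring
  simp_rw [h1, h2]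
  refine integral_integral_swap ((integrable_prod_shear θ f (𝓕 g)).mono' ?_
    (.of_forall fun p => ?_))
  · exact Continuous.aestronglyMeasurable (by fun_prop)
  · simp only [Function.uncurry, norm_mul, norm_wave, mul_one, le_refl]

theorem fourier_injective {f g : Alg} (h : ∀ k, 𝓕 f k = 𝓕 g k) : f = g := by
  have : 𝓕 f = 𝓕 g := SchwartzMap.ext h
  rw [← FourierTransform.fourierInv_fourier_eq (F := Alg) f, this,
    FourierTransform.fourierInv_fourier_eq]

theorem moyal_assoc {θ : ℝ} (hθ : 0 < θ) (f g h : Alg) :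
    moyal θ (moyal θ f g) h = moyal θ f (moyal θ g h) := by
  ext x
  rw [moyal_eq_right hθ, moyal_eq_right hθ]
  have h1 (l : Plane) : 𝓕 h l * wave l x * moyal θ f g (x + displ θ l) =
      ∫ k, 𝓕 h l * 𝓕 g (k - l) * wave k (displ θ l) * wave k x * f (x + displ θ k) := by
    rw [moyal_eq_right hθ, ← integral_const_mul, ← integral_sub_right_eq_self _ l]
    congr 1; ext k
    have e1 : wave k x = wave (k - l) x * wave l x := by rw [← wave_add_left, sub_add_cancel]
    have e2 : wave k (displ θ l) = wave (k - l) (displ θ l) := by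
      rw [← mul_one (wave (k - l) _), ← wave_displ_self θ l, ← wave_add_left, sub_add_cancel]
    have e3 : x + displ θ l + displ θ (k - l) = x + displ θ k := by
      rw [add_assoc, ← map_add, add_sub_cancel]
    rw [wave_add_right, e1, e2, e3]
    ring
  have h2 (k : Plane) : 𝓕 (moyal θ g h) k * wave k x * f (x + displ θ k) =
      ∫ l, 𝓕 h l * 𝓕 g (k - l) * wave k (displ θ l) * wave k x * f (x + displ θ k) := by
    rw [fourier_moyal hθ, ← integral_mul_const, ← integral_mul_const]
  simp_rw [h1, h2]
  obtain ⟨C, -, hC⟩ := norm_apply_le f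
  refine integral_integral_swap ?_
  have hi : Integrable (fun p : Plane × Plane => ‖𝓕 h p.1‖ * ‖𝓕 g (p.2 - p.1)‖ * C)
      (volume.prod volume) := by
    refine Integrable.mul_const ?_ C
    rw [integrable_prod_iff (Continuous.aestronglyMeasurable (by fun_prop))]
    refine ⟨.of_forall fun y => ?_, ?_⟩
    · exact ((𝓕 g).integrable (μ := volume)).norm.comp_sub_right y |>.const_mul ‖𝓕 h y‖
    · refine ((𝓕 h).integrable.norm.mul_const (∫ x, ‖𝓕 g x‖)).congr (.of_forall fun y => ?_)
      simp only [norm_mul, norm_norm]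
      rw [integral_const_mul, integral_sub_right_eq_self (μ := volume) (fun x => ‖𝓕 g x‖)]
  refine hi.mono' (Continuous.aestronglyMeasurable (by fun_prop)) (.of_forall fun p => ?_)
  simp only [Function.uncurry, norm_mul, norm_wave, mul_one]
  gcongr
  exact hC _

theorem fourier_lineDeriv (m : Plane) (f : Alg) (k : Plane) :
    𝓕 (∂_{m} f : Alg) k = 2 * Real.pi * Complex.I * (inner ℝ k m : ℝ) * 𝓕 f k := by
  have hm : (fun k : Plane => inner ℝ k m).HasTemperateGrowth := by fun_prop
  rw [SchwartzMap.fourier_lineDerivOp_eq, smul_apply,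
    SchwartzMap.smulLeftCLM_apply_apply hm, smul_eq_mul, Complex.real_smul]
  ring

/-- The Leibniz rule for the Moyal product. -/
theorem lineDeriv_moyal {θ : ℝ} (hθ : 0 < θ) (m : Plane) (f g : Alg) :
    (∂_{m} (moyal θ f g) : Alg) = moyal θ (∂_{m} f) g + moyal θ f (∂_{m} g) := by
  have hi (f g : Alg) (k : Plane) :
      Integrable fun l => 𝓕 g l * 𝓕 f (k - l) * wave k (displ θ l) := by
    obtain ⟨C, -, hC⟩ := norm_apply_le (𝓕 f)
    simp only [mul_assoc]
    refine integrable_mul_bounded _ (by fun_prop) (C := C) fun l => ?_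
    rw [norm_mul, norm_wave, mul_one]; exact hC _
  refine fourier_injective fun k => ?_
  rw [FourierTransform.fourier_add, add_apply, fourier_lineDeriv, fourier_moyal hθ,
    fourier_moyal hθ, fourier_moyal hθ, ← integral_add (hi _ _ k) (hi _ _ k), ← integral_const_mul]
  congr 1; ext l
  rw [fourier_lineDeriv, fourier_lineDeriv, inner_sub_left]
  push_cast; ring

theorem moyal_translate (θ : ℝ) (κ : Plane) (f g : Alg) :
    moyal θ (translate κ f) (translate κ g) = translate κ (moyal θ f g) := by
  ext x
  simp only [moyal_apply, translate_apply, moyalFun, add_right_comm x _ κ]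

theorem fourier_conjAlg (f : Alg) (k : Plane) : 𝓕 (conjAlg f) k = conj (𝓕 f (-k)) := by
  rw [fourier_eq_wave, fourier_eq_wave, ← integral_conj]
  congr 1; ext x
  rw [map_mul, conj_wave, neg_neg, conjAlg_apply]

theorem conjAlg_moyal {θ : ℝ} (hθ : 0 < θ) (f g : Alg) :
    conjAlg (moyal θ f g) = moyal θ (conjAlg g) (conjAlg f) := by
  ext x
  rw [conjAlg_apply, moyal_eq_right hθ, moyal_eq_left hθ (conjAlg g), ← integral_conj,
    ← integral_neg_eq_self]
  congr 1; ext k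
  rw [fourier_conjAlg, conjAlg_apply, map_mul, map_mul, conj_wave, neg_neg, map_neg (displ θ),
    ← sub_eq_add_neg]

theorem conjAlg_conjAlg (f : Alg) : conjAlg (conjAlg f) = f := by
  ext x; simp [conjAlg_apply]

/-- The integral is a trace: `∫ f ⋆ g = ∫ f g`. -/
theorem integral_moyal {θ : ℝ} (hθ : 0 < θ) (f g : Alg) :
    ∫ x, moyal θ f g x = ∫ x, f x * g x := by
  have h1 : ∫ x, moyal θ f g x = 𝓕 (moyal θ f g) 0 := by
    rw [fourier_eq_wave]; simp [wave_zero_left]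
  rw [h1, fourier_moyal hθ]
  have h2 := SchwartzMap.integral_fourier_mul_eq g (𝓕⁻ f)
  rw [FourierTransform.fourier_fourierInv_eq] at h2
  simp only [mul_comm (f _), ← h2]
  congr 1; ext l
  rw [wave_zero_left, zero_sub, mul_one, SchwartzMap.fourierInv_coe,
    Real.fourierInv_eq_fourier_neg, SchwartzMap.fourier_coe, SchwartzMap.fourier_coe]

/-- Left multiplication by `f^*` is adjoint to left multiplication by `f`. -/
theorem integral_conj_mul_moyal {θ : ℝ} (hθ : 0 < θ) (f χ ψ : Alg) :
    ∫ x, conj (χ x) * moyal θ f ψ x = ∫ x, conj (moyal θ (conjAlg f) χ x) * ψ x := by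
  simp only [← conjAlg_apply]
  rw [← integral_moyal hθ, ← integral_moyal hθ, conjAlg_moyal hθ, conjAlg_conjAlg, moyal_assoc hθ]

/-! ### Square norms and boundedness of left multiplication -/

/-- The inclusion of the Schwartz functions in `L²(ℝ²)`. -/
def l2 : Alg →ₗ[ℂ] Lp ℂ 2 (volume : Measure Plane) :=
  (SchwartzMap.toLpCLM ℂ ℂ 2 (volume : Measure Plane)).toLinearMap

theorem inner_l2 (f g : Alg) : inner ℂ (l2 f) (l2 g) = ∫ x, conj (f x) * g x := by
  refine (SchwartzMap.inner_toL2_toL2_eq (V := ℂ) f g (volume : Measure Plane)).trans ?_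
  simp only [RCLike.inner_apply, mul_comm]

theorem norm_sq_l2 (f : Alg) : ‖l2 f‖ ^ 2 = ∫ x, ‖f x‖ ^ 2 := by
  have h := inner_self_eq_norm_sq_to_K (𝕜 := ℂ) (l2 f)
  rw [inner_l2] at h
  simp only [Complex.conj_mul'] at h
  have : ∫ x, ((‖f x‖ : ℂ)) ^ 2 = ((∫ x, ‖f x‖ ^ 2 : ℝ) : ℂ) := by
    rw [← integral_complex_ofReal]; push_cast; rfl
  rw [this] at h
  exact Complex.ofReal_injective (by rw [h]; push_cast; rfl)

theorem integrable_norm_sq (f : Alg) : Integrable fun x => ‖f x‖ ^ 2 :=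
  (memLp_two_iff_integrable_sq_norm f.continuous.aestronglyMeasurable).1 (f.memLp 2 _)

theorem lintegral_enorm_sq (f : Alg) : ∫⁻ x, ‖f x‖ₑ ^ 2 = ENNReal.ofReal (‖l2 f‖ ^ 2) := by
  rw [norm_sq_l2, ofReal_integral_eq_lintegral_ofReal (integrable_norm_sq f)
    (.of_forall fun x => by positivity)]
  congr 1; ext x
  rw [ENNReal.ofReal_pow (norm_nonneg _), ofReal_norm]

theorem l2_translate (κ : Plane) (f : Alg) : ‖l2 (translate κ f)‖ = ‖l2 f‖ := by
  rw [← sq_eq_sq₀ (norm_nonneg _) (norm_nonneg _), norm_sq_l2, norm_sq_l2]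
  simp only [translate_apply]
  exact integral_add_right_eq_self (μ := (volume : Measure Plane)) (fun x => ‖f x‖ ^ 2) κ

theorem l2_fourier (f : Alg) : ‖l2 (𝓕 f)‖ = ‖l2 f‖ := SchwartzMap.norm_fourier_toL2_eq f

theorem integral_norm_mul_norm_le (f g : Alg) : ∫ x, ‖f x‖ * ‖g x‖ ≤ ‖l2 f‖ * ‖l2 g‖ := by
  have h (f : Alg) : (∫ x, ‖f x‖ ^ (2 : ℝ)) ^ (1 / (2 : ℝ)) = ‖l2 f‖ := by
    simp only [Real.rpow_two]
    rw [← norm_sq_l2, ← Real.sqrt_eq_rpow, Real.sqrt_sq (norm_nonneg _)]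
  have := integral_mul_norm_le_Lp_mul_Lq (μ := (volume : Measure Plane)) (f := f) (g := g)
    Real.HolderConjugate.two_two (by simpa using f.memLp 2 volume) (by simpa using g.memLp 2 volume)
  rwa [h, h] at this

/-- The operator norm of left multiplication by `f` is at most `r`. -/
def OpBound (θ : ℝ) (f : Alg) (r : ℝ) : Prop :=
  ∀ ψ : Alg, ‖l2 (moyal θ f ψ)‖ ≤ r * ‖l2 ψ‖

/-- Left multiplication by `f` is a superposition of unitaries with weights `𝓕 f`, so that its
norm is at most the `L¹` norm of `𝓕 f`. -/
theorem opBound_integral_fourier {θ : ℝ} (hθ : 0 < θ) (f : Alg) :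
    OpBound θ f (∫ k, ‖𝓕 f k‖) := by
  intro ψ
  set χ := moyal θ f ψ with hχ
  have hnn : (0 : ℝ) ≤ ∫ k, ‖𝓕 f k‖ := integral_nonneg fun k => norm_nonneg _
  suffices h : ‖l2 χ‖ ^ 2 ≤ (∫ k, ‖𝓕 f k‖) * (‖l2 χ‖ * ‖l2 ψ‖) by
    rcases (norm_nonneg (l2 χ)).eq_or_lt with h0 | h0
    · rw [← h0]; positivity
    · nlinarith
  obtain ⟨C, hC0, hC⟩ := norm_apply_le ψ
  have hint : Integrable (fun p : Plane × Plane =>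
      ‖χ p.1‖ * (‖𝓕 f p.2‖ * ‖ψ (p.1 - displ θ p.2)‖)) (volume.prod volume) := by
    refine ((χ.integrable.norm.mul_prod (𝓕 f).integrable.norm).mul_const C).mono'
      (Continuous.aestronglyMeasurable (by fun_prop)) (.of_forall fun p => ?_)
    simp only [norm_mul, norm_norm, mul_assoc]
    gcongr
    exact hC _
  have h1 (x : Plane) : ‖χ x‖ ^ 2 ≤ ∫ k, ‖χ x‖ * (‖𝓕 f k‖ * ‖ψ (x - displ θ k)‖) := by
    rw [integral_const_mul, sq]
    gcongr
    conv_lhs => rw [hχ, moyal_eq_left hθ]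
    refine (norm_integral_le_integral_norm _).trans_eq ?_
    simp only [norm_mul, norm_wave, mul_one]
  have h2 (k : Plane) : ∫ x, ‖χ x‖ * (‖𝓕 f k‖ * ‖ψ (x - displ θ k)‖) ≤
      ‖𝓕 f k‖ * (‖l2 χ‖ * ‖l2 ψ‖) := by
    have := integral_norm_mul_norm_le χ (translate (-displ θ k) ψ)
    rw [l2_translate] at this
    simp only [translate_apply, ← sub_eq_add_neg] at this
    simp only [mul_left_comm ‖χ _‖]
    rw [integral_const_mul]
    gcongr
  calc ‖l2 χ‖ ^ 2 = ∫ x, ‖χ x‖ ^ 2 := norm_sq_l2 χ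
    _ ≤ ∫ x, ∫ k, ‖χ x‖ * (‖𝓕 f k‖ * ‖ψ (x - displ θ k)‖) :=
        integral_mono (integrable_norm_sq χ) hint.integral_prod_left h1
    _ = ∫ k, ∫ x, ‖χ x‖ * (‖𝓕 f k‖ * ‖ψ (x - displ θ k)‖) := integral_integral_swap hint
    _ ≤ ∫ k, ‖𝓕 f k‖ * (‖l2 χ‖ * ‖l2 ψ‖) :=
        integral_mono hint.integral_prod_right ((𝓕 f).integrable.norm.mul_const _) h2
    _ = _ := integral_mul_const _ _

/-! ### The coherent transform -/

theorem fourier_translate (κ : Plane) (f : Alg) (k : Plane) :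
    𝓕 (translate κ f) k = wave k κ * 𝓕 f k := by
  rw [fourier_eq_wave, fourier_eq_wave, ← integral_const_mul,
    ← integral_sub_right_eq_self (fun x => translate κ f x * wave (-k) x) κ]
  congr 1; ext x
  have := wave_neg_right (-k) κ
  rw [neg_neg] at this
  rw [translate_apply, sub_add_cancel, sub_eq_add_neg, wave_add_right, this]
  ring

/-- The coherent transform `(κ, x) ↦ (g(· - κ) ⋆ ψ)(x)` of `ψ`. -/
def coherent (θ : ℝ) (g ψ : Alg) (p : Plane × Plane) : ℂ := moyal θ (translate (-p.1) g) ψ p.2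

theorem coherent_eq {θ : ℝ} (hθ : 0 < θ) (g ψ : Alg) (p : Plane × Plane) :
    coherent θ g ψ p = ∫ k, 𝓕 ψ k * wave k p.2 * g (p.2 + displ θ k - p.1) := by
  rw [coherent, moyal_eq_right hθ]
  simp only [translate_apply, sub_eq_add_neg]

theorem continuous_coherent {θ : ℝ} (hθ : 0 < θ) (g ψ : Alg) : Continuous (coherent θ g ψ) := by
  obtain ⟨C, hC0, hC⟩ := norm_apply_le g
  rw [funext (coherent_eq hθ g ψ)]
  refine continuous_of_dominated (bound := fun k => ‖𝓕 ψ k‖ * C)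
    (fun p => Continuous.aestronglyMeasurable (by fun_prop)) (fun p => .of_forall fun k => ?_)
    ((𝓕 ψ).integrable.norm.mul_const C) (.of_forall fun k => by fun_prop)
  rw [norm_mul, norm_mul, norm_wave, mul_one]
  gcongr
  exact hC _

theorem norm_coherent_le {θ : ℝ} (hθ : 0 < θ) (g ψ : Alg) :
    ∃ C, 0 ≤ C ∧ ∀ p, ‖coherent θ g ψ p‖ ≤ C := by
  obtain ⟨C, hC0, hC⟩ := norm_apply_le g
  refine ⟨∫ k, ‖𝓕 ψ k‖ * C, integral_nonneg fun k => by positivity, fun p => ?_⟩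
  rw [coherent_eq hθ]
  refine norm_integral_le_of_norm_le ((𝓕 ψ).integrable.norm.mul_const C) (.of_forall fun k => ?_)
  rw [norm_mul, norm_mul, norm_wave, mul_one]
  gcongr
  exact hC _

/-- The coherent transform is isometric up to the factor `‖g‖₂`. With `y = x - κ` fixed it is an
inverse Fourier transform, to which Plancherel's theorem applies. -/
theorem lintegral_coherent {θ : ℝ} (hθ : 0 < θ) (g ψ : Alg) :
    ∫⁻ p, ‖coherent θ g ψ p‖ₑ ^ 2 ∂(volume.prod volume) =
      ENNReal.ofReal (‖l2 g‖ ^ 2 * ‖l2 ψ‖ ^ 2) := by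
  have hm : Measurable fun p => ‖coherent θ g ψ p‖ₑ ^ 2 :=
    (continuous_coherent hθ g ψ).measurable.enorm.pow_const 2
  have hy (y : Plane) : ∫⁻ κ, ‖coherent θ g ψ (κ, y + κ)‖ₑ ^ 2 =
      ∫⁻ k, ‖𝓕 ψ k‖ₑ ^ 2 * ‖g (y + displ θ k)‖ₑ ^ 2 := by
    have ht : Function.HasTemperateGrowth fun k => g (y + displ θ k) :=
      g.hasTemperateGrowth.comp (by fun_prop)
    set G : Alg := SchwartzMap.smulLeftCLM ℂ (fun k => g (y + displ θ k)) (𝓕 ψ) with hG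
    have hGa (k : Plane) : G k = g (y + displ θ k) * 𝓕 ψ k :=
      SchwartzMap.smulLeftCLM_apply_apply ht _ _
    have h1 (κ : Plane) : coherent θ g ψ (κ, y + κ) = (𝓕⁻ G : Alg) (κ + y) := by
      rw [eq_integral_fourier (𝓕⁻ G), FourierTransform.fourier_fourierInv_eq, coherent_eq hθ]
      congr 1; ext k
      rw [hGa, add_comm κ y, add_right_comm, add_sub_cancel_right]
      ring
    simp_rw [h1]
    rw [lintegral_add_right_eq_self (fun x => ‖(𝓕⁻ G : Alg) x‖ₑ ^ 2), lintegral_enorm_sq,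
      ← l2_fourier, FourierTransform.fourier_fourierInv_eq, ← lintegral_enorm_sq]
    congr 1; ext k
    rw [hGa, enorm_mul, mul_pow, mul_comm]
  rw [lintegral_prod _ hm.aemeasurable]
  have hs (κ : Plane) : ∫⁻ x, ‖coherent θ g ψ (κ, x)‖ₑ ^ 2 =
      ∫⁻ y, ‖coherent θ g ψ (κ, y + κ)‖ₑ ^ 2 :=
    (lintegral_add_right_eq_self (μ := (volume : Measure Plane))
      (fun x => ‖coherent θ g ψ (κ, x)‖ₑ ^ 2) κ).symm
  simp_rw [hs]
  rw [lintegral_lintegral_swap]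
  · simp_rw [hy]
    rw [lintegral_lintegral_swap]
    · have hk (k : Plane) : ∫⁻ y, ‖𝓕 ψ k‖ₑ ^ 2 * ‖g (y + displ θ k)‖ₑ ^ 2 =
          ‖𝓕 ψ k‖ₑ ^ 2 * ENNReal.ofReal (‖l2 g‖ ^ 2) := by
        rw [lintegral_const_mul' _ _ (by simp), lintegral_add_right_eq_self (fun y => ‖g y‖ₑ ^ 2),
          lintegral_enorm_sq]
      simp_rw [hk]
      rw [lintegral_mul_const' _ _ (by simp), lintegral_enorm_sq, l2_fourier,
        ← ENNReal.ofReal_mul (by positivity), mul_comm]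
    · exact (((𝓕 ψ).continuous.measurable.enorm.comp measurable_snd).pow_const 2).mul
        ((Continuous.measurable (f := fun p : Plane × Plane => g (p.1 + displ θ p.2))
          (by fun_prop)).enorm.pow_const 2) |>.aemeasurable
  · exact (hm.comp (f := fun p : Plane × Plane => (p.1, p.2 + p.1)) (by fun_prop)).aemeasurable

theorem memLp_coherent {θ : ℝ} (hθ : 0 < θ) (g ψ : Alg) :
    MemLp (coherent θ g ψ) 2 (volume.prod volume) := by
  refine ⟨(continuous_coherent hθ g ψ).aestronglyMeasurable, ?_⟩
  rw [eLpNorm_lt_top_iff_lintegral_rpow_enorm_lt_top (by simp) (by simp)]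
  simp only [ENNReal.toReal_ofNat, ENNReal.rpow_ofNat]
  rw [lintegral_coherent hθ]
  exact ENNReal.ofReal_lt_top

theorem integral_coherent {θ : ℝ} (hθ : 0 < θ) (g ψ : Alg) :
    ∫ p, ‖coherent θ g ψ p‖ ^ 2 ∂(volume.prod volume) = ‖l2 g‖ ^ 2 * ‖l2 ψ‖ ^ 2 := by
  rw [integral_eq_lintegral_of_nonneg_ae (f := fun p => ‖coherent θ g ψ p‖ ^ 2)
    (.of_forall fun p => by positivity)
    ((continuous_coherent hθ g ψ).norm.pow 2).aestronglyMeasurable]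
  simp_rw [ENNReal.ofReal_pow (norm_nonneg _), ofReal_norm]
  rw [lintegral_coherent hθ, ENNReal.toReal_ofReal (by positivity)]

/-! ### Quantization of symbols by coherent elements -/

/-- The quantization of the symbol `h`: the superposition `∫ h(κ) f₀(· - κ) dκ` of the translates of
`f₀ = g^* ⋆ g`, that is, the convolution of `h` with `f₀`. -/
def quant (θ : ℝ) (g : Alg) : Alg →ₗ[ℂ] Alg where
  toFun h := SchwartzMap.convolution (ContinuousLinearMap.mul ℂ ℂ) h (moyal θ (conjAlg g) g)
  map_add' h h' := by rw [map_add]; rfl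
  map_smul' c h := by rw [map_smul]; rfl

theorem quant_apply (θ : ℝ) (g h : Alg) : quant θ g h =
    SchwartzMap.convolution (ContinuousLinearMap.mul ℂ ℂ) h (moyal θ (conjAlg g) g) := rfl

theorem fourier_quant (θ : ℝ) (g h : Alg) (k : Plane) :
    𝓕 (quant θ g h) k = 𝓕 h k * 𝓕 (moyal θ (conjAlg g) g) k := by
  rw [quant_apply, SchwartzMap.fourier_convolution, SchwartzMap.pairing_apply_apply,
    ContinuousLinearMap.mul_apply']

theorem quant_moyal_apply {θ : ℝ} (hθ : 0 < θ) (g h ψ : Alg) (x : Plane) :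
    moyal θ (quant θ g h) ψ x =
      ∫ κ, h κ * coherent θ (moyal θ (conjAlg g) g) ψ (κ, x) := by
  set f₀ := moyal θ (conjAlg g) g with hf₀
  have h1 (k : Plane) : 𝓕 (quant θ g h) k * wave k x * ψ (x - displ θ k) =
      ∫ κ, h κ * wave (-k) κ * (𝓕 f₀ k * wave k x * ψ (x - displ θ k)) := by
    rw [integral_mul_const, fourier_quant, fourier_eq_wave h]
    ring
  have h2 (κ : Plane) : h κ * coherent θ f₀ ψ (κ, x) =
      ∫ k, h κ * wave (-k) κ * (𝓕 f₀ k * wave k x * ψ (x - displ θ k)) := by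
    rw [coherent, moyal_eq_left hθ, ← integral_const_mul]
    congr 1; ext k
    rw [fourier_translate, wave_neg_right]; ring
  rw [moyal_eq_left hθ]
  simp_rw [h1, h2]
  obtain ⟨C, hC0, hC⟩ := norm_apply_le ψ
  refine (integral_integral_swap ?_).symm
  refine ((h.integrable.norm.mul_prod (𝓕 f₀).integrable.norm).mul_const C).mono'
    (Continuous.aestronglyMeasurable ?_) (.of_forall fun p => ?_)
  · fun_prop
  · simp only [Function.uncurry, norm_mul, norm_wave, mul_one]
    rw [← mul_assoc]
    gcongr
    exact hC _

theorem conjAlg_translate (κ : Plane) (f : Alg) :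
    conjAlg (translate κ f) = translate κ (conjAlg f) := by
  ext x; simp [conjAlg_apply, translate_apply]

theorem integrable_symbol {θ : ℝ} (hθ : 0 < θ) (g h χ ψ : Alg) :
    Integrable (fun p : Plane × Plane =>
      h p.1 * (conj (coherent θ g χ p) * coherent θ g ψ p)) (volume.prod volume) := by
  obtain ⟨C, hC0, hC⟩ := norm_apply_le h
  refine Integrable.bdd_mul (c := C) ?_ (Continuous.aestronglyMeasurable (by fun_prop))
    (.of_forall fun p => hC _)
  exact (memLp_coherent hθ g χ).star.integrable_mul (memLp_coherent hθ g ψ)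

/-- The matrix elements of a quantized symbol are averages of the symbol against coherent
transforms. -/
theorem inner_quant {θ : ℝ} (hθ : 0 < θ) (g h χ ψ : Alg) :
    inner ℂ (l2 χ) (l2 (moyal θ (quant θ g h) ψ)) =
      ∫ p, h p.1 * (conj (coherent θ g χ p) * coherent θ g ψ p) ∂(volume.prod volume) := by
  rw [inner_l2, integral_prod _ (integrable_symbol hθ g h χ ψ)]
  set f₀ := moyal θ (conjAlg g) g with hf₀
  have h1 (x : Plane) : conj (χ x) * moyal θ (quant θ g h) ψ x =
      ∫ κ, conj (χ x) * (h κ * coherent θ f₀ ψ (κ, x)) := by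
    rw [integral_const_mul, quant_moyal_apply hθ]
  have h2 (κ : Plane) :
      ∫ x, h κ * (conj (coherent θ g χ (κ, x)) * coherent θ g ψ (κ, x)) =
      ∫ x, conj (χ x) * (h κ * coherent θ f₀ ψ (κ, x)) := by
    simp only [mul_left_comm (conj (χ _))]
    rw [integral_const_mul, integral_const_mul]
    congr 1
    have := integral_conj_mul_moyal hθ (conjAlg (translate (-κ) g)) χ
      (moyal θ (translate (-κ) g) ψ)
    rw [conjAlg_conjAlg, ← moyal_assoc hθ, conjAlg_translate, moyal_translate] at this
    exact this.symm
  simp_rw [h1, h2]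
  obtain ⟨C, hC0, hC⟩ := norm_coherent_le hθ f₀ ψ
  have hc := continuous_coherent hθ f₀ ψ
  refine integral_integral_swap ?_
  refine ((χ.integrable.norm.mul_prod h.integrable.norm).mul_const C).mono'
    (Continuous.aestronglyMeasurable ?_) (.of_forall fun p => ?_)
  · fun_prop
  · simp only [Function.uncurry, norm_mul, RCLike.norm_conj, mul_assoc]
    gcongr
    exact hC _

set_option maxHeartbeats 800000 in
/-- Quantization does not increase the norm of a matrix valued symbol: its matrix elements are those
of the pointwise action of the symbol on coherent transforms, and the coherent transform is
isometric. -/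
theorem quant_matrix_bound {θ : ℝ} (hθ : 0 < θ) {g : Alg} (hg : ‖l2 g‖ = 1)
    {ι : Type*} [Fintype ι] (M : ι → ι → Alg) (r : ℝ)
    (hM : ∀ (κ : Plane) (Y : ι → ℂ), ∑ i, ‖∑ j, M i j κ * Y j‖ ^ 2 ≤ r ^ 2 * ∑ j, ‖Y j‖ ^ 2)
    (ψ : ι → Alg) :
    ∑ i, ‖l2 (∑ j, moyal θ (quant θ g (M i j)) (ψ j))‖ ^ 2 ≤ r ^ 2 * ∑ j, ‖l2 (ψ j)‖ ^ 2 := by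
  obtain ⟨χ, hχ⟩ : ∃ χ : ι → Alg, ∀ i, χ i = ∑ j, moyal θ (quant θ g (M i j)) (ψ j) :=
    ⟨_, fun i => rfl⟩
  simp_rw [← hχ]
  obtain ⟨W, hWdef⟩ : ∃ W : Alg → Plane × Plane → ℂ, W = coherent θ g := ⟨_, rfl⟩
  have hi (i j : ι) : Integrable (fun p : Plane × Plane =>
      M i j p.1 * (conj (W (χ i) p) * W (ψ j) p)) (volume.prod volume) := by
    rw [hWdef]; exact integrable_symbol hθ g (M i j) (χ i) (ψ j)
  have hsq (ψ : Alg) : Integrable (fun p => ‖W ψ p‖ ^ 2) (volume.prod volume) := by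
    rw [hWdef]
    exact (memLp_two_iff_integrable_sq_norm
      (continuous_coherent hθ g ψ).aestronglyMeasurable).1 (memLp_coherent hθ g ψ)
  have hW (ψ : Alg) : ∫ p, ‖W ψ p‖ ^ 2 ∂(volume.prod volume) = ‖l2 ψ‖ ^ 2 := by
    rw [hWdef, integral_coherent hθ, hg, one_pow, one_mul]
  have hs1 : Integrable (fun p => ∑ i, ‖W (χ i) p‖ ^ 2) (volume.prod volume) :=
    integrable_finsetSum _ fun i _ => hsq _
  have hs2 : Integrable (fun p => ∑ i, ‖W (ψ i) p‖ ^ 2) (volume.prod volume) :=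
    integrable_finsetSum _ fun i _ => hsq _
  have h1 : ((∑ i, ‖l2 (χ i)‖ ^ 2 : ℝ) : ℂ) =
      ∫ p, ∑ i, ∑ j, M i j p.1 * (conj (W (χ i) p) * W (ψ j) p) ∂(volume.prod volume) := by
    rw [integral_finsetSum _ fun i _ => integrable_finsetSum _ fun j _ => hi i j]
    push_cast
    refine Finset.sum_congr rfl fun i _ => ?_
    rw [integral_finsetSum _ fun j _ => hi i j]
    simp_rw [hWdef, ← inner_quant hθ]
    rw [← inner_sum, ← map_sum, ← hχ]
    exact (inner_self_eq_norm_sq_to_K (𝕜 := ℂ) (l2 (χ i))).symm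
  have h2 (p : Plane × Plane) :
      ‖∑ i, ∑ j, M i j p.1 * (conj (W (χ i) p) * W (ψ j) p)‖ ≤
        (∑ i, ‖W (χ i) p‖ ^ 2 + r ^ 2 * ∑ j, ‖W (ψ j) p‖ ^ 2) / 2 := by
    have hM' := hM p.1 fun j => W (ψ j) p
    calc _ = ‖∑ i, conj (W (χ i) p) * ∑ j, M i j p.1 * W (ψ j) p‖ := by
          congr 1
          refine Finset.sum_congr rfl fun i _ => ?_
          rw [Finset.mul_sum]
          exact Finset.sum_congr rfl fun j _ => by ring
      _ ≤ ∑ i, ‖W (χ i) p‖ * ‖∑ j, M i j p.1 * W (ψ j) p‖ := by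
          refine (norm_sum_le _ _).trans_eq (Finset.sum_congr rfl fun i _ => ?_)
          rw [norm_mul, RCLike.norm_conj]
      _ ≤ ∑ i, (‖W (χ i) p‖ ^ 2 + ‖∑ j, M i j p.1 * W (ψ j) p‖ ^ 2) / 2 := by
          refine Finset.sum_le_sum fun i _ => ?_
          nlinarith [sq_nonneg (‖W (χ i) p‖ - ‖∑ j, M i j p.1 * W (ψ j) p‖)]
      _ ≤ _ := by
          rw [← Finset.sum_div, Finset.sum_add_distrib]; gcongr
  have hnn : 0 ≤ ∑ i, ‖l2 (χ i)‖ ^ 2 := Finset.sum_nonneg fun i _ => sq_nonneg _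
  have h3 : ∑ i, ‖l2 (χ i)‖ ^ 2 ≤
      (∑ i, ‖l2 (χ i)‖ ^ 2 + r ^ 2 * ∑ j, ‖l2 (ψ j)‖ ^ 2) / 2 := by
    calc ∑ i, ‖l2 (χ i)‖ ^ 2 = ‖((∑ i, ‖l2 (χ i)‖ ^ 2 : ℝ) : ℂ)‖ := by
          rw [Complex.norm_real, Real.norm_of_nonneg hnn]
      _ ≤ ∫ p, (∑ i, ‖W (χ i) p‖ ^ 2 + r ^ 2 * ∑ j, ‖W (ψ j) p‖ ^ 2) / 2
          ∂(volume.prod volume) := by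
          rw [h1]
          exact norm_integral_le_of_norm_le ((hs1.add (hs2.const_mul _)).div_const _)
            (.of_forall h2)
      _ = _ := by
          rw [integral_div, integral_add hs1 (hs2.const_mul _), integral_const_mul,
            integral_finsetSum _ fun i _ => hsq _, integral_finsetSum _ fun i _ => hsq _]
          simp_rw [hW]
  linarith

/-! ### Linear forms dominated by the `L¹` norm of the Fourier transform -/

/-- The function `(1 + |k|²)⁻¹`. -/
def bessel (k : Plane) : ℂ := (((1 + ‖k‖ ^ 2) ^ (-1 : ℝ) : ℝ) : ℂ)

theorem bessel_eq (k : Plane) : bessel k = (1 + (‖k‖ : ℂ) ^ 2)⁻¹ := by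
  rw [bessel, Real.rpow_neg_one]; push_cast; rfl

theorem bessel_mul (k : Plane) : bessel k * (1 + (‖k‖ : ℂ) ^ 2) = 1 := by
  rw [bessel_eq]
  refine inv_mul_cancel₀ ?_
  have : (0 : ℝ) < 1 + ‖k‖ ^ 2 := by positivity
  exact_mod_cast this.ne'

theorem bessel_temperate : Function.HasTemperateGrowth bessel :=
  Function.HasTemperateGrowth.comp Function.Complex.hasTemperateGrowth_ofReal
    (Function.hasTemperateGrowth_one_add_norm_sq_rpow (H := Plane) (-1))

theorem memLp_bessel : MemLp bessel 2 (volume : Measure Plane) := by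
  rw [memLp_two_iff_integrable_sq_norm
    bessel_temperate.1.continuous.aestronglyMeasurable]
  have := integrable_rpow_neg_one_add_norm_sq (μ := (volume : Measure Plane)) (r := 4)
    (by rw [finrank_euclideanSpace_fin]; norm_num)
  refine this.congr (.of_forall fun k => ?_)
  have hk : (0 : ℝ) ≤ 1 + ‖k‖ ^ 2 := by positivity
  simp only [bessel, Complex.norm_real, Real.norm_eq_abs, sq_abs]
  rw [← Real.rpow_mul_natCast hk]
  norm_num

theorem exists_integral_bessel_le :
    ∃ C, 0 ≤ C ∧ ∀ u : Alg, ∫ k, ‖bessel k * u k‖ ≤ C * ‖l2 u‖ := by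
  refine ⟨(∫ k, ‖bessel k‖ ^ (2 : ℝ)) ^ (1 / (2 : ℝ)), by positivity, fun u => ?_⟩
  have := integral_mul_norm_le_Lp_mul_Lq (μ := (volume : Measure Plane)) (f := bessel) (g := u)
    Real.HolderConjugate.two_two (by simpa using memLp_bessel) (by simpa using u.memLp 2 volume)
  have h (f : Alg) : (∫ x, ‖f x‖ ^ (2 : ℝ)) ^ (1 / (2 : ℝ)) = ‖l2 f‖ := by
    simp only [Real.rpow_two]
    rw [← norm_sq_l2, ← Real.sqrt_eq_rpow, Real.sqrt_sq (norm_nonneg _)]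
  rw [h] at this
  simpa only [norm_mul] using this

/-- The operator `1 - Δ / (4π²)`, whose Fourier multiplier is `1 + |k|²`. -/
def regularize (f : Alg) : Alg :=
  f - (1 / (4 * Real.pi ^ 2) : ℂ) • ∑ μ, partialDeriv μ (partialDeriv μ f)

theorem fourier_partialDeriv (μ : Fin 2) (f : Alg) (k : Plane) :
    𝓕 (partialDeriv μ f) k = 2 * Real.pi * Complex.I * (k μ : ℝ) * 𝓕 f k := by
  have := fourier_lineDeriv (EuclideanSpace.single μ (1 : ℝ)) f k
  rw [EuclideanSpace.inner_single_right] at this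
  simpa [partialDeriv] using this

theorem fourier_regularize (f : Alg) (k : Plane) :
    𝓕 (regularize f) k = (1 + (‖k‖ : ℂ) ^ 2) * 𝓕 f k := by
  have hpi : (Real.pi : ℂ) ≠ 0 := by exact_mod_cast Real.pi_ne_zero
  have hk : (‖k‖ : ℂ) ^ 2 = (k 0 : ℂ) ^ 2 + (k 1 : ℂ) ^ 2 := by
    have : ‖k‖ ^ 2 = k 0 ^ 2 + k 1 ^ 2 := by
      rw [EuclideanSpace.norm_sq_eq, Fin.sum_univ_two, Real.norm_eq_abs, Real.norm_eq_abs, sq_abs,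
        sq_abs]
    exact_mod_cast this
  rw [regularize, sub_eq_add_neg, ← neg_smul, FourierTransform.fourier_add,
    FourierTransform.fourier_smul, Fin.sum_univ_two, FourierTransform.fourier_add, add_apply,
    smul_apply, add_apply, smul_eq_mul]
  simp only [fourier_partialDeriv, hk]
  field_simp
  linear_combination (-4 * ((k 0 : ℂ) ^ 2 + (k 1 : ℂ) ^ 2) * 𝓕 f k) * Complex.I_sq

/-- The `L¹` norm of the Fourier transform is dominated by a Sobolev norm, because `(1 + |k|²)⁻¹` is
square integrable on the plane. -/
theorem exists_integral_fourier_le :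
    ∃ C, 0 ≤ C ∧ ∀ f : Alg, ∫ k, ‖𝓕 f k‖ ≤ C * ‖l2 (regularize f)‖ := by
  obtain ⟨C, hC0, hC⟩ := exists_integral_bessel_le
  refine ⟨C, hC0, fun f => ?_⟩
  have := hC (𝓕 (regularize f))
  simpa only [fourier_regularize, ← mul_assoc, bessel_mul, one_mul, l2_fourier] using this

/-- The linear form `ℓ` is integration of the Fourier transform against the density `m`. -/
def HasDensity (ℓ : Alg →ₗ[ℂ] ℂ) (m : Plane → ℂ) : Prop :=
  ∀ f : Alg, Integrable (fun k => 𝓕 f k * m k) ∧ ℓ f = ∫ k, 𝓕 f k * m k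

/-- A linear form dominated by the `L¹` norm of the Fourier transform is given by a density in
momentum space. The density is produced by Riesz' theorem in a weighted `L²` space. -/
theorem exists_density (ℓ : Alg →ₗ[ℂ] ℂ) {C : ℝ} (hC0 : 0 ≤ C)
    (hC : ∀ f, ‖ℓ f‖ ≤ C * ∫ k, ‖𝓕 f k‖) :
    ∃ m, HasDensity ℓ m := by
  obtain ⟨C', hC'0, hC'⟩ := exists_integral_bessel_le
  let lift : Alg →ₗ[ℂ] Alg := (FourierTransform.fourierInvCLM ℂ Alg).toLinearMap ∘ₗ
    (SchwartzMap.smulLeftCLM ℂ bessel).toLinearMap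
  have hlift (u : Alg) (k : Plane) : 𝓕 (lift u) k = bessel k * u k := by
    change 𝓕 (𝓕⁻ (SchwartzMap.smulLeftCLM ℂ bessel u) : Alg) k = _
    rw [FourierTransform.fourier_fourierInv_eq,
      SchwartzMap.smulLeftCLM_apply_apply bessel_temperate, smul_eq_mul]
  have hbd (u : Alg) : ‖(ℓ ∘ₗ lift) u‖ ≤ (C * C') * ‖l2 u‖ := by
    refine (hC _).trans ?_
    simp only [hlift, mul_assoc]
    exact mul_le_mul_of_nonneg_left (hC' u) hC0
  have hd : DenseRange l2 := SchwartzMap.denseRange_toLpCLM (F := ℂ) (p := 2) (by simp)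
  let L := (ℓ ∘ₗ lift).extendOfNorm l2
  let w := (InnerProductSpace.toDual ℂ (Lp ℂ 2 (volume : Measure Plane))).symm L
  have hL (u : Alg) : ℓ (lift u) = ∫ k, conj (w k) * u k := by
    have h1 : L (l2 u) = ℓ (lift u) := LinearMap.extendOfNorm_eq hd ⟨_, hbd⟩ u
    rw [← h1, ← InnerProductSpace.toDual_symm_apply (y := L), L2.inner_def]
    refine integral_congr_ae ?_
    filter_upwards [SchwartzMap.coeFn_toLp u 2 volume] with k hk
    change inner ℂ (w k) ((u.toLp 2 volume) k) = _
    rw [hk, RCLike.inner_apply, mul_comm]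
  have hlift' (f : Alg) : lift (𝓕 (regularize f)) = f := by
    refine fourier_injective fun k => ?_
    rw [hlift, fourier_regularize, ← mul_assoc, bessel_mul, one_mul]
  refine ⟨fun k => (1 + (‖k‖ : ℂ) ^ 2) * conj (w k), fun f => ?_⟩
  have he (k : Plane) : 𝓕 f k * ((1 + (‖k‖ : ℂ) ^ 2) * conj (w k)) =
      conj (w k) * 𝓕 (regularize f) k := by rw [fourier_regularize]; ring
  simp_rw [he]
  refine ⟨(Lp.memLp w).star.integrable_mul ((𝓕 (regularize f)).memLp 2 volume), ?_⟩
  rw [← hL, hlift']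

/-- The linear form `ℓ` is dominated by the operator norm of left multiplication. -/
def OpDominated (θ : ℝ) (ℓ : Alg →ₗ[ℂ] ℂ) (C : ℝ) : Prop :=
  ∀ (f : Alg) (r : ℝ), 0 ≤ r → OpBound θ f r → ‖ℓ f‖ ≤ C * r

theorem OpDominated.norm_le {θ : ℝ} (hθ : 0 < θ) {ℓ : Alg →ₗ[ℂ] ℂ} {C : ℝ}
    (h : OpDominated θ ℓ C) (f : Alg) : ‖ℓ f‖ ≤ C * ∫ k, ‖𝓕 f k‖ :=
  h f _ (integral_nonneg fun _ => norm_nonneg _) (opBound_integral_fourier hθ f)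

section density

variable {ℓ : Alg →ₗ[ℂ] ℂ} {m : Plane → ℂ}

theorem density_translate (hm : HasDensity ℓ m)
    (κ : Plane) (f : Alg) : ℓ (translate κ f) = ∫ k, wave k κ * (𝓕 f k * m k) := by
  simp_rw [(hm _).2, fourier_translate, mul_assoc]

theorem continuous_translate_of_density
    (hm : HasDensity ℓ m) (f : Alg) :
    Continuous fun κ => ℓ (translate κ f) := by
  simp_rw [density_translate hm]
  refine continuous_of_dominated (bound := fun k => ‖𝓕 f k * m k‖) (fun κ => ?_)
    (fun κ => .of_forall fun k => ?_) (hm f).1.norm (.of_forall fun k => by fun_prop)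
  · exact (Continuous.aestronglyMeasurable (by fun_prop)).mul (hm f).1.aestronglyMeasurable
  · rw [norm_mul, norm_wave, one_mul]

theorem hasDerivAt_translate_of_density
    (hm : HasDensity ℓ m)
    (f : Alg) (κ d : Plane) (t : ℝ) :
    HasDerivAt (fun t : ℝ => ℓ (translate (κ + t • d) f))
      (ℓ (translate (κ + t • d) (∂_{d} f))) t := by
  simp_rw [density_translate hm]
  refine (hasDerivAt_integral_of_dominated_loc_of_deriv_le (𝕜 := ℝ) (s := Set.univ)
    (F := fun (t : ℝ) k => wave k (κ + t • d) * (𝓕 f k * m k))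
    (F' := fun (t : ℝ) k => wave k (κ + t • d) * (𝓕 (∂_{d} f : Alg) k * m k))
    (bound := fun k => ‖𝓕 (∂_{d} f : Alg) k * m k‖) Filter.univ_mem (.of_forall fun s => ?_)
    ?_ ?_ (.of_forall fun k s _ => ?_) (hm _).1.norm (.of_forall fun k s _ => ?_)).2
  · exact (Continuous.aestronglyMeasurable (by fun_prop)).mul (hm f).1.aestronglyMeasurable
  · refine (hm f).1.bdd_mul (c := 1) (Continuous.aestronglyMeasurable (by fun_prop))
      (.of_forall fun k => (norm_wave _ _).le)
  · exact (Continuous.aestronglyMeasurable (by fun_prop)).mul (hm _).1.aestronglyMeasurable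
  · rw [norm_mul, norm_wave, one_mul]
  · rw [fourier_lineDeriv]
    have h1 : HasDerivAt (fun s : ℝ => ((2 * Real.pi * inner ℝ k (κ + s • d) : ℝ) : ℂ) * Complex.I)
        (((2 * Real.pi * inner ℝ k d : ℝ) : ℂ) * Complex.I) s := by
      refine HasDerivAt.mul_const (HasDerivAt.ofReal_comp ?_) _
      simp only [inner_add_right, inner_smul_right]
      simpa using (((hasDerivAt_id s).mul_const (inner ℝ k d)).const_add
        (inner ℝ k κ)).const_mul (2 * Real.pi)
    refine (h1.cexp.mul_const (𝓕 f k * m k)).congr_deriv ?_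
    rw [wave]; push_cast; ring

/-- The value on a quantized symbol is the average of the symbol against the values on the
translates of the coherent element. -/
theorem apply_quant_of_density {θ : ℝ}
    (hm : HasDensity ℓ m) (g h : Alg) :
    ℓ (quant θ g h) = ∫ κ, h κ * ℓ (translate (-κ) (moyal θ (conjAlg g) g)) := by
  set f₀ := moyal θ (conjAlg g) g
  have h1 (k : Plane) : 𝓕 (quant θ g h) k * m k =
      ∫ κ, h κ * wave (-k) κ * (𝓕 f₀ k * m k) := by
    rw [integral_mul_const, fourier_quant, fourier_eq_wave h, mul_assoc]
  have h2 (κ : Plane) : h κ * ℓ (translate (-κ) f₀) =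
      ∫ k, h κ * wave (-k) κ * (𝓕 f₀ k * m k) := by
    rw [density_translate hm, ← integral_const_mul]
    simp_rw [wave_neg_right, mul_assoc]
  rw [(hm _).2]
  simp_rw [h1, h2]
  refine (integral_integral_swap ?_).symm
  have := (h.integrable (μ := volume)).mul_prod (hm f₀).1
  refine (this.bdd_mul (c := 1) (f := fun p : Plane × Plane => wave (-p.2) p.1)
    (Continuous.aestronglyMeasurable (by fun_prop))
    (.of_forall fun k => (norm_wave _ _).le)).congr (.of_forall fun p => ?_)
  simp only [Function.uncurry]; ring

end density

/-! ### Gaussian cutoffs and ramps -/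

/-- The bound behind the decay of the derivatives of the Gaussian; `(1 + t)^N ≤ N! exp (1 + t)`
and `1 + t - t²/2 ≤ 3/2`. -/
theorem gaussian_decay (N : ℕ) :
    ∃ C, ∀ t : ℝ, 0 ≤ t → (1 + t) ^ N * Real.exp (-t ^ 2 / 2) ≤ C := by
  refine ⟨N.factorial * Real.exp (3 / 2), fun t ht => ?_⟩
  have h1 : (1 + t) ^ N ≤ N.factorial * Real.exp (1 + t) := by
    have := Real.pow_div_factorial_le_exp (1 + t) (by linarith) N
    rwa [div_le_iff₀ (by positivity), mul_comm] at this
  calc (1 + t) ^ N * Real.exp (-t ^ 2 / 2)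
      ≤ N.factorial * Real.exp (1 + t) * Real.exp (-t ^ 2 / 2) := by gcongr
    _ = N.factorial * Real.exp (1 + t + -t ^ 2 / 2) := by rw [mul_assoc, ← Real.exp_add]
    _ ≤ _ := by gcongr; nlinarith [sq_nonneg (t - 1)]

/-- The Gaussian `exp (-|x|² / 2)`. -/
def gaussian : Alg where
  toFun x := (Real.exp (-‖x‖ ^ 2 / 2) : ℂ)
  smooth' := by
    refine Complex.ofRealCLM.contDiff.comp (Real.contDiff_exp.comp ?_)
    exact ((contDiff_norm_sq ℝ).neg).div_const 2
  decay' k n := by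
    have hq : Function.HasTemperateGrowth fun x : Plane => -‖x‖ ^ 2 / 2 := by
      have := ((Function.hasTemperateGrowth_norm_sq (H := Plane)).neg).mul
        (Function.HasTemperateGrowth.const (1 / 2 : ℝ))
      refine (funext fun x => ?_ : _ = fun x : Plane => -‖x‖ ^ 2 / 2) ▸ this
      simp only [Pi.neg_apply, Pi.mul_apply]; ring
    obtain ⟨j, C, hC0, hC⟩ := hq.norm_iteratedFDeriv_le_uniform n
    obtain ⟨B, hB⟩ := gaussian_decay (k + j * n)
    refine ⟨n.factorial * (1 + C) ^ n * B, fun x => ?_⟩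
    have h1 : ‖iteratedFDeriv ℝ n (fun x : Plane => (Real.exp (-‖x‖ ^ 2 / 2) : ℂ)) x‖ ≤
        n.factorial * Real.exp (-‖x‖ ^ 2 / 2) * ((1 + C) * (1 + ‖x‖) ^ j) ^ n := by
      have e := Complex.ofRealLI.norm_iteratedFDeriv_comp_left (i := n) (n := (⊤ : ℕ∞)) (x := x)
        (f := fun x : Plane => Real.exp (-‖x‖ ^ 2 / 2)) (Real.contDiff_exp.comp hq.1).contDiffAt
        (mod_cast le_top)
      refine e.trans_le (_root_.norm_iteratedFDeriv_comp_le (g := Real.exp)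
        (f := fun x : Plane => -‖x‖ ^ 2 / 2) (N := (⊤ : ℕ∞)) Real.contDiff_exp hq.1 (mod_cast le_top) x
        (fun i _ => ?_) fun i hi1 hi => ?_)
      · rw [norm_iteratedFDeriv_eq_norm_iteratedDeriv, iteratedDeriv_eq_iterate,
          Real.iter_deriv_exp, Real.norm_of_nonneg (Real.exp_pos _).le]
      · refine (hC i hi x).trans ?_
        have h1 : 1 ≤ (1 + C) * (1 + ‖x‖) ^ j :=
          one_le_mul_of_one_le_of_one_le (by linarith) (one_le_pow₀ (by simp))
        refine le_trans ?_ (le_self_pow₀ h1 (by omega))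
        gcongr
        linarith
    calc ‖x‖ ^ k * ‖iteratedFDeriv ℝ n (fun x : Plane => (Real.exp (-‖x‖ ^ 2 / 2) : ℂ)) x‖
        ≤ (1 + ‖x‖) ^ k * (n.factorial * Real.exp (-‖x‖ ^ 2 / 2) *
          ((1 + C) * (1 + ‖x‖) ^ j) ^ n) := by
          gcongr
          linarith
      _ = n.factorial * (1 + C) ^ n * ((1 + ‖x‖) ^ (k + j * n) * Real.exp (-‖x‖ ^ 2 / 2)) := by
          rw [mul_pow, ← pow_mul, pow_add]; ring
      _ ≤ _ := by gcongr; exact hB _ (norm_nonneg _)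

/-- The dilation `x ↦ x / (n + 1)` of the plane. -/
def shrink (n : ℕ) : Plane ≃L[ℝ] Plane :=
  ContinuousLinearEquiv.smulLeft (Units.mk0 ((n : ℝ) + 1)⁻¹ (by positivity))

theorem shrink_apply (n : ℕ) (x : Plane) : shrink n x = ((n : ℝ) + 1)⁻¹ • x := rfl

/-- The cutoff `exp (-|x|² / (2 (n + 1)²))`. -/
def cutoff (n : ℕ) : Alg := SchwartzMap.compCLMOfContinuousLinearEquiv ℂ (shrink n) gaussian

/-- The real function underlying `cutoff`. -/
def cutoffFun (n : ℕ) (x : Plane) : ℝ := Real.exp (-(((n : ℝ) + 1)⁻¹ ^ 2 * ‖x‖ ^ 2) / 2)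

theorem cutoff_apply (n : ℕ) (x : Plane) : cutoff n x = (cutoffFun n x : ℂ) := by
  change (Real.exp (-‖shrink n x‖ ^ 2 / 2) : ℂ) = _
  rw [shrink_apply, norm_smul, mul_pow, Real.norm_eq_abs, sq_abs]
  rfl

theorem cutoffFun_nonneg (n : ℕ) (x : Plane) : 0 ≤ cutoffFun n x := (Real.exp_pos _).le

theorem cutoffFun_le_one (n : ℕ) (x : Plane) : cutoffFun n x ≤ 1 := by
  refine Real.exp_le_one_iff.2 ?_
  have : 0 ≤ ((n : ℝ) + 1)⁻¹ ^ 2 * ‖x‖ ^ 2 := by positivity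
  linarith

theorem tendsto_inv_succ :
    Filter.Tendsto (fun n : ℕ => ((n : ℝ) + 1)⁻¹) Filter.atTop (nhds 0) := by
  simpa using tendsto_one_div_add_atTop_nhds_zero_nat (𝕜 := ℝ)

theorem tendsto_cutoffFun (x : Plane) :
    Filter.Tendsto (fun n => cutoffFun n x) Filter.atTop (nhds 1) := by
  have h : Filter.Tendsto (fun n : ℕ => -(((n : ℝ) + 1)⁻¹ ^ 2 * ‖x‖ ^ 2) / 2) Filter.atTop
      (nhds (-(0 ^ 2 * ‖x‖ ^ 2) / 2)) :=
    (((tendsto_inv_succ.pow 2).mul_const _).neg).div_const 2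
  have := (Real.continuous_exp.tendsto _).comp h
  simpa [cutoffFun, Function.comp_def] using this

theorem lineDeriv_cutoff (n : ℕ) (m : Plane) (f : Alg) :
    (∂_{m} (SchwartzMap.compCLMOfContinuousLinearEquiv ℂ (shrink n) f) : Alg) =
      ((n : ℝ) + 1)⁻¹ • SchwartzMap.compCLMOfContinuousLinearEquiv ℂ (shrink n) (∂_{m} f) := by
  ext x
  rw [SchwartzMap.lineDerivOp_compCLMOfContinuousLinearEquiv, shrink_apply,
    LineDeriv.lineDerivOp_left_smul]
  rfl

theorem exists_partialDeriv_cutoff_le :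
    ∃ C, 0 ≤ C ∧ ∀ n μ x, ‖partialDeriv μ (cutoff n) x‖ ≤ ((n : ℝ) + 1)⁻¹ * C ∧
      ‖partialDeriv μ (partialDeriv μ (cutoff n)) x‖ ≤ ((n : ℝ) + 1)⁻¹ * C := by
  have h (μ : Fin 2) : ∃ C, 0 ≤ C ∧ ∀ n x, ‖partialDeriv μ (cutoff n) x‖ ≤ ((n : ℝ) + 1)⁻¹ * C ∧
      ‖partialDeriv μ (partialDeriv μ (cutoff n)) x‖ ≤ ((n : ℝ) + 1)⁻¹ * C := by
    obtain ⟨C₁, h0, h1⟩ := norm_apply_le (partialDeriv μ gaussian)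
    obtain ⟨C₂, h0', h2⟩ := norm_apply_le (partialDeriv μ (partialDeriv μ gaussian))
    refine ⟨C₁ + C₂, by positivity, fun n x => ?_⟩
    have hn : 0 ≤ ((n : ℝ) + 1)⁻¹ := by positivity
    have hn1 : ((n : ℝ) + 1)⁻¹ ≤ 1 := inv_le_one_of_one_le₀ (by simp)
    have e1 : partialDeriv μ (cutoff n) = ((n : ℝ) + 1)⁻¹ •
      SchwartzMap.compCLMOfContinuousLinearEquiv ℂ (shrink n) (partialDeriv μ gaussian) :=
      lineDeriv_cutoff n _ _
    have e2 : partialDeriv μ (partialDeriv μ (cutoff n)) = ((n : ℝ) + 1)⁻¹ • ((n : ℝ) + 1)⁻¹ •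
      SchwartzMap.compCLMOfContinuousLinearEquiv ℂ (shrink n)
        (partialDeriv μ (partialDeriv μ gaussian)) := by
      rw [e1]
      change (∂_{(EuclideanSpace.single μ (1 : ℝ) : Plane)} (((n : ℝ) + 1)⁻¹ • _ : Alg) : Alg) = _
      rw [LineDeriv.lineDerivOp_smul, lineDeriv_cutoff]
      rfl
    constructor
    · rw [e1, smul_apply, norm_smul, Real.norm_of_nonneg hn]
      gcongr
      exact (h1 _).trans (by linarith)
    · rw [e2, smul_apply, norm_smul, smul_apply, norm_smul, Real.norm_of_nonneg hn]
      gcongr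
      refine (mul_le_of_le_one_left (norm_nonneg _) hn1).trans ((h2 _).trans (by linarith))
  choose C h0 hC using h
  refine ⟨C 0 + C 1, add_nonneg (h0 0) (h0 1), fun n μ x => ?_⟩
  have hn : 0 ≤ ((n : ℝ) + 1)⁻¹ := by positivity
  have hμ : C μ ≤ C 0 + C 1 := by fin_cases μ <;> simp [h0]
  exact ⟨(hC μ n x).1.trans (by gcongr), (hC μ n x).2.trans (by gcongr)⟩

/-- The linear function `x ↦ v·x` with a Gaussian cutoff. -/
def ramp (v : Plane) (n : ℕ) : Alg :=
  SchwartzMap.smulLeftCLM ℂ (fun x => ((inner ℝ v x : ℝ) : ℂ)) (cutoff n)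

theorem ramp_apply (v : Plane) (n : ℕ) (x : Plane) :
    ramp v n x = ((inner ℝ v x * cutoffFun n x : ℝ) : ℂ) := by
  have : Function.HasTemperateGrowth fun x : Plane => ((inner ℝ v x : ℝ) : ℂ) := by fun_prop
  rw [ramp, SchwartzMap.smulLeftCLM_apply_apply this, cutoff_apply, smul_eq_mul]
  push_cast; rfl

/-- The gradient of `ramp v n`. -/
def rampGrad (v : Plane) (n : ℕ) (μ : Fin 2) (x : Plane) : ℝ :=
  (v μ - ((n : ℝ) + 1)⁻¹ ^ 2 * inner ℝ v x * x μ) * cutoffFun n x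

theorem partialDeriv_ramp (v : Plane) (n : ℕ) (μ : Fin 2) (x : Plane) :
    partialDeriv μ (ramp v n) x = (rampGrad v n μ x : ℂ) := by
  change (∂_{EuclideanSpace.single μ (1 : ℝ)} (ramp v n) : Alg) x = _
  set e : Plane := EuclideanSpace.single μ (1 : ℝ)
  set ε : ℝ := ((n : ℝ) + 1)⁻¹
  rw [SchwartzMap.lineDerivOp_apply]
  refine HasLineDerivAt.lineDeriv ?_
  have hx : inner ℝ x e = x μ := by simp [e, EuclideanSpace.inner_single_right]
  have hv : inner ℝ v e = v μ := by simp [e, EuclideanSpace.inner_single_right]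
  have he : ‖e‖ = 1 := by simp [e]
  have h0 : HasDerivAt (fun t : ℝ => -(ε ^ 2 * (‖x‖ ^ 2 + 2 * (t * x μ) + t ^ 2)) / 2)
      (-(ε ^ 2 * (2 * x μ)) / 2) 0 := by
    have := ((((hasDerivAt_id (0 : ℝ)).mul_const (x μ)).const_mul 2).const_add (‖x‖ ^ 2)).add
      ((hasDerivAt_id (0 : ℝ)).pow 2)
    have := ((this.const_mul (ε ^ 2)).neg).div_const 2
    simpa using this
  have h1 : HasDerivAt (fun t : ℝ => (inner ℝ v x + t * v μ) *
      Real.exp (-(ε ^ 2 * (‖x‖ ^ 2 + 2 * (t * x μ) + t ^ 2)) / 2)) (rampGrad v n μ x) 0 := by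
    have := (((hasDerivAt_id (0 : ℝ)).mul_const (v μ)).const_add (inner ℝ v x)).mul h0.exp
    refine this.congr_deriv ?_
    have e0 : -(ε ^ 2 * (‖x‖ ^ 2 + 2 * (0 * x μ) + 0 ^ 2)) / 2 = -(ε ^ 2 * ‖x‖ ^ 2) / 2 := by ring
    simp only [rampGrad, cutoffFun, id, e0]
    ring
  refine h1.ofReal_comp.congr_of_eventuallyEq (.of_forall fun t => ?_)
  simp only
  rw [ramp_apply, cutoffFun, inner_add_right, inner_smul_right, hv, norm_add_sq_real,
    inner_smul_right, hx, norm_smul, he, mul_one, Real.norm_eq_abs, sq_abs]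

/-- The cutoff does not increase the length of the gradient. With `r = |x|² / (n + 1)²` this comes
down to `1 + r (r - 2) ≤ exp r`. -/
theorem sum_rampGrad_sq_le (v : Plane) (n : ℕ) (x : Plane) :
    rampGrad v n 0 x ^ 2 + rampGrad v n 1 x ^ 2 ≤ ‖v‖ ^ 2 := by
  set ε : ℝ := ((n : ℝ) + 1)⁻¹ with hε
  set r : ℝ := ε ^ 2 * ‖x‖ ^ 2 with hr
  set q : ℝ := inner ℝ v x with hq
  have hr0 : 0 ≤ r := by positivity
  have hxn : ‖x‖ ^ 2 = x 0 ^ 2 + x 1 ^ 2 := by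
    rw [EuclideanSpace.norm_sq_eq, Fin.sum_univ_two, Real.norm_eq_abs, Real.norm_eq_abs, sq_abs,
      sq_abs]
  have hvn : ‖v‖ ^ 2 = v 0 ^ 2 + v 1 ^ 2 := by
    rw [EuclideanSpace.norm_sq_eq, Fin.sum_univ_two, Real.norm_eq_abs, Real.norm_eq_abs, sq_abs,
      sq_abs]
  have hqe : q = v 0 * x 0 + v 1 * x 1 := by
    simp [hq, PiLp.inner_apply, Fin.sum_univ_two, mul_comm]
  have hqle : q ^ 2 ≤ ‖v‖ ^ 2 * ‖x‖ ^ 2 := by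
    rw [hvn, hxn, hqe]; nlinarith [sq_nonneg (v 0 * x 1 - v 1 * x 0)]
  have hcut : cutoffFun n x ^ 2 = Real.exp (-r) := by
    rw [cutoffFun, ← Real.exp_nat_mul]; congr 1; push_cast; ring
  have h1 : rampGrad v n 0 x ^ 2 + rampGrad v n 1 x ^ 2 =
      (‖v‖ ^ 2 + ε ^ 2 * q ^ 2 * (r - 2)) * Real.exp (-r) := by
    rw [← hcut, rampGrad, rampGrad, hvn, hr, hxn, ← hq, ← hε]
    linear_combination (-2 * ε ^ 2 * q * cutoffFun n x ^ 2) * hqe.symm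
  have hexp : 1 + r * max (r - 2) 0 ≤ Real.exp r := by
    have h3 := Real.sum_le_exp_of_nonneg hr0 4
    simp [Finset.sum_range_succ, Nat.factorial] at h3
    rcases max_cases (r - 2) 0 with ⟨h, _⟩ | ⟨h, _⟩ <;> rw [h]
    · nlinarith [sq_nonneg (r - 1), mul_nonneg hr0 (sq_nonneg (r - 3))]
    · nlinarith [mul_nonneg hr0 hr0, mul_nonneg hr0 (mul_nonneg hr0 hr0)]
  rw [h1, Real.exp_neg, ← div_eq_mul_inv, div_le_iff₀ (Real.exp_pos _)]
  have h2 : ε ^ 2 * q ^ 2 * (r - 2) ≤ ‖v‖ ^ 2 * (r * max (r - 2) 0) := by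
    calc ε ^ 2 * q ^ 2 * (r - 2) ≤ ε ^ 2 * q ^ 2 * max (r - 2) 0 := by
          gcongr; exact le_max_left _ _
      _ ≤ ε ^ 2 * (‖v‖ ^ 2 * ‖x‖ ^ 2) * max (r - 2) 0 := by
          gcongr
      _ = _ := by rw [hr]; ring
  nlinarith [mul_le_mul_of_nonneg_left hexp (sq_nonneg ‖v‖)]

/-- The ramps are Lipschitz with constant `|v|`. -/
theorem abs_ramp_sub_le (v : Plane) (n : ℕ) (x y : Plane) :
    ‖ramp v n x - ramp v n y‖ ≤ ‖v‖ * ‖x - y‖ := by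
  refine Convex.norm_image_sub_le_of_norm_fderiv_le (𝕜 := ℝ) (s := Set.univ)
    (fun z _ => (ramp v n).differentiableAt) (fun z _ => ?_) convex_univ trivial trivial
  refine ContinuousLinearMap.opNorm_le_bound _ (norm_nonneg _) fun m => ?_
  have hm : m = m 0 • EuclideanSpace.single 0 (1 : ℝ) + m 1 • EuclideanSpace.single 1 (1 : ℝ) := by
    ext i; fin_cases i <;> simp
  have h (μ : Fin 2) : fderiv ℝ (ramp v n) z (EuclideanSpace.single μ (1 : ℝ)) =
      (rampGrad v n μ z : ℂ) := by
    rw [← partialDeriv_ramp]; rfl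
  have hmn : ‖m‖ ^ 2 = m 0 ^ 2 + m 1 ^ 2 := by
    rw [EuclideanSpace.norm_sq_eq, Fin.sum_univ_two, Real.norm_eq_abs, Real.norm_eq_abs, sq_abs,
      sq_abs]
  rw [hm, map_add, map_smul, map_smul, h, h, ← hm]
  have e : m 0 • (rampGrad v n 0 z : ℂ) + m 1 • (rampGrad v n 1 z : ℂ) =
      ((m 0 * rampGrad v n 0 z + m 1 * rampGrad v n 1 z : ℝ) : ℂ) := by
    simp only [Complex.real_smul]; push_cast; ring
  rw [e, Complex.norm_real, Real.norm_eq_abs]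
  refine abs_le_of_sq_le_sq ?_ (by positivity)
  have := sum_rampGrad_sq_le v n z
  rw [mul_pow, hmn]
  nlinarith [sq_nonneg (m 0 * rampGrad v n 1 z - m 1 * rampGrad v n 0 z), sq_nonneg (m 0),
    sq_nonneg (m 1), mul_le_mul_of_nonneg_right this (by positivity : 0 ≤ m 0 ^ 2 + m 1 ^ 2)]

/-! ### Operator bounds -/

section bilinear

variable (θ : ℝ) (f f' g g' : Alg) (c : ℂ)

theorem moyal_add_left : moyal θ (f + f') g = moyal θ f g + moyal θ f' g :=
  (leftMul θ).map_add₂ f f' g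

theorem moyal_sub_left : moyal θ (f - f') g = moyal θ f g - moyal θ f' g :=
  (leftMul θ).map_sub₂ f f' g

theorem moyal_smul_left : moyal θ (c • f) g = c • moyal θ f g :=
  (leftMul θ).map_smul₂ c f g

theorem moyal_add_right : moyal θ f (g + g') = moyal θ f g + moyal θ f g' :=
  (leftMul θ f).map_add g g'

theorem moyal_smul_right : moyal θ f (c • g) = c • moyal θ f g :=
  (leftMul θ f).map_smul c g

theorem moyal_sub_right : moyal θ f (g - g') = moyal θ f g - moyal θ f g' :=
  (leftMul θ f).map_sub g g'

end bilinear

theorem conjAlg_add (f g : Alg) : conjAlg (f + g) = conjAlg f + conjAlg g := by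
  ext x; simp [conjAlg_apply]

theorem conjAlg_smul (c : ℂ) (f : Alg) : conjAlg (c • f) = conj c • conjAlg f := by
  ext x; simp [conjAlg_apply]

theorem OpBound.mono {θ : ℝ} {f : Alg} {r s : ℝ} (h : OpBound θ f r) (hrs : r ≤ s) :
    OpBound θ f s := fun ψ => (h ψ).trans (by gcongr)

theorem OpBound.smul {θ : ℝ} {f : Alg} {r : ℝ} (h : OpBound θ f r) (c : ℂ) :
    OpBound θ (c • f) (‖c‖ * r) := fun ψ => by
  rw [moyal_smul_left, map_smul, norm_smul, mul_assoc]
  gcongr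
  exact h ψ

theorem OpBound.moyal {θ : ℝ} (hθ : 0 < θ) {f g : Alg} {r s : ℝ} (hr : 0 ≤ r)
    (hf : OpBound θ f r) (hg : OpBound θ g s) : OpBound θ (moyal θ f g) (r * s) := fun ψ => by
  rw [moyal_assoc hθ, mul_assoc]
  exact (hf _).trans (mul_le_mul_of_nonneg_left (hg ψ) hr)

theorem OpBound.translate {θ : ℝ} {f : Alg} {r : ℝ} (hf : OpBound θ f r) (κ : Plane) :
    OpBound θ (translate κ f) r := fun ψ => by
  have e : ψ = MoyalPlane.translate κ (MoyalPlane.translate (-κ) ψ) := by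
    ext x; simp [translate_apply]
  conv_lhs => rw [e]
  rw [moyal_translate, l2_translate]
  exact (hf _).trans_eq (by rw [l2_translate])

theorem OpBound.conjAlg {θ : ℝ} (hθ : 0 < θ) {f : Alg} {r : ℝ} (hr : 0 ≤ r)
    (hf : OpBound θ f r) : OpBound θ (conjAlg f) r := fun ψ => by
  set χ := MoyalPlane.moyal θ (MoyalPlane.conjAlg f) ψ
  have h1 : inner ℂ (l2 ψ) (l2 (MoyalPlane.moyal θ f χ)) = inner ℂ (l2 χ) (l2 χ) := by
    rw [inner_l2, inner_l2, integral_conj_mul_moyal hθ]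
  have h2 : ‖l2 χ‖ ^ 2 ≤ ‖l2 ψ‖ * (r * ‖l2 χ‖) := by
    have := norm_inner_le_norm (𝕜 := ℂ) (l2 ψ) (l2 (MoyalPlane.moyal θ f χ))
    rw [h1, inner_self_eq_norm_sq_to_K, norm_pow, RCLike.norm_ofReal, abs_of_nonneg
      (norm_nonneg _)] at this
    exact this.trans (mul_le_mul_of_nonneg_left (hf χ) (norm_nonneg _))
  rcases (norm_nonneg (l2 χ)).eq_or_lt with h0 | h0
  · rw [← h0]; positivity
  · nlinarith

theorem opBound_quant {θ : ℝ} (hθ : 0 < θ) {g : Alg} (hg : ‖l2 g‖ = 1) {h : Alg} {r : ℝ}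
    (hr : 0 ≤ r) (hh : ∀ x, ‖h x‖ ≤ r) : OpBound θ (quant θ g h) r := fun ψ => by
  have := quant_matrix_bound hθ hg (fun _ _ : Unit => h) r (fun κ Y => by
    simp only [Finset.univ_unique, Finset.sum_singleton, norm_mul, mul_pow]
    gcongr
    exact hh κ) (fun _ => ψ)
  simp only [Finset.univ_unique, Finset.sum_singleton, ← mul_pow] at this
  exact le_of_sq_le_sq this (by positivity)

theorem partialDeriv_quant (θ : ℝ) (g h : Alg) (μ : Fin 2) :
    partialDeriv μ (quant θ g h) = quant θ g (partialDeriv μ h) :=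
  fourier_injective fun k => by
    rw [fourier_partialDeriv, fourier_quant, fourier_quant, fourier_partialDeriv, ← mul_assoc]

theorem translate_quant (θ : ℝ) (g h : Alg) (κ : Plane) :
    translate κ (quant θ g h) = quant θ g (translate κ h) :=
  fourier_injective fun k => by
    rw [fourier_translate, fourier_quant, fourier_quant, fourier_translate, mul_assoc]

theorem partialDeriv_moyal {θ : ℝ} (hθ : 0 < θ) (μ : Fin 2) (f g : Alg) :
    partialDeriv μ (moyal θ f g) = moyal θ (partialDeriv μ f) g + moyal θ f (partialDeriv μ g) :=
  lineDeriv_moyal hθ _ f g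

/-! ### The quantized cutoffs form an approximate unit -/

theorem norm_cutoff_le (n : ℕ) (x : Plane) : ‖cutoff n x‖ ≤ 1 := by
  rw [cutoff_apply, Complex.norm_real, Real.norm_of_nonneg (cutoffFun_nonneg n x)]
  exact cutoffFun_le_one n x

theorem tendsto_cutoff (x : Plane) :
    Filter.Tendsto (fun n => cutoff n x) Filter.atTop (nhds 1) := by
  simp_rw [cutoff_apply]
  exact (Complex.continuous_ofReal.tendsto _).comp (tendsto_cutoffFun x)

/-- Quantized cutoffs converge strongly to the identity: they are contractions, and their diagonal
matrix elements converge by dominated convergence. -/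
theorem tendsto_l2_quant_cutoff {θ : ℝ} (hθ : 0 < θ) {g : Alg} (hg : ‖l2 g‖ = 1) (ψ : Alg) :
    Filter.Tendsto (fun n => ‖l2 (moyal θ (quant θ g (cutoff n)) ψ - ψ)‖) Filter.atTop
      (nhds 0) := by
  have h1 : Filter.Tendsto
      (fun n => inner ℂ (l2 ψ) (l2 (moyal θ (quant θ g (cutoff n)) ψ))) Filter.atTop
      (nhds ((‖l2 ψ‖ ^ 2 : ℝ) : ℂ)) := by
    have h2 : ((‖l2 ψ‖ ^ 2 : ℝ) : ℂ) = ∫ p, 1 * (conj (coherent θ g ψ p) * coherent θ g ψ p)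
        ∂(volume.prod volume) := by
      have := integral_coherent hθ g ψ
      rw [hg, one_pow, one_mul] at this
      rw [← this, ← integral_complex_ofReal]
      congr 1; ext p
      rw [Complex.conj_mul', one_mul]; push_cast; rfl
    rw [h2]
    simp_rw [inner_quant hθ]
    have hi : Integrable (fun p => conj (coherent θ g ψ p) * coherent θ g ψ p)
        (volume.prod volume) :=
      (memLp_coherent hθ g ψ).star.integrable_mul (memLp_coherent hθ g ψ)
    refine tendsto_integral_of_dominated_convergence _
      (fun n => (integrable_symbol hθ g (cutoff n) ψ ψ).aestronglyMeasurable) hi.norm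
      (fun n => .of_forall fun p => ?_) (.of_forall fun p => (tendsto_cutoff p.1).mul_const _)
    rw [norm_mul]
    exact mul_le_of_le_one_left (norm_nonneg _) (norm_cutoff_le n _)
  have h3 : Filter.Tendsto (fun n => 2 * ‖l2 ψ‖ ^ 2 -
      2 * (inner ℂ (l2 ψ) (l2 (moyal θ (quant θ g (cutoff n)) ψ))).re) Filter.atTop (nhds 0) := by
    have := (((Complex.continuous_re.tendsto _).comp h1).const_mul 2).const_sub (2 * ‖l2 ψ‖ ^ 2)
    rw [Complex.ofReal_re, sub_self] at this
    exact this
  have h4 : Filter.Tendsto (fun n => ‖l2 (moyal θ (quant θ g (cutoff n)) ψ - ψ)‖ ^ 2)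
      Filter.atTop (nhds 0) := by
    refine squeeze_zero (fun n => by positivity) (fun n => ?_) h3
    rw [map_sub, norm_sub_rev, norm_sub_sq (𝕜 := ℂ)]
    have := opBound_quant hθ hg zero_le_one (norm_cutoff_le n) ψ
    rw [one_mul] at this
    have : ‖l2 (moyal θ (quant θ g (cutoff n)) ψ)‖ ^ 2 ≤ ‖l2 ψ‖ ^ 2 := by gcongr
    simp only [RCLike.re_to_complex]
    linarith
  have := (Real.continuous_sqrt.tendsto 0).comp h4
  simpa [Function.comp_def, Real.sqrt_sq] using this

/-- Quantized cutoffs are an approximate unit for every linear form dominated by the operator norm.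
By the Leibniz rule the defect goes to zero in a Sobolev norm, which dominates the operator
norm. -/
theorem tendsto_apply_quant_cutoff {θ : ℝ} (hθ : 0 < θ) {g : Alg} (hg : ‖l2 g‖ = 1)
    {ℓ : Alg →ₗ[ℂ] ℂ} {C : ℝ} (hC0 : 0 ≤ C) (hℓ : OpDominated θ ℓ C) (b : Alg) :
    Filter.Tendsto (fun n => ℓ (moyal θ (quant θ g (cutoff n)) b)) Filter.atTop (nhds (ℓ b)) := by
  obtain ⟨C', hC'0, hC'⟩ := exists_integral_fourier_le
  obtain ⟨B, hB0, hB⟩ := exists_partialDeriv_cutoff_le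
  set F : ℕ → Alg := fun n => moyal θ (quant θ g (cutoff n)) b - b with hF
  have hsmall (s : ℕ → Alg) (ψ : Alg) (hs : ∀ n x, ‖s n x‖ ≤ ((n : ℝ) + 1)⁻¹ * B) :
      Filter.Tendsto (fun n => ‖l2 (moyal θ (quant θ g (s n)) ψ)‖) Filter.atTop (nhds 0) := by
    have h0 : Filter.Tendsto (fun n : ℕ => ((n : ℝ) + 1)⁻¹ * B * ‖l2 ψ‖) Filter.atTop (nhds 0) := by
      simpa using (tendsto_inv_succ.mul_const B).mul_const ‖l2 ψ‖
    exact squeeze_zero (fun n => norm_nonneg _)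
      (fun n => opBound_quant hθ hg (by positivity) (hs n) ψ) h0
  have hder (μ : Fin 2) : Filter.Tendsto (fun n => ‖l2 (partialDeriv μ (partialDeriv μ (F n)))‖)
      Filter.atTop (nhds 0) := by
    have e (n : ℕ) : partialDeriv μ (partialDeriv μ (F n)) =
        moyal θ (quant θ g (partialDeriv μ (partialDeriv μ (cutoff n)))) b +
        (2 : ℂ) • moyal θ (quant θ g (partialDeriv μ (cutoff n))) (partialDeriv μ b) +
        (moyal θ (quant θ g (cutoff n)) (partialDeriv μ (partialDeriv μ b)) -
          partialDeriv μ (partialDeriv μ b)) := by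
      simp only [hF, map_sub, map_add, partialDeriv_moyal hθ, partialDeriv_quant]
      module
    have h0 := ((hsmall _ b fun n x => (hB n μ x).2).add
      ((hsmall _ (partialDeriv μ b) fun n x => (hB n μ x).1).const_mul 2)).add
        (tendsto_l2_quant_cutoff hθ hg (partialDeriv μ (partialDeriv μ b)))
    simp only [mul_zero, add_zero] at h0
    refine squeeze_zero (fun n => norm_nonneg _) (fun n => ?_) h0
    rw [e, map_add, map_add, map_smul]
    refine (norm_add_le _ _).trans (add_le_add_left ((norm_add_le _ _).trans ?_) _)
    rw [norm_smul]; simp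
  have hreg : Filter.Tendsto (fun n => ‖l2 (regularize (F n))‖) Filter.atTop (nhds 0) := by
    have h0 := (tendsto_l2_quant_cutoff hθ hg b).add
      (((hder 0).add (hder 1)).const_mul ‖(1 / (4 * Real.pi ^ 2) : ℂ)‖)
    simp only [mul_zero, add_zero] at h0
    refine squeeze_zero (fun n => norm_nonneg _) (fun n => ?_) h0
    rw [regularize, map_sub, map_smul, Fin.sum_univ_two, map_add]
    refine (norm_sub_le _ _).trans (add_le_add_right ?_ _)
    rw [norm_smul]
    gcongr
    exact norm_add_le _ _
  rw [tendsto_iff_norm_sub_tendsto_zero]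
  have h0 := hreg.const_mul (C * C')
  rw [mul_zero] at h0
  refine squeeze_zero (fun n => norm_nonneg _) (fun n => ?_) h0
  rw [← map_sub, mul_assoc]
  exact (hℓ.norm_le hθ _).trans (mul_le_mul_of_nonneg_left (hC' _) hC0)

/-! ### States -/

theorem norm_sq_core (θ : ℝ) (ψ : Spinor) :
    ‖(moyalTriple θ).core ψ‖ ^ 2 = ∑ i, ‖l2 (ψ i)‖ ^ 2 := PiLp.norm_sq_eq_of_L2 _ _

theorem contractive_rep_iff (θ : ℝ) (f : Alg) :
    (moyalTriple θ).Contractive ((moyalTriple θ).rep f) ↔ OpBound θ f 1 := by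
  have hrep (ψ : Spinor) (i : Fin 2) : (moyalTriple θ).rep f ψ i = moyal θ f (ψ i) := rfl
  constructor
  · intro h ψ
    have := pow_le_pow_left₀ (norm_nonneg _) (h ![ψ, 0]) 2
    rw [norm_sq_core, norm_sq_core, Fin.sum_univ_two, Fin.sum_univ_two] at this
    simp only [hrep, Matrix.cons_val_zero, Matrix.cons_val_one, map_zero, norm_zero] at this
    have h0 : moyal θ f 0 = 0 := (leftMul θ f).map_zero
    rw [h0, map_zero, norm_zero] at this
    rw [one_mul]
    exact le_of_sq_le_sq (by simpa using this) (norm_nonneg _)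
  · intro h ψ
    refine le_of_sq_le_sq ?_ (norm_nonneg _)
    rw [norm_sq_core, norm_sq_core]
    gcongr with i
    exact (h (ψ i)).trans_eq (one_mul _)

namespace IsState

variable {θ : ℝ} {φ : Alg →ₗ[ℂ] ℂ}

theorem opDominated (hφ : IsState θ φ) : OpDominated θ φ 1 := by
  intro f r hr hf
  have key : ∀ s, 0 < s → OpBound θ f s → ‖φ f‖ ≤ s := fun s hs hf => by
    have h1 : OpBound θ (((s⁻¹ : ℝ) : ℂ) • f) 1 := by
      have := hf.smul ((s⁻¹ : ℝ) : ℂ)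
      rwa [Complex.norm_real, Real.norm_of_nonneg (by positivity), inv_mul_cancel₀ hs.ne'] at this
    have h2 := hφ.norm_eq_one.1 ⟨_, (contractive_rep_iff θ _).2 h1, rfl⟩
    rw [map_smul, norm_smul, Complex.norm_real, Real.norm_of_nonneg (by positivity),
      inv_mul_le_iff₀ hs, mul_one] at h2
    exact h2
  rw [one_mul]
  refine le_of_forall_pos_le_add fun ε hε => key _ (by positivity) (hf.mono (by linarith))

/-- The Cauchy-Schwarz inequality for a state, in additive form. -/
theorem two_mul_re_le (hφ : IsState θ φ) (x y : Alg) :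
    2 * (φ (moyal θ (conjAlg x) y)).re ≤
      (φ (moyal θ (conjAlg x) x)).re + (φ (moyal θ (conjAlg y) y)).re := by
  have e (c : ℂ) : φ (moyal θ (conjAlg (x + c • y)) (x + c • y)) =
      φ (moyal θ (conjAlg x) x) + c * φ (moyal θ (conjAlg x) y) +
        conj c * φ (moyal θ (conjAlg y) x) + conj c * c * φ (moyal θ (conjAlg y) y) := by
    simp only [conjAlg_add, conjAlg_smul, moyal_add_left, moyal_add_right, moyal_smul_left,
      moyal_smul_right, map_add, map_smul, smul_eq_mul]
    ring
  have h1 := (hφ.nonneg (x + (-1 : ℂ) • y)).1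
  have h2 := (hφ.nonneg (x + Complex.I • y)).2
  have hx := (hφ.nonneg x).2
  have hy := (hφ.nonneg y).2
  rw [e] at h1 h2
  simp at h1 h2
  rw [hx, hy] at h2
  linarith

end IsState

/-- The density `κ ↦ φ (f₀(· - κ))` of a state, where `f₀ = g^* ⋆ g`. The value is real, since
`f₀(· - κ)` is positive. -/
def husimi (θ : ℝ) (g : Alg) (φ : Alg →ₗ[ℂ] ℂ) (κ : Plane) : ℝ :=
  (φ (translate (-κ) (moyal θ (conjAlg g) g))).re

theorem translate_coherent (θ : ℝ) (g : Alg) (κ : Plane) :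
    translate κ (moyal θ (conjAlg g) g) =
      moyal θ (conjAlg (translate κ g)) (translate κ g) := by
  rw [conjAlg_translate, moyal_translate]

section husimi

variable {θ : ℝ} {φ : Alg →ₗ[ℂ] ℂ} {g : Alg}

theorem husimi_nonneg (hφ : IsState θ φ) (κ : Plane) : 0 ≤ husimi θ g φ κ := by
  rw [husimi, translate_coherent]; exact (hφ.nonneg _).1

theorem apply_translate_eq_husimi (hφ : IsState θ φ) (κ : Plane) :
    φ (translate (-κ) (moyal θ (conjAlg g) g)) = husimi θ g φ κ := by
  apply Complex.ext
  · rfl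
  · rw [translate_coherent, Complex.ofReal_im]; exact (hφ.nonneg _).2

theorem continuous_apply_translate (hθ : 0 < θ) {ℓ : Alg →ₗ[ℂ] ℂ} {C : ℝ} (hC0 : 0 ≤ C)
    (hℓ : OpDominated θ ℓ C) (f : Alg) : Continuous fun κ => ℓ (translate (-κ) f) := by
  obtain ⟨m, hm⟩ := exists_density ℓ hC0 (hℓ.norm_le hθ)
  exact (continuous_translate_of_density hm f).comp continuous_neg

theorem apply_quant (hθ : 0 < θ) {ℓ : Alg →ₗ[ℂ] ℂ} {C : ℝ} (hC0 : 0 ≤ C)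
    (hℓ : OpDominated θ ℓ C) (h : Alg) :
    Integrable (fun κ => h κ * ℓ (translate (-κ) (moyal θ (conjAlg g) g))) ∧
      ℓ (quant θ g h) = ∫ κ, h κ * ℓ (translate (-κ) (moyal θ (conjAlg g) g)) := by
  obtain ⟨m, hm⟩ := exists_density ℓ hC0 (hℓ.norm_le hθ)
  refine ⟨?_, apply_quant_of_density hm g h⟩
  refine integrable_mul_bounded h (continuous_apply_translate hθ hC0 hℓ _) (C := C * _) fun κ =>
    hℓ _ _ (integral_nonneg fun _ => norm_nonneg _) ((opBound_integral_fourier hθ _).translate _)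

theorem apply_quant_eq_integral_husimi (hθ : 0 < θ) (hφ : IsState θ φ) (h : Alg) :
    φ (quant θ g h) = ∫ κ, h κ * husimi θ g φ κ := by
  simp_rw [(apply_quant hθ zero_le_one hφ.opDominated h).2, apply_translate_eq_husimi hφ]

theorem continuous_husimi (hθ : 0 < θ) (hφ : IsState θ φ) : Continuous (husimi θ g φ) :=
  Complex.continuous_re.comp (continuous_apply_translate hθ zero_le_one hφ.opDominated _)

theorem integrable_cutoff_husimi (hθ : 0 < θ) (hφ : IsState θ φ) (n : ℕ) :
    Integrable fun κ => cutoffFun n κ * husimi θ g φ κ := by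
  have := (apply_quant (g := g) hθ zero_le_one hφ.opDominated (cutoff n)).1.re
  simpa [cutoff_apply, husimi] using this

theorem integral_cutoff_husimi (hθ : 0 < θ) (hφ : IsState θ φ) (n : ℕ) :
    ((∫ κ, cutoffFun n κ * husimi θ g φ κ : ℝ) : ℂ) = φ (quant θ g (cutoff n)) := by
  rw [apply_quant_eq_integral_husimi hθ hφ, ← integral_complex_ofReal]
  simp_rw [cutoff_apply, Complex.ofReal_mul]

/-- Fatou's lemma, applied to the values of the state on the quantized cutoffs, which are
contractions. -/
theorem lintegral_husimi_le (hθ : 0 < θ) (hg : ‖l2 g‖ = 1) (hφ : IsState θ φ) :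
    ∫⁻ κ, ENNReal.ofReal (husimi θ g φ κ) ≤ 1 := by
  have hlim (κ : Plane) : Filter.Tendsto
      (fun n => ENNReal.ofReal (cutoffFun n κ * husimi θ g φ κ)) Filter.atTop
      (nhds (ENNReal.ofReal (husimi θ g φ κ))) := by
    have := (tendsto_cutoffFun κ).mul_const (husimi θ g φ κ)
    rw [one_mul] at this
    exact (ENNReal.continuous_ofReal.tendsto _).comp this
  simp_rw [fun κ => (hlim κ).liminf_eq.symm]
  refine (lintegral_liminf_le' fun n => ?_).trans ?_
  · exact (integrable_cutoff_husimi hθ hφ n).aestronglyMeasurable.aemeasurable.ennreal_ofReal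
  refine Filter.liminf_le_of_le (by isBoundedDefault) fun b hb => ?_
  obtain ⟨n, hn⟩ := hb.exists
  refine hn.trans ?_
  rw [← ofReal_integral_eq_lintegral_ofReal (integrable_cutoff_husimi hθ hφ n)
    (.of_forall fun κ => mul_nonneg (cutoffFun_nonneg n κ) (husimi_nonneg hφ κ)),
    ENNReal.ofReal_le_one]
  have h1 := hφ.opDominated _ 1 zero_le_one
    (opBound_quant hθ hg zero_le_one (norm_cutoff_le n))
  rw [← integral_cutoff_husimi hθ hφ, Complex.norm_real, one_mul] at h1
  exact (le_abs_self _).trans h1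

theorem integrable_husimi (hθ : 0 < θ) (hg : ‖l2 g‖ = 1) (hφ : IsState θ φ) :
    Integrable (husimi θ g φ) := by
  refine ⟨(continuous_husimi hθ hφ).aestronglyMeasurable, ?_⟩
  rw [hasFiniteIntegral_iff_ofReal (.of_forall fun κ => husimi_nonneg hφ κ)]
  exact (lintegral_husimi_le hθ hg hφ).trans_lt ENNReal.one_lt_top

/-- Comparison of a state on contractions with the mass of its density: integrate the
Cauchy-Schwarz inequality for `g(· - κ)` and `g(· - κ) ⋆ b` over `κ`. -/
theorem two_mul_re_le_integral_husimi (hθ : 0 < θ) (hg : ‖l2 g‖ = 1) (hφ : IsState θ φ) {b : Alg}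
    (hb : OpBound θ b 1) : 2 * (φ b).re ≤ (∫ κ, husimi θ g φ κ) + 1 := by
  let right : Alg →ₗ[ℂ] Alg := (leftMul θ).flip b
  let both : Alg →ₗ[ℂ] Alg := leftMul θ (conjAlg b) ∘ₗ right
  have hright : OpDominated θ (φ ∘ₗ right) 1 := fun f r hr hf => by
    have := hφ.opDominated (moyal θ f b) (r * 1) (by positivity) (hf.moyal hθ hr hb)
    rwa [mul_one] at this
  have hboth : OpDominated θ (φ ∘ₗ both) 1 := fun f r hr hf => by
    have := hφ.opDominated (moyal θ (conjAlg b) (moyal θ f b)) (1 * (r * 1)) (by positivity)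
      ((hb.conjAlg hθ zero_le_one).moyal hθ zero_le_one (hf.moyal hθ hr hb))
    rwa [mul_one, one_mul r] at this
  have hpt (κ : Plane) : 2 * (φ (right (translate (-κ) (moyal θ (conjAlg g) g)))).re ≤
      husimi θ g φ κ + (φ (both (translate (-κ) (moyal θ (conjAlg g) g)))).re := by
    have := hφ.two_mul_re_le (translate (-κ) g) (moyal θ (translate (-κ) g) b)
    rw [conjAlg_moyal hθ, moyal_assoc hθ (conjAlg b), ← moyal_assoc hθ _ _ b,
      ← translate_coherent] at this
    exact this
  have hn (n : ℕ) : 2 * (φ (moyal θ (quant θ g (cutoff n)) b)).re ≤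
      (∫ κ, husimi θ g φ κ) + 1 := by
    have hR := apply_quant (g := g) hθ zero_le_one hright (cutoff n)
    have hB := apply_quant (g := g) hθ zero_le_one hboth (cutoff n)
    have hH := integrable_husimi hθ hg hφ
    have eR : (φ (moyal θ (quant θ g (cutoff n)) b)).re = ∫ κ, cutoffFun n κ *
        (φ (right (translate (-κ) (moyal θ (conjAlg g) g)))).re := by
      change ((φ ∘ₗ right) (quant θ g (cutoff n))).re = _
      rw [hR.2, ← RCLike.re_to_complex, ← integral_re hR.1]
      simp [cutoff_apply]
    have eB : ((φ ∘ₗ both) (quant θ g (cutoff n))).re = ∫ κ, cutoffFun n κ *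
        (φ (both (translate (-κ) (moyal θ (conjAlg g) g)))).re := by
      rw [hB.2, ← RCLike.re_to_complex, ← integral_re hB.1]
      simp [cutoff_apply]
    have iR : Integrable fun κ => cutoffFun n κ *
        (φ (right (translate (-κ) (moyal θ (conjAlg g) g)))).re := by
      simpa [cutoff_apply] using hR.1.re
    have iB : Integrable fun κ => cutoffFun n κ *
        (φ (both (translate (-κ) (moyal θ (conjAlg g) g)))).re := by
      simpa [cutoff_apply] using hB.1.re
    have hB1 : ((φ ∘ₗ both) (quant θ g (cutoff n))).re ≤ 1 := by
      have := hboth _ 1 zero_le_one (opBound_quant hθ hg zero_le_one (norm_cutoff_le n))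
      rw [one_mul] at this
      exact (Complex.re_le_norm _).trans this
    rw [eR, ← integral_const_mul]
    calc ∫ κ, 2 * (cutoffFun n κ * (φ (right (translate (-κ) (moyal θ (conjAlg g) g)))).re)
        ≤ ∫ κ, (husimi θ g φ κ + cutoffFun n κ *
            (φ (both (translate (-κ) (moyal θ (conjAlg g) g)))).re) := by
          refine integral_mono (iR.const_mul 2) (hH.add iB) fun κ => ?_
          have h1 := mul_le_mul_of_nonneg_left (hpt κ) (cutoffFun_nonneg n κ)
          have h2 := mul_le_of_le_one_left (husimi_nonneg (g := g) hφ κ) (cutoffFun_le_one n κ)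
          simp only
          linarith
      _ = (∫ κ, husimi θ g φ κ) + ((φ ∘ₗ both) (quant θ g (cutoff n))).re := by
          rw [integral_add hH iB, eB]
      _ ≤ _ := by linarith
  have hlim := tendsto_apply_quant_cutoff hθ hg zero_le_one hφ.opDominated b
  exact le_of_tendsto (((Complex.continuous_re.tendsto _).comp hlim).const_mul 2)
    (.of_forall hn)

/-- The density of a state is a probability density. It has mass at least one because a state
takes values of modulus close to one on contractions. -/
theorem integral_husimi (hθ : 0 < θ) (hg : ‖l2 g‖ = 1) (hφ : IsState θ φ) :
    ∫ κ, husimi θ g φ κ = 1 := by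
  refine le_antisymm ?_ ?_
  · rw [integral_eq_lintegral_of_nonneg_ae (.of_forall fun κ => husimi_nonneg hφ κ)
      (continuous_husimi hθ hφ).aestronglyMeasurable]
    exact ENNReal.toReal_le_of_le_ofReal zero_le_one
      (by simpa using lintegral_husimi_le hθ hg hφ)
  · have h : (1 : ℝ) ≤ ((∫ κ, husimi θ g φ κ) + 1) / 2 := by
      refine hφ.norm_eq_one.2 ?_
      rintro _ ⟨b, hb, rfl⟩
      rw [contractive_rep_iff] at hb
      rcases eq_or_ne (φ b) 0 with h0 | h0
      · rw [h0, norm_zero]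
        have : 0 ≤ ∫ κ, husimi θ g φ κ := integral_nonneg fun κ => husimi_nonneg hφ κ
        positivity
      · -- rotate `b` so that the value of the state is its modulus
        have hn : (‖φ b‖ : ℂ) ≠ 0 := by simpa using h0
        set c : ℂ := conj (φ b) / ‖φ b‖ with hc
        have hc1 : ‖c‖ = 1 := by
          rw [hc, norm_div, RCLike.norm_conj, Complex.norm_real, norm_norm,
            div_self (by simpa using h0)]
        have hb' := hb.smul c
        rw [hc1, one_mul] at hb'
        have := two_mul_re_le_integral_husimi hθ hg hφ hb'
        have e : c * φ b = (‖φ b‖ : ℂ) := by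
          rw [hc, div_mul_eq_mul_div, Complex.conj_mul', sq, mul_div_assoc, div_self hn, mul_one]
        rw [map_smul, smul_eq_mul, e, Complex.ofReal_re] at this
        linarith
    linarith

end husimi

/-! ### Spectral distances from bounded commutators -/

namespace SpectralData

variable {A V H : Type} [AddCommGroup A] [Module ℂ A] [AddCommGroup V] [Module ℂ V]
  [NormedAddCommGroup H] [InnerProductSpace ℂ H] (S : SpectralData A V H)

theorem comm_smul (c : ℂ) (a : A) : S.comm (c • a) = c • S.comm a := by
  ext ψ; simp [comm, smul_sub]

/-- Rescaling: an element whose commutator is bounded by `r` gives a lower bound for the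
distance. -/
theorem ofReal_le_spectralDist {φ₁ φ₂ : A →ₗ[ℂ] ℂ} {a : A} {r : ℝ} (hr : 0 < r)
    (h : ∀ ψ, ‖S.core (S.comm a ψ)‖ ≤ r * ‖S.core ψ‖) :
    ENNReal.ofReal (r⁻¹ * ‖φ₁ a - φ₂ a‖) ≤ S.spectralDist φ₁ φ₂ := by
  have hn : ‖((r⁻¹ : ℝ) : ℂ)‖ = r⁻¹ := by
    rw [Complex.norm_real, Real.norm_of_nonneg (by positivity)]
  have hc : S.Contractive (S.comm (((r⁻¹ : ℝ) : ℂ) • a)) := fun ψ => by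
    rw [comm_smul, LinearMap.smul_apply, map_smul, norm_smul, hn, inv_mul_le_iff₀ hr]
    exact h ψ
  have := le_iSup₂_of_le (f := fun (a : A) (_ : S.Contractive (S.comm a)) =>
    ENNReal.ofReal ‖φ₁ a - φ₂ a‖) _ hc le_rfl
  rwa [map_smul, map_smul, ← smul_sub, norm_smul, hn] at this

theorem spectralDist_le {φ₁ φ₂ : A →ₗ[ℂ] ℂ} {d : ℝ}
    (h : ∀ a, S.Contractive (S.comm a) → ‖φ₁ a - φ₂ a‖ ≤ d) :
    S.spectralDist φ₁ φ₂ ≤ ENNReal.ofReal d :=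
  iSup₂_le fun a ha => ENNReal.ofReal_le_ofReal (h a ha)

end SpectralData

/-! ### The two-point space -/

theorem norm_sq_twoPoint_core (Λ : ℂ) (ψ : Fin 2 → ℂ) :
    ‖(twoPoint Λ).core ψ‖ ^ 2 = ‖ψ 0‖ ^ 2 + ‖ψ 1‖ ^ 2 := by
  have := EuclideanSpace.norm_sq_eq ((twoPoint Λ).core ψ)
  rw [Fin.sum_univ_two] at this
  exact this

theorem norm_twoPoint_comm (Λ : ℂ) (a ψ : Fin 2 → ℂ) :
    ‖(twoPoint Λ).core ((twoPoint Λ).comm a ψ)‖ = ‖Λ‖ * ‖a 0 - a 1‖ * ‖(twoPoint Λ).core ψ‖ := by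
  have h0 : (twoPoint Λ).comm a ψ 0 = conj Λ * (a 1 - a 0) * ψ 1 := by
    simp [twoPoint, SpectralData.comm, diracI, diagRep, Matrix.vecHead, Matrix.vecTail]
    ring
  have h1 : (twoPoint Λ).comm a ψ 1 = Λ * (a 0 - a 1) * ψ 0 := by
    simp [twoPoint, SpectralData.comm, diracI, diagRep, Matrix.vecHead, Matrix.vecTail]
    ring
  rw [← sq_eq_sq₀ (norm_nonneg _) (by positivity), mul_pow, norm_sq_twoPoint_core,
    norm_sq_twoPoint_core, h0, h1]
  simp only [norm_mul, RCLike.norm_conj, norm_sub_rev (a 1)]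
  ring

theorem twoPoint_dist {Λ : ℂ} (hΛ : Λ ≠ 0) :
    (twoPoint Λ).spectralDist (delta 0) (delta 1) = ENNReal.ofReal ‖Λ‖⁻¹ := by
  have hΛ' : 0 < ‖Λ‖ := norm_pos_iff.2 hΛ
  have hδ (a : Fin 2 → ℂ) : delta 0 a - delta 1 a = a 0 - a 1 := rfl
  refine le_antisymm ((twoPoint Λ).spectralDist_le fun a ha => ?_) ?_
  · have := ha ![1, 0]
    have h1 : 0 < ‖(twoPoint Λ).core ![1, 0]‖ := by
      have := norm_sq_twoPoint_core Λ ![1, 0]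
      refine (norm_nonneg _).lt_of_ne' fun h => ?_
      simp [h] at this
    rw [norm_twoPoint_comm, mul_le_iff_le_one_left h1] at this
    rwa [hδ, ← one_div, le_div_iff₀ hΛ', mul_comm]
  · have := (twoPoint Λ).ofReal_le_spectralDist (φ₁ := delta 0) (φ₂ := delta 1) (a := ![1, 0]) hΛ'
      (fun ψ => by rw [norm_twoPoint_comm]; simp)
    rw [hδ] at this
    simpa using this

theorem twoPoint_dist_zero : (twoPoint 0).spectralDist (delta 0) (delta 1) = ⊤ := by
  refine ENNReal.eq_top_of_forall_nnreal_le fun r => ?_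
  have := (twoPoint 0).ofReal_le_spectralDist (φ₁ := delta 0) (φ₂ := delta 1)
    (a := ![(r : ℝ), 0]) zero_lt_one (fun ψ => by rw [norm_twoPoint_comm]; simp)
  simpa [delta] using this

/-! ### Commutators with the Dirac operators -/

/-- The operator `∂₁ + i ∂₂`, which appears in the upper right corner of `i D`. -/
def dPlus (a : Alg) : Alg := partialDeriv 0 a + Complex.I • partialDeriv 1 a

/-- The operator `∂₁ - i ∂₂`, which appears in the lower left corner of `i D`. -/
def dMinus (a : Alg) : Alg := partialDeriv 0 a - Complex.I • partialDeriv 1 a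

theorem planeDirac_zero (ψ : Spinor) : planeDirac ψ 0 = (-Complex.I) • dPlus (ψ 1) := by
  simp [planeDirac, gam, dPlus, Fin.sum_univ_two]

theorem planeDirac_one (ψ : Spinor) : planeDirac ψ 1 = (-Complex.I) • dMinus (ψ 0) := by
  simp [planeDirac, gam, dMinus, Fin.sum_univ_two, sub_eq_add_neg]

theorem dPlus_moyal {θ : ℝ} (hθ : 0 < θ) (f g : Alg) :
    dPlus (moyal θ f g) = moyal θ (dPlus f) g + moyal θ f (dPlus g) := by
  simp only [dPlus, partialDeriv_moyal hθ, moyal_add_left, moyal_add_right, moyal_smul_left,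
    moyal_smul_right]
  module

theorem dMinus_moyal {θ : ℝ} (hθ : 0 < θ) (f g : Alg) :
    dMinus (moyal θ f g) = moyal θ (dMinus f) g + moyal θ f (dMinus g) := by
  simp only [dMinus, partialDeriv_moyal hθ, moyal_sub_left, moyal_sub_right, moyal_smul_left,
    moyal_smul_right]
  module

section comm

variable {θ : ℝ}

theorem moyal_comm_zero (hθ : 0 < θ) (a : Alg) (ψ : Spinor) :
    (moyalTriple θ).comm a ψ 0 = (-Complex.I) • moyal θ (dPlus a) (ψ 1) := by
  change planeDirac (fun i => moyal θ a (ψ i)) 0 - moyal θ a (planeDirac ψ 0) = _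
  rw [planeDirac_zero, planeDirac_zero, dPlus_moyal hθ, moyal_smul_right]
  module

theorem moyal_comm_one (hθ : 0 < θ) (a : Alg) (ψ : Spinor) :
    (moyalTriple θ).comm a ψ 1 = (-Complex.I) • moyal θ (dMinus a) (ψ 0) := by
  change planeDirac (fun i => moyal θ a (ψ i)) 1 - moyal θ a (planeDirac ψ 1) = _
  rw [planeDirac_one, planeDirac_one, dMinus_moyal hθ, moyal_smul_right]
  module

theorem double_comm_apply (Λ : ℂ) (a : Fin 2 → Alg) (Ψ : Fin 2 → Spinor) (i s : Fin 2) :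
    ((moyalTriple θ).double grading Λ).comm a Ψ i s = (moyalTriple θ).comm (a i) (Ψ i) s +
      (![1, -1] s : ℂ) • ∑ j, diracI Λ i j • moyal θ (a j - a i) (Ψ j s) := by
  have hd (Ψ : Fin 2 → Spinor) : ((moyalTriple θ).double grading Λ).dirac Ψ i s =
      planeDirac (Ψ i) s + ∑ j, diracI Λ i j • ((![1, -1] s : ℂ) • Ψ j s) := by
    simp [SpectralData.double, grading, moyalTriple]
  have h1 : ((moyalTriple θ).double grading Λ).comm a Ψ i s =
      ((moyalTriple θ).double grading Λ).dirac (fun j t => moyal θ (a j) (Ψ j t)) i s -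
      moyal θ (a i) (((moyalTriple θ).double grading Λ).dirac Ψ i s) := rfl
  have h2 : (moyalTriple θ).comm (a i) (Ψ i) s =
    planeDirac (fun t => moyal θ (a i) (Ψ i t)) s - moyal θ (a i) (planeDirac (Ψ i) s) := rfl
  rw [h1, h2, hd, hd]
  simp only [Fin.sum_univ_two, moyal_add_right, moyal_smul_right, moyal_sub_left]
  module

theorem norm_sq_double_core (Λ : ℂ) (Ψ : Fin 2 → Spinor) :
    ‖((moyalTriple θ).double grading Λ).core Ψ‖ ^ 2 =
      ∑ p : Fin 2 × Fin 2, ‖l2 (Ψ p.1 p.2)‖ ^ 2 := by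
  rw [Fintype.sum_prod_type]
  refine (PiLp.norm_sq_eq_of_L2 _ _).trans (Finset.sum_congr rfl fun i _ => norm_sq_core θ (Ψ i))

end comm

/-! ### Upper bounds for the distances -/

theorem lineDeriv_eq (d : Plane) (a : Alg) :
    (∂_{d} a : Alg) = (d 0 : ℂ) • partialDeriv 0 a + (d 1 : ℂ) • partialDeriv 1 a := by
  refine fourier_injective fun k => ?_
  rw [FourierTransform.fourier_add, FourierTransform.fourier_smul, FourierTransform.fourier_smul,
    add_apply, smul_apply, smul_apply, fourier_lineDeriv, fourier_partialDeriv,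
    fourier_partialDeriv]
  simp [PiLp.inner_apply, Fin.sum_univ_two]
  ring

/-- The complex number `d₁ + i d₂`. -/
def toComplex (d : Plane) : ℂ := d 0 + Complex.I * d 1

theorem norm_toComplex (d : Plane) : ‖toComplex d‖ = ‖d‖ := by
  rw [← sq_eq_sq₀ (norm_nonneg _) (norm_nonneg _), EuclideanSpace.norm_sq_eq, Fin.sum_univ_two,
    ← Complex.normSq_eq_norm_sq, Complex.normSq_apply]
  simp [toComplex]
  ring

theorem lineDeriv_eq_dPlus_dMinus (d : Plane) (a : Alg) :
    (∂_{d} a : Alg) = (1 / 2 : ℂ) • (conj (toComplex d) • dPlus a + toComplex d • dMinus a) := by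
  have h : conj (toComplex d) = d 0 - Complex.I * d 1 := by
    simp [toComplex, Complex.conj_ofReal, sub_eq_add_neg]
  rw [lineDeriv_eq, h, toComplex, dPlus, dMinus]
  have hI : Complex.I * Complex.I = -1 := Complex.I_mul_I
  ext x
  simp only [add_apply, sub_apply, smul_apply, smul_eq_mul]
  linear_combination ((d 1 : ℂ) * partialDeriv 1 a x) * hI

/-- If the components of the commutator satisfy a joint quadratic bound, then the derivative of `a`
in a direction `d`, shifted by `δ`, is bounded by the Cauchy-Schwarz inequality. -/
theorem opBound_lineDeriv_sub {θ : ℝ} {a δ : Alg} {l : ℝ} (hl : 0 < l) (d : Plane)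
    (hp : ∀ χ, ‖l2 (moyal θ (dPlus a) χ)‖ ^ 2 + l ^ 2 * ‖l2 (moyal θ δ χ)‖ ^ 2 ≤ ‖l2 χ‖ ^ 2)
    (hm : ∀ χ, ‖l2 (moyal θ (dMinus a) χ)‖ ^ 2 + l ^ 2 * ‖l2 (moyal θ δ χ)‖ ^ 2 ≤ ‖l2 χ‖ ^ 2) :
    OpBound θ ((∂_{d} a : Alg) - δ) (√(‖d‖ ^ 2 + l⁻¹ ^ 2)) := by
  intro χ
  have key (c : ℂ) (hc : ‖c‖ = ‖d‖) (p : Alg)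
      (h : ‖l2 (moyal θ p χ)‖ ^ 2 + l ^ 2 * ‖l2 (moyal θ δ χ)‖ ^ 2 ≤ ‖l2 χ‖ ^ 2) :
      ‖c • l2 (moyal θ p χ) - l2 (moyal θ δ χ)‖ ≤ √(‖d‖ ^ 2 + l⁻¹ ^ 2) * ‖l2 χ‖ := by
    set A := ‖l2 (moyal θ p χ)‖
    set B := ‖l2 (moyal θ δ χ)‖
    refine (norm_sub_le _ _).trans ?_
    rw [norm_smul, hc]
    refine le_of_sq_le_sq ?_ (by positivity)
    rw [mul_pow, Real.sq_sqrt (by positivity)]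
    calc (‖d‖ * A + B) ^ 2 = (‖d‖ * A + l⁻¹ * (l * B)) ^ 2 := by
          rw [← mul_assoc, inv_mul_cancel₀ hl.ne', one_mul]
      _ ≤ (‖d‖ ^ 2 + l⁻¹ ^ 2) * (A ^ 2 + (l * B) ^ 2) := by
          nlinarith [sq_nonneg (‖d‖ * (l * B) - l⁻¹ * A)]
      _ ≤ _ := by rw [mul_pow l]; gcongr
  have h1 := key (conj (toComplex d)) (by rw [RCLike.norm_conj, norm_toComplex]) _ (hp χ)
  have h2 := key (toComplex d) (norm_toComplex d) _ (hm χ)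
  have e : l2 (moyal θ ((∂_{d} a : Alg) - δ) χ) =
      (1 / 2 : ℂ) • ((conj (toComplex d) • l2 (moyal θ (dPlus a) χ) - l2 (moyal θ δ χ)) +
        (toComplex d • l2 (moyal θ (dMinus a) χ) - l2 (moyal θ δ χ))) := by
    rw [lineDeriv_eq_dPlus_dMinus]
    simp only [moyal_sub_left, moyal_smul_left, moyal_add_left, map_sub, map_smul, map_add]
    module
  rw [e, norm_smul]
  have h3 := norm_add_le (conj (toComplex d) • l2 (moyal θ (dPlus a) χ) - l2 (moyal θ δ χ))
    (toComplex d • l2 (moyal θ (dMinus a) χ) - l2 (moyal θ δ χ))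
  rw [show ‖(1 / 2 : ℂ)‖ = 1 / 2 by norm_num]
  linarith

/-- The derivative of `a` in the direction `d` is half the sum of `∂₁ a ± i ∂₂ a` with coefficients
of modulus `‖d‖`. -/
theorem opBound_lineDeriv {θ : ℝ} {a : Alg} (d : Plane)
    (hp : OpBound θ (dPlus a) 1) (hm : OpBound θ (dMinus a) 1) :
    OpBound θ (∂_{d} a : Alg) ‖d‖ := by
  intro χ
  rw [lineDeriv_eq_dPlus_dMinus, moyal_smul_left, moyal_add_left, moyal_smul_left,
    moyal_smul_left, map_smul, map_add, map_smul, map_smul, norm_smul]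
  have h1 := norm_add_le (conj (toComplex d) • l2 (moyal θ (dPlus a) χ))
    (toComplex d • l2 (moyal θ (dMinus a) χ))
  rw [norm_smul, norm_smul, RCLike.norm_conj, norm_toComplex] at h1
  have h2 := mul_le_mul_of_nonneg_left (hp χ) (norm_nonneg d)
  have h3 := mul_le_mul_of_nonneg_left (hm χ) (norm_nonneg d)
  norm_num at *
  linarith

section upper

variable {θ : ℝ} {φ : Alg →ₗ[ℂ] ℂ}

theorem hasDerivAt_translate (hθ : 0 < θ) (hφ : IsState θ φ) (f : Alg) (κ d : Plane) (t : ℝ) :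
    HasDerivAt (fun t : ℝ => φ (translate (κ + t • d) f))
      (φ (translate (κ + t • d) (∂_{d} f))) t := by
  obtain ⟨m, hm⟩ := exists_density φ zero_le_one (hφ.opDominated.norm_le hθ)
  exact hasDerivAt_translate_of_density hm f κ d t

theorem norm_apply_translate_le (hφ : IsState θ φ) {f : Alg} {r : ℝ} (hr : 0 ≤ r)
    (hf : OpBound θ f r) (κ : Plane) : ‖φ (translate κ f)‖ ≤ r := by
  simpa using hφ.opDominated _ r hr (hf.translate κ)

/-- The components of a contractive commutator with the Dirac operator of the plane. -/
theorem opBound_of_contractive (hθ : 0 < θ) {a : Alg}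
    (ha : (moyalTriple θ).Contractive ((moyalTriple θ).comm a)) :
    OpBound θ (dPlus a) 1 ∧ OpBound θ (dMinus a) 1 := by
  have h (ψ : Spinor) := pow_le_pow_left₀ (norm_nonneg _) (ha ψ) 2
  simp only [norm_sq_core, Fin.sum_univ_two, moyal_comm_zero hθ, moyal_comm_one hθ, map_smul,
    norm_smul, norm_neg, Complex.norm_I, one_mul] at h
  have z (f : Alg) : l2 (moyal θ f 0) = 0 := by
    rw [show moyal θ f 0 = 0 from (leftMul θ f).map_zero, map_zero]
  constructor <;> intro χ <;> rw [one_mul] <;> refine le_of_sq_le_sq ?_ (norm_nonneg _)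
  · simpa [z] using h ![0, χ]
  · simpa [z] using h ![χ, 0]

theorem moyal_dist_le (hθ : 0 < θ) (hφ : IsState θ φ) (κ κ' : Plane) :
    (moyalTriple θ).spectralDist (φ ∘ₗ translate κ) (φ ∘ₗ translate κ') ≤
      ENNReal.ofReal ‖κ - κ'‖ := by
  refine (moyalTriple θ).spectralDist_le fun a ha => ?_
  obtain ⟨hp, hm⟩ := opBound_of_contractive hθ ha
  have := norm_image_sub_le_of_norm_deriv_le_segment_01' (C := ‖κ - κ'‖)
    (fun t _ => (hasDerivAt_translate hθ hφ a κ' (κ - κ') t).hasDerivWithinAt)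
    (fun t _ => norm_apply_translate_le hφ (norm_nonneg _) (opBound_lineDeriv _ hp hm) _)
  simpa using this

/-- The columns of a contractive commutator with the Dirac operator of the product. -/
theorem quadratic_bound_of_contractive (hθ : 0 < θ) {Λ : ℂ} {a : Fin 2 → Alg}
    (ha : ((moyalTriple θ).double grading Λ).Contractive
      (((moyalTriple θ).double grading Λ).comm a)) (i : Fin 2) (χ : Alg) :
    ‖l2 (moyal θ (dPlus (a i)) χ)‖ ^ 2 + ‖Λ‖ ^ 2 * ‖l2 (moyal θ (a 0 - a 1) χ)‖ ^ 2 ≤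
        ‖l2 χ‖ ^ 2 ∧
      ‖l2 (moyal θ (dMinus (a i)) χ)‖ ^ 2 + ‖Λ‖ ^ 2 * ‖l2 (moyal θ (a 0 - a 1) χ)‖ ^ 2 ≤
        ‖l2 χ‖ ^ 2 := by
  have h (Ψ : Fin 2 → Spinor) := pow_le_pow_left₀ (norm_nonneg _) (ha Ψ) 2
  have z (f : Alg) : moyal θ f 0 = 0 := (leftMul θ f).map_zero
  have hsw : ‖l2 (moyal θ (a 1 - a 0) χ)‖ = ‖l2 (moyal θ (a 0 - a 1) χ)‖ := by
    rw [moyal_sub_left, moyal_sub_left, map_sub, map_sub, norm_sub_rev]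
  simp only [norm_sq_double_core, Fintype.sum_prod_type, Fin.sum_univ_two, double_comm_apply,
    moyal_comm_zero hθ, moyal_comm_one hθ] at h
  have h00 := h ![![0, χ], 0]
  have h01 := h ![![χ, 0], 0]
  have h10 := h ![0, ![0, χ]]
  have h11 := h ![0, ![χ, 0]]
  simp [z, diracI, norm_smul, mul_pow] at h00 h01 h10 h11
  rw [hsw] at h10 h11
  match i with
  | 0 => exact ⟨by linarith, by linarith⟩
  | 1 => exact ⟨by linarith, by linarith⟩

/-- Both sheets are interpolated along the segment of translations: for `d = κ' - κ` and `φ_t` the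
translate of `φ` by `κ + t d`, the derivative of `(1 - t) φ_t(a₁) + t φ_t(a₂)` is a convex combination
of the values of `φ_t` at `∂_d a_i - (a₁ - a₂)`. -/
theorem double_dist_le (hθ : 0 < θ) (hφ : IsState θ φ) {Λ : ℂ} (hΛ : Λ ≠ 0) (κ κ' : Plane) :
    ((moyalTriple θ).double grading Λ).spectralDist (sheet (φ ∘ₗ translate κ) 0)
        (sheet (φ ∘ₗ translate κ') 1) ≤
      ENNReal.ofReal (√(‖κ - κ'‖ ^ 2 + ‖Λ‖⁻¹ ^ 2)) := by
  refine SpectralData.spectralDist_le _ fun a ha => ?_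
  have hΛ' : 0 < ‖Λ‖ := norm_pos_iff.2 hΛ
  set d := κ' - κ with hd
  have hR (i : Fin 2) := opBound_lineDeriv_sub hΛ' d
    (fun χ => (quadratic_bound_of_contractive hθ ha i χ).1)
    (fun χ => (quadratic_bound_of_contractive hθ ha i χ).2)
  set R := √(‖d‖ ^ 2 + ‖Λ‖⁻¹ ^ 2) with hRdef
  have hR0 : 0 ≤ R := Real.sqrt_nonneg _
  let u : ℝ → ℂ := fun t => (1 - t : ℝ) * φ (translate (κ + t • d) (a 0)) +
    (t : ℝ) * φ (translate (κ + t • d) (a 1))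
  have hu (t : ℝ) : HasDerivAt u
      ((1 - t : ℝ) * φ (translate (κ + t • d) ((∂_{d} (a 0) : Alg) - (a 0 - a 1))) +
        (t : ℝ) * φ (translate (κ + t • d) ((∂_{d} (a 1) : Alg) - (a 0 - a 1)))) t := by
    have h0 := ((hasDerivAt_id t).const_sub 1).ofReal_comp.mul
      (hasDerivAt_translate hθ hφ (a 0) κ d t)
    have h1 := (hasDerivAt_id t).ofReal_comp.mul (hasDerivAt_translate hθ hφ (a 1) κ d t)
    refine (h0.add h1).congr_deriv ?_
    simp only [map_sub, id]
    push_cast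
    ring
  have := norm_image_sub_le_of_norm_deriv_le_segment_01' (C := R)
    (fun t _ => (hu t).hasDerivWithinAt) (fun t ht => ?_)
  · have e1 : u 1 = φ (translate κ' (a 1)) := by simp [u, hd]
    have e0 : u 0 = φ (translate κ (a 0)) := by simp [u]
    rw [e1, e0, norm_sub_rev (φ _), hRdef, hd, norm_sub_rev κ' κ] at this
    exact this
  · have ht1 : 0 ≤ 1 - t := by linarith [ht.2]
    refine (norm_add_le _ _).trans ?_
    rw [norm_mul, norm_mul, Complex.norm_real, Complex.norm_real, Real.norm_of_nonneg ht1,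
      Real.norm_of_nonneg ht.1]
    have b0 := mul_le_mul_of_nonneg_left (norm_apply_translate_le hφ hR0 (hR 0) (κ + t • d)) ht1
    have b1 := mul_le_mul_of_nonneg_left (norm_apply_translate_le hφ hR0 (hR 1) (κ + t • d)) ht.1
    linarith

end upper

/-! ### Quantized ramps and lower bounds for the distances -/

theorem dPlus_quant (θ : ℝ) (g h : Alg) : dPlus (quant θ g h) = quant θ g (dPlus h) := by
  simp only [dPlus, partialDeriv_quant, map_add, map_smul]

theorem dMinus_quant (θ : ℝ) (g h : Alg) : dMinus (quant θ g h) = quant θ g (dMinus h) := by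
  simp only [dMinus, partialDeriv_quant, map_sub, map_smul]

/-- The matrix of functions whose quantization is the commutator of `D'` with the quantization of
`b`: the classical commutator of the Dirac operator of the product with the pair `b`. Rows and columns are indexed by a
sheet and a spinor component. -/
def commSymbol (Λ : ℂ) (b : Fin 2 → Alg) (p q : Fin 2 × Fin 2) : Alg :=
  if p.1 = q.1 then
    if p.2 = q.2 then 0 else (-Complex.I) • (![dPlus (b p.1), dMinus (b p.1)] p.2)
  else if p.2 = q.2 then (![1, -1] p.2 * diracI Λ p.1 q.1 : ℂ) • (b q.1 - b p.1) else 0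

/-- The four rows of `commSymbol`, in a form that applies both to its values and to its
quantization. -/
theorem sum_commSymbol {M : Type*} [AddCommMonoid M] (F : Alg → Fin 2 → Fin 2 → M)
    (hF : ∀ i s, F 0 i s = 0) (Λ : ℂ) (b : Fin 2 → Alg) :
    (∑ q : Fin 2 × Fin 2, F (commSymbol Λ b (0, 0) q) q.1 q.2 =
      F ((-Complex.I) • dPlus (b 0)) 0 1 + F (conj Λ • (b 1 - b 0)) 1 0) ∧
    (∑ q : Fin 2 × Fin 2, F (commSymbol Λ b (0, 1) q) q.1 q.2 =
      F ((-Complex.I) • dMinus (b 0)) 0 0 + F (-conj Λ • (b 1 - b 0)) 1 1) ∧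
    (∑ q : Fin 2 × Fin 2, F (commSymbol Λ b (1, 0) q) q.1 q.2 =
      F (Λ • (b 0 - b 1)) 0 0 + F ((-Complex.I) • dPlus (b 1)) 1 1) ∧
    (∑ q : Fin 2 × Fin 2, F (commSymbol Λ b (1, 1) q) q.1 q.2 =
      F (-Λ • (b 0 - b 1)) 0 1 + F ((-Complex.I) • dMinus (b 1)) 1 0) := by
  simp only [Fintype.sum_prod_type, Fin.sum_univ_two, commSymbol]
  refine ⟨?_, ?_, ?_, ?_⟩ <;> simp [hF, diracI]

theorem double_comm_quant {θ : ℝ} (hθ : 0 < θ) (g : Alg) (Λ : ℂ) (b : Fin 2 → Alg)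
    (Ψ : Fin 2 → Spinor) (i s : Fin 2) :
    ((moyalTriple θ).double grading Λ).comm (fun i => quant θ g (b i)) Ψ i s =
      ∑ q : Fin 2 × Fin 2, moyal θ (quant θ g (commSymbol Λ b (i, s) q)) (Ψ q.1 q.2) := by
  have z (f : Alg) : moyal θ 0 f = 0 := by
    exact congrArg (fun L : Alg →ₗ[ℂ] Alg => L f) (map_zero (leftMul θ))
  obtain ⟨h00, h01, h10, h11⟩ := sum_commSymbol
    (fun f j t => moyal θ (quant θ g f) (Ψ j t)) (fun j t => by simp only [map_zero, z]) Λ b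
  rw [double_comm_apply, Fin.sum_univ_two]
  match i, s with
  | 0, 0 =>
    rw [h00, moyal_comm_zero hθ, dPlus_quant, sub_self, z, map_smul, map_smul, map_sub,
      moyal_smul_left, moyal_smul_left]
    simp [diracI]
  | 0, 1 =>
    rw [h01, moyal_comm_one hθ, dMinus_quant, sub_self, z, map_smul, map_smul, map_sub,
      moyal_smul_left, moyal_smul_left]
    simp [diracI]
  | 1, 0 =>
    rw [h10, moyal_comm_zero hθ, dPlus_quant, sub_self, z, map_smul, map_smul, map_sub,
      moyal_smul_left, moyal_smul_left, add_comm]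
    simp [diracI]
  | 1, 1 =>
    rw [h11, moyal_comm_one hθ, dMinus_quant, sub_self, z, map_smul, map_smul, map_sub,
      moyal_smul_left, moyal_smul_left, add_comm]
    simp [diracI]

/-- The commutator of the Dirac operator of the product with a quantized pair is bounded by the
pointwise norm of the classical commutator. -/
theorem norm_double_comm_quant_le {θ : ℝ} (hθ : 0 < θ) {g : Alg} (hg : ‖l2 g‖ = 1) (Λ : ℂ)
    (b : Fin 2 → Alg) {r : ℝ} (hr : 0 ≤ r)
    (h : ∀ (x : Plane) (Y : Fin 2 × Fin 2 → ℂ),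
      ∑ p, ‖∑ q, commSymbol Λ b p q x * Y q‖ ^ 2 ≤ r ^ 2 * ∑ q, ‖Y q‖ ^ 2)
    (Ψ : Fin 2 → Spinor) :
    ‖((moyalTriple θ).double grading Λ).core
        (((moyalTriple θ).double grading Λ).comm (fun i => quant θ g (b i)) Ψ)‖ ≤
      r * ‖((moyalTriple θ).double grading Λ).core Ψ‖ := by
  refine le_of_sq_le_sq ?_ (by positivity)
  rw [mul_pow, norm_sq_double_core, norm_sq_double_core]
  simp only [double_comm_quant hθ]
  exact quant_matrix_bound hθ hg _ r h fun q => Ψ q.1 q.2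

/-- The pair of symbols `(v · x + s, v · x)`, cut off by a Gaussian of width `n + 1`. -/
def testPair (v : Plane) (s : ℝ) (n : ℕ) : Fin 2 → Alg :=
  ![ramp v n + (s : ℂ) • cutoff n, ramp v n]

/-- The matrix with rows `(A, -c̄)` and `(-c, -Ā)` is a multiple of a unitary. -/
theorem norm_sq_quaternion (A c y z : ℂ) :
    ‖A * y - conj c * z‖ ^ 2 + ‖-(conj A * z) - c * y‖ ^ 2 =
      (‖A‖ ^ 2 + ‖c‖ ^ 2) * (‖y‖ ^ 2 + ‖z‖ ^ 2) := by
  simp only [← Complex.normSq_eq_norm_sq, Complex.normSq_apply, Complex.sub_re, Complex.sub_im,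
    Complex.mul_re, Complex.mul_im, Complex.neg_re, Complex.neg_im, Complex.conj_re,
    Complex.conj_im]
  ring

theorem norm_add_sq_le {ε : ℝ} (hε : 0 < ε) (p q : ℂ) :
    ‖p + q‖ ^ 2 ≤ (1 + ε) * ‖p‖ ^ 2 + (1 + ε⁻¹) * ‖q‖ ^ 2 := by
  have h1 := pow_le_pow_left₀ (norm_nonneg _) (norm_add_le p q) 2
  have h2 : 2 * ‖p‖ * ‖q‖ ≤ ε * ‖p‖ ^ 2 + ε⁻¹ * ‖q‖ ^ 2 := by
    have : 0 ≤ ε⁻¹ * (ε * ‖p‖ - ‖q‖) ^ 2 := by positivity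
    have e : ε⁻¹ * (ε * ‖p‖ - ‖q‖) ^ 2 =
        ε * ‖p‖ ^ 2 + ε⁻¹ * ‖q‖ ^ 2 - 2 * ‖p‖ * ‖q‖ := by
      field_simp
      ring
    linarith
  linarith

/-- The commutator with the uncut pair has norm `√(‖v‖² + |Λ|² s²)`; the derivatives of the cutoff
only contribute an error which vanishes as the cutoff is removed. -/
theorem sum_commSymbol_le {Λ : ℂ} {v : Plane} {s ε : ℝ} (hε : 0 < ε)
    (hv : ‖v‖ ^ 2 + ‖Λ‖ ^ 2 * s ^ 2 ≤ 1) {n : ℕ} {x : Plane}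
    (he : |s| * (‖partialDeriv 0 (cutoff n) x‖ + ‖partialDeriv 1 (cutoff n) x‖) ≤ ε)
    (Y : Fin 2 × Fin 2 → ℂ) :
    ∑ p, ‖∑ q, commSymbol Λ (testPair v s n) p q x * Y q‖ ^ 2 ≤ (1 + ε) ^ 2 * ∑ q, ‖Y q‖ ^ 2 := by
  set w : ℝ := s * cutoffFun n x with hw
  set A : ℂ := -Complex.I * (rampGrad v n 0 x + Complex.I * rampGrad v n 1 x) with hA
  set c : ℂ := Λ * w with hc
  set E : ℂ := -Complex.I * (s * (partialDeriv 0 (cutoff n) x +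
    Complex.I * partialDeriv 1 (cutoff n) x)) with hE
  set F : ℂ := -Complex.I * (s * (partialDeriv 0 (cutoff n) x -
    Complex.I * partialDeriv 1 (cutoff n) x)) with hF
  have hcA : conj A = Complex.I * (rampGrad v n 0 x - Complex.I * rampGrad v n 1 x) := by
    simp [hA, sub_eq_add_neg]
  have hcc : conj c = conj Λ * w := by simp [hc]
  have hEn : ‖E‖ ^ 2 ≤ ε ^ 2 := by
    refine pow_le_pow_left₀ (norm_nonneg _) (le_trans ?_ he) 2
    rw [hE, norm_mul, norm_neg, Complex.norm_I, one_mul, norm_mul, Complex.norm_real,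
      Real.norm_eq_abs]
    gcongr
    exact (norm_add_le _ _).trans (by simp)
  have hFn : ‖F‖ ^ 2 ≤ ε ^ 2 := by
    refine pow_le_pow_left₀ (norm_nonneg _) (le_trans ?_ he) 2
    rw [hF, norm_mul, norm_neg, Complex.norm_I, one_mul, norm_mul, Complex.norm_real,
      Real.norm_eq_abs]
    gcongr
    exact (norm_sub_le _ _).trans (by simp)
  have hAc : ‖A‖ ^ 2 + ‖c‖ ^ 2 ≤ 1 := by
    have h1 : ‖A‖ ^ 2 = rampGrad v n 0 x ^ 2 + rampGrad v n 1 x ^ 2 := by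
      rw [hA, norm_mul, norm_neg, Complex.norm_I, one_mul, ← Complex.normSq_eq_norm_sq,
        Complex.normSq_apply]
      simp; ring
    have h2 : ‖c‖ ^ 2 ≤ ‖Λ‖ ^ 2 * s ^ 2 := by
      rw [hc, norm_mul, Complex.norm_real, mul_pow, Real.norm_eq_abs, sq_abs, hw, mul_pow]
      have := pow_le_one₀ (n := 2) (cutoffFun_nonneg n x) (cutoffFun_le_one n x)
      gcongr
      exact mul_le_of_le_one_right (sq_nonneg _) this
    have := sum_rampGrad_sq_le v n x
    linarith
  obtain ⟨r00, r01, r10, r11⟩ := sum_commSymbol (fun f i t => f x * Y (i, t))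
    (fun i t => by rw [zero_apply, zero_mul]) Λ (testPair v s n)
  have b0 (μ : Fin 2) : partialDeriv μ (testPair v s n 0) x =
      rampGrad v n μ x + s * partialDeriv μ (cutoff n) x := by
    change partialDeriv μ (ramp v n + (s : ℂ) • cutoff n) x = _
    rw [map_add, map_smul, add_apply, smul_apply, partialDeriv_ramp, smul_eq_mul]
  have b1 (μ : Fin 2) : partialDeriv μ (testPair v s n 1) x = rampGrad v n μ x :=
    partialDeriv_ramp v n μ x
  have d10 : testPair v s n 0 x - testPair v s n 1 x = w := by
    change (ramp v n + (s : ℂ) • cutoff n) x - ramp v n x = _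
    rw [add_apply, smul_apply, cutoff_apply, hw, smul_eq_mul]
    push_cast; ring
  have d01 : testPair v s n 1 x - testPair v s n 0 x = -w := by rw [← d10]; ring
  simp only [dPlus, dMinus, smul_apply, add_apply, sub_apply, smul_eq_mul, b0, b1, d10, d01]
    at r00 r01 r10 r11
  replace r00 := r00.trans (show _ = (A * Y (0, 1) - conj c * Y (1, 0)) + E * Y (0, 1) by
    rw [hcc]; ring)
  replace r01 := r01.trans (show _ = (-(conj A * Y (0, 0)) + conj c * Y (1, 1)) + F * Y (0, 0) by
    rw [hcc, hcA]; ring)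
  replace r10 := r10.trans (show _ = A * Y (1, 1) + c * Y (0, 0) by rw [hA, hc]; ring)
  replace r11 := r11.trans (show _ = -(conj A * Y (1, 0)) - c * Y (0, 1) by rw [hcA, hc]; ring)
  clear_value A c E F w
  -- the rows pair up into two quaternionic matrices, plus errors in the rows of the first sheet
  have q1 := norm_sq_quaternion A c (Y (0, 1)) (Y (1, 0))
  have q2 := norm_sq_quaternion (-conj A) (-c) (Y (0, 0)) (Y (1, 1))
  have q2' : ‖-(conj A * Y (0, 0)) + conj c * Y (1, 1)‖ ^ 2 +
      ‖A * Y (1, 1) + c * Y (0, 0)‖ ^ 2 =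
      (‖A‖ ^ 2 + ‖c‖ ^ 2) * (‖Y (0, 0)‖ ^ 2 + ‖Y (1, 1)‖ ^ 2) := by
    simpa using q2
  have e1 := norm_add_sq_le hε (A * Y (0, 1) - conj c * Y (1, 0)) (E * Y (0, 1))
  have e2 := norm_add_sq_le hε (-(conj A * Y (0, 0)) + conj c * Y (1, 1)) (F * Y (0, 0))
  rw [norm_mul E, mul_pow] at e1
  rw [norm_mul F, mul_pow] at e2
  simp only [Fintype.sum_prod_type, Fin.sum_univ_two]
  simp only [Fintype.sum_prod_type, Fin.sum_univ_two, Prod.mk.eta] at r00 r01 r10 r11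
  rw [r00, r01, r10, r11]
  have t1 : (1 + ε⁻¹) * (‖E‖ ^ 2 * ‖Y (0, 1)‖ ^ 2) ≤ (ε + ε ^ 2) * ‖Y (0, 1)‖ ^ 2 := by
    calc _ ≤ (1 + ε⁻¹) * (ε ^ 2 * ‖Y (0, 1)‖ ^ 2) := by gcongr
      _ = _ := by field_simp; ring
  have t2 : (1 + ε⁻¹) * (‖F‖ ^ 2 * ‖Y (0, 0)‖ ^ 2) ≤ (ε + ε ^ 2) * ‖Y (0, 0)‖ ^ 2 := by
    calc _ ≤ (1 + ε⁻¹) * (ε ^ 2 * ‖Y (0, 0)‖ ^ 2) := by gcongr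
      _ = _ := by field_simp; ring
  have m1 : (1 + ε) * ((‖A‖ ^ 2 + ‖c‖ ^ 2) * (‖Y (0, 1)‖ ^ 2 + ‖Y (1, 0)‖ ^ 2)) ≤
      (1 + ε) * (‖Y (0, 1)‖ ^ 2 + ‖Y (1, 0)‖ ^ 2) := by
    gcongr; exact mul_le_of_le_one_left (by positivity) hAc
  have m2 : (1 + ε) * ((‖A‖ ^ 2 + ‖c‖ ^ 2) * (‖Y (0, 0)‖ ^ 2 + ‖Y (1, 1)‖ ^ 2)) ≤
      (1 + ε) * (‖Y (0, 0)‖ ^ 2 + ‖Y (1, 1)‖ ^ 2) := by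
    gcongr; exact mul_le_of_le_one_left (by positivity) hAc
  rw [← q1] at m1
  rw [← q2'] at m2
  have p1 : 0 ≤ ε * ‖A * Y (1, 1) + c * Y (0, 0)‖ ^ 2 := by positivity
  have p2 : 0 ≤ ε * ‖-(conj A * Y (1, 0)) - c * Y (0, 1)‖ ^ 2 := by positivity
  have s1 : 0 ≤ (ε + ε ^ 2) * ‖Y (1, 0)‖ ^ 2 := by positivity
  have s2 : 0 ≤ (ε + ε ^ 2) * ‖Y (1, 1)‖ ^ 2 := by positivity
  linarith

/-- A positive sequence `ε n → 0` such that the commutators with the quantized test pairs have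
norm at most `1 + ε n`. -/
theorem exists_norm_comm_testPair_le {θ : ℝ} (hθ : 0 < θ) {g : Alg} (hg : ‖l2 g‖ = 1) {Λ : ℂ}
    {v : Plane} {s : ℝ} (hv : ‖v‖ ^ 2 + ‖Λ‖ ^ 2 * s ^ 2 ≤ 1) :
    ∃ ε : ℕ → ℝ, (∀ n, 0 < ε n) ∧ Filter.Tendsto ε Filter.atTop (nhds 0) ∧ ∀ n Ψ,
      ‖((moyalTriple θ).double grading Λ).core (((moyalTriple θ).double grading Λ).comm
          (fun i => quant θ g (testPair v s n i)) Ψ)‖ ≤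
        (1 + ε n) * ‖((moyalTriple θ).double grading Λ).core Ψ‖ := by
  obtain ⟨C, hC0, hC⟩ := exists_partialDeriv_cutoff_le
  have hpos (n : ℕ) : 0 < ((n : ℝ) + 1)⁻¹ * (|s| * (C + C) + 1) := by positivity
  refine ⟨fun n => ((n : ℝ) + 1)⁻¹ * (|s| * (C + C) + 1), hpos, ?_, fun n Ψ => ?_⟩
  · simpa using tendsto_inv_succ.mul_const (|s| * (C + C) + 1)
  have h0 : (0 : ℝ) ≤ ((n : ℝ) + 1)⁻¹ := by positivity
  refine norm_double_comm_quant_le hθ hg Λ _ (by linarith [hpos n]) (fun x Y => ?_) Ψ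
  refine sum_commSymbol_le (hpos n) hv ?_ Y
  calc |s| * (‖partialDeriv 0 (cutoff n) x‖ + ‖partialDeriv 1 (cutoff n) x‖)
      ≤ |s| * (((n : ℝ) + 1)⁻¹ * C + ((n : ℝ) + 1)⁻¹ * C) := by
        gcongr
        · exact (hC n 0 x).1
        · exact (hC n 1 x).1
    _ ≤ _ := by linarith

section lower

variable {θ : ℝ} {φ : Alg →ₗ[ℂ] ℂ}

/-- The state is integration against a probability density on quantized symbols, so that its values
converge to those expected for the uncut symbols `(v · x + s, v · x)`. -/
theorem tendsto_apply_testPair (hθ : 0 < θ) {g : Alg} (hg : ‖l2 g‖ = 1) (hφ : IsState θ φ)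
    (v : Plane) (s : ℝ) (κ κ' : Plane) :
    Filter.Tendsto (fun n => φ (translate κ (quant θ g (testPair v s n 0))) -
        φ (translate κ' (quant θ g (testPair v s n 1)))) Filter.atTop
      (nhds ((inner ℝ v (κ - κ') + s : ℝ) : ℂ)) := by
  have hval (n : ℕ) : φ (translate κ (quant θ g (testPair v s n 0))) -
        φ (translate κ' (quant θ g (testPair v s n 1))) =
      ∫ x, (ramp v n (x + κ) - ramp v n (x + κ') + s * cutoff n (x + κ)) * husimi θ g φ x := by
    rw [← map_sub, translate_quant, translate_quant, ← map_sub,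
      apply_quant_eq_integral_husimi hθ hφ]
    refine integral_congr_ae (.of_forall fun x => ?_)
    simp only [testPair, sub_apply, translate_apply, Matrix.cons_val_zero, Matrix.cons_val_one,
      add_apply, smul_apply, smul_eq_mul]
    ring
  have hlim : ((inner ℝ v (κ - κ') + s : ℝ) : ℂ) =
      ∫ x, ((inner ℝ v (κ - κ') + s : ℝ) : ℂ) * husimi θ g φ x := by
    rw [integral_const_mul, integral_complex_ofReal, integral_husimi hθ hg hφ]
    simp
  simp_rw [hval]
  rw [hlim]
  refine tendsto_integral_of_dominated_convergence
    (fun x => (‖v‖ * ‖κ - κ'‖ + |s|) * husimi θ g φ x) (fun n => ?_)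
    ((integrable_husimi hθ hg hφ).const_mul _) (fun n => .of_forall fun x => ?_)
    (.of_forall fun x => ?_)
  · have := continuous_husimi (g := g) hθ hφ
    have h1 := (ramp v n).continuous
    have h2 := (cutoff n).continuous
    exact Continuous.aestronglyMeasurable (by fun_prop)
  · rw [norm_mul, Complex.norm_real, Real.norm_of_nonneg (husimi_nonneg hφ x)]
    have h1 := abs_ramp_sub_le v n (x + κ) (x + κ')
    rw [add_sub_add_left_eq_sub] at h1
    have h2 : ‖(s : ℂ) * cutoff n (x + κ)‖ ≤ |s| := by
      rw [norm_mul, Complex.norm_real, Real.norm_eq_abs]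
      exact mul_le_of_le_one_right (abs_nonneg _) (norm_cutoff_le n _)
    exact mul_le_mul_of_nonneg_right ((norm_add_le _ _).trans (add_le_add h1 h2))
      (husimi_nonneg hφ x)
  · refine Filter.Tendsto.mul_const _ ?_
    have hr (y : Plane) : Filter.Tendsto (fun n => ramp v n y) Filter.atTop
        (nhds ((inner ℝ v y : ℝ) : ℂ)) := by
      simp_rw [ramp_apply]
      refine (Complex.continuous_ofReal.tendsto _).comp ?_
      simpa using (tendsto_cutoffFun y).const_mul (inner ℝ v y)
    have := ((hr (x + κ)).sub (hr (x + κ'))).add ((tendsto_cutoff (x + κ)).const_mul (s : ℂ))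
    convert this using 2
    simp only [inner_add_right, inner_sub_right]
    push_cast
    ring

/-- A vector of norm one with respect to which symbols are quantized. -/
theorem exists_norm_l2_eq_one : ∃ g : Alg, ‖l2 g‖ = 1 := by
  have h : l2 gaussian ≠ 0 := fun h => by
    have h0 := norm_sq_l2 gaussian
    have hg : gaussian = 0 := SchwartzMap.injective_toLp (μ := (volume : Measure Plane)) 2 <| by
      change l2 gaussian = l2 0
      rw [h, map_zero]
    have := congrArg (fun f : Alg => f 0) hg
    have e : gaussian 0 = (Real.exp (-‖(0 : Plane)‖ ^ 2 / 2) : ℂ) := rfl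
    simp [e] at this
  refine ⟨((‖l2 gaussian‖⁻¹ : ℝ) : ℂ) • gaussian, ?_⟩
  rw [map_smul, norm_smul, Complex.norm_real, norm_inv, norm_norm,
    inv_mul_cancel₀ (norm_ne_zero_iff.2 h)]

theorem ofReal_le_of_tendsto {ε : ℕ → ℝ} {z : ℕ → ℂ} {t : ℝ} {d : ℝ≥0∞}
    (hε : Filter.Tendsto ε Filter.atTop (nhds 0))
    (hz : Filter.Tendsto z Filter.atTop (nhds (t : ℂ)))
    (h : ∀ n, ENNReal.ofReal ((1 + ε n)⁻¹ * ‖z n‖) ≤ d) : ENNReal.ofReal t ≤ d := by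
  have h1 : Filter.Tendsto (fun n => (1 + ε n)⁻¹ * ‖z n‖) Filter.atTop (nhds |t|) := by
    simpa using ((hε.const_add 1).inv₀ (by simp)).mul hz.norm
  refine (ENNReal.ofReal_le_ofReal (le_abs_self t)).trans ?_
  exact le_of_tendsto ((ENNReal.continuous_ofReal.tendsto _).comp h1) (.of_forall h)

theorem le_double_dist (hθ : 0 < θ) (hφ : IsState θ φ) {Λ : ℂ} {v : Plane} {s : ℝ}
    (hv : ‖v‖ ^ 2 + ‖Λ‖ ^ 2 * s ^ 2 ≤ 1) (κ κ' : Plane) :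
    ENNReal.ofReal (inner ℝ v (κ - κ') + s) ≤
      ((moyalTriple θ).double grading Λ).spectralDist (sheet (φ ∘ₗ translate κ) 0)
        (sheet (φ ∘ₗ translate κ') 1) := by
  obtain ⟨g, hg⟩ := exists_norm_l2_eq_one
  obtain ⟨ε, hpos, hε, h⟩ := exists_norm_comm_testPair_le hθ hg hv
  refine ofReal_le_of_tendsto hε (tendsto_apply_testPair hθ hg hφ v s κ κ') fun n => ?_
  exact ((moyalTriple θ).double grading Λ).ofReal_le_spectralDist
    (φ₁ := sheet (φ ∘ₗ translate κ) 0) (φ₂ := sheet (φ ∘ₗ translate κ') 1)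
    (a := fun i => quant θ g (testPair v s n i)) (by linarith [hpos n]) (h n)

/-- The lower bound on the plane is read off from the product for `Λ = 0`, with equal elements on
both sheets. -/
theorem le_moyal_dist (hθ : 0 < θ) (hφ : IsState θ φ) {v : Plane} (hv : ‖v‖ ≤ 1)
    (κ κ' : Plane) : ENNReal.ofReal (inner ℝ v (κ - κ')) ≤
      (moyalTriple θ).spectralDist (φ ∘ₗ translate κ) (φ ∘ₗ translate κ') := by
  obtain ⟨g, hg⟩ := exists_norm_l2_eq_one
  obtain ⟨ε, hpos, hε, h⟩ := exists_norm_comm_testPair_le (Λ := 0) (v := v) (s := 0) hθ hg (by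
    simpa using pow_le_one₀ (n := 2) (norm_nonneg v) hv)
  have hlim := tendsto_apply_testPair hθ hg hφ v 0 κ κ'
  rw [add_zero] at hlim
  refine ofReal_le_of_tendsto hε hlim fun n => ?_
  have e : testPair v 0 n 0 = testPair v 0 n 1 := by simp [testPair]
  rw [e]
  refine (moyalTriple θ).ofReal_le_spectralDist (φ₁ := φ ∘ₗ translate κ)
    (φ₂ := φ ∘ₗ translate κ') (a := quant θ g (testPair v 0 n 1)) (by linarith [hpos n])
    fun ψ => ?_
  -- spinors supported on the first sheet
  have h1 := pow_le_pow_left₀ (norm_nonneg _) (h n ![ψ, 0]) 2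
  refine le_of_sq_le_sq ?_ (by have := hpos n; positivity)
  rw [mul_pow, norm_sq_double_core, norm_sq_double_core, Fintype.sum_prod_type,
    Fintype.sum_prod_type] at h1
  rw [mul_pow, norm_sq_core, norm_sq_core]
  simp only [double_comm_apply] at h1
  simpa [diracI, e] using h1

theorem moyal_dist (hθ : 0 < θ) (hφ : IsState θ φ) (κ κ' : Plane) :
    (moyalTriple θ).spectralDist (φ ∘ₗ translate κ) (φ ∘ₗ translate κ') =
      ENNReal.ofReal ‖κ - κ'‖ := by
  refine le_antisymm (moyal_dist_le hθ hφ κ κ') ?_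
  have h := le_moyal_dist hθ hφ (v := ‖κ - κ'‖⁻¹ • (κ - κ')) (by
    rw [norm_smul, norm_inv, norm_norm]; exact inv_mul_le_one) κ κ'
  rwa [real_inner_smul_left, real_inner_self_eq_norm_sq, sq, ← mul_assoc, inv_mul_mul_self] at h

theorem double_dist (hθ : 0 < θ) (hφ : IsState θ φ) {Λ : ℂ} (hΛ : Λ ≠ 0) (κ κ' : Plane) :
    ((moyalTriple θ).double grading Λ).spectralDist (sheet (φ ∘ₗ translate κ) 0)
        (sheet (φ ∘ₗ translate κ') 1) = ENNReal.ofReal (√(‖κ - κ'‖ ^ 2 + ‖Λ‖⁻¹ ^ 2)) := by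
  refine le_antisymm (double_dist_le hθ hφ hΛ κ κ') ?_
  have hΛ' : 0 < ‖Λ‖ := norm_pos_iff.2 hΛ
  set R := √(‖κ - κ'‖ ^ 2 + ‖Λ‖⁻¹ ^ 2) with hRdef
  have hR : 0 < R := Real.sqrt_pos.2 (by positivity)
  have hR2 : R ^ 2 = ‖κ - κ'‖ ^ 2 + ‖Λ‖⁻¹ ^ 2 := Real.sq_sqrt (by positivity)
  -- the maximizer of `inner v (κ - κ') + s` under `‖v‖² + |Λ|² s² ≤ 1`
  have h := le_double_dist hθ hφ (Λ := Λ) (v := R⁻¹ • (κ - κ')) (s := R⁻¹ * ‖Λ‖⁻¹ ^ 2) (by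
    rw [norm_smul, norm_inv, Real.norm_of_nonneg hR.le]
    have : (R⁻¹ * ‖κ - κ'‖) ^ 2 + ‖Λ‖ ^ 2 * (R⁻¹ * ‖Λ‖⁻¹ ^ 2) ^ 2 =
        R⁻¹ ^ 2 * (‖κ - κ'‖ ^ 2 + ‖Λ‖⁻¹ ^ 2) := by field_simp
    rw [this, ← hR2, ← mul_pow, inv_mul_cancel₀ hR.ne', one_pow]) κ κ'
  rwa [real_inner_smul_left, real_inner_self_eq_norm_sq, ← mul_add, ← hR2, sq,
    inv_mul_cancel_left₀ hR.ne'] at h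

theorem double_dist_zero (hθ : 0 < θ) (hφ : IsState θ φ) (κ κ' : Plane) :
    ((moyalTriple θ).double grading 0).spectralDist (sheet (φ ∘ₗ translate κ) 0)
        (sheet (φ ∘ₗ translate κ') 1) = ⊤ := by
  refine ENNReal.eq_top_of_forall_nnreal_le fun r => ?_
  have := le_double_dist hθ hφ (Λ := 0) (v := 0) (s := r) (by simp) κ κ'
  simpa using this

end lower

end MoyalPlane

end

theorem mainTheorem3 (θ : ℝ) (hθ : 0 < θ) (Λ : ℂ)
    (φ : MoyalPlane.Alg →ₗ[ℂ] ℂ) (hφ : MoyalPlane.IsState θ φ)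
    (ω ω' : MoyalPlane.Alg →ₗ[ℂ] ℂ)
    (hω : ω ∈ MoyalPlane.translates φ) (hω' : ω' ∈ MoyalPlane.translates φ) :
    ((MoyalPlane.moyalTriple θ).double MoyalPlane.grading Λ).spectralDist
        (MoyalPlane.sheet ω 0) (MoyalPlane.sheet ω' 1) ^ 2 =
      (MoyalPlane.moyalTriple θ).spectralDist ω ω' ^ 2 +
        (MoyalPlane.twoPoint Λ).spectralDist (MoyalPlane.delta 0) (MoyalPlane.delta 1) ^ 2 := by
  obtain ⟨κ, rfl⟩ := hω
  obtain ⟨κ', rfl⟩ := hω'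
  dsimp only
  rcases eq_or_ne Λ 0 with rfl | hΛ
  · rw [MoyalPlane.double_dist_zero hθ hφ, MoyalPlane.twoPoint_dist_zero]
    simp
  · rw [MoyalPlane.double_dist hθ hφ hΛ, MoyalPlane.moyal_dist hθ hφ,
      MoyalPlane.twoPoint_dist hΛ, ← ENNReal.ofReal_pow (by positivity),
      ← ENNReal.ofReal_pow (by positivity), ← ENNReal.ofReal_pow (by positivity),
      ← ENNReal.ofReal_add (by positivity) (by positivity), Real.sq_sqrt (by positivity)]
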